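/- Let $G$ be an $n$-dimensional real Lie group with Lie algebra $\mathfrak g$ and left Haar measure $m$, and let $\hbar\in\mathbb R\setminus\{0\}$. Assume that there is an open, star-shaped neighbourhood $\mathcal O=-\mathcal O$ of $0$ in $\mathfrak g$ such that $\exp$ maps $\mathcal O$ diffeomorphically onto $\mathcal U=\exp(\mathcal O)$, such that $G\setminus\mathcal U$ has measure zero, and such that $\exp^{-1}:\mathcal U\to\mathcal O$ maps every subset of $\mathcal U$ with compact closure in $G$ to a set with compact closure in $\mathfrak g$. Fix such an $\mathcal O$. Let $dX$ be the Lebesgue measure on $\mathfrak g$ given by the invariant volume form of $m$ at the unit element, $dp$ the dual measure on $\mathfrak g^*$ (so that $\hat u(p)=\int u(X)e^{-i\langle p,X\rangle}dX$ is inverted by $u(X)=(2\pi)^{-n}\int \hat u(p)e^{i\langle p,X\rangle}dp$), $M=G\times\mathfrak g^*\cong T^*G$, and $dl=|2\pi\hbar|^{-n}\,dm\,dp$. Let $\mathcal L(M)\subset L^2(M,dl)$ be the Hilbert space of the inverse momentum Fourier transforms $f(q,p)=\int_{\mathfrak g}\tilde f(q,X)e^{-\frac i\hbar\langle p,X\rangle}dX$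 of the functions $\tilde f\in L^2(G\times\mathfrak g,dm\,dX)$ with support in $G\times\overline{\mathcal O}$, with scalar product $(f,g)=\int_M\bar f g\,dl$ and norm $\|\cdot\|_2$. Put $F(X)=\sqrt{|\det\lambda(\mathrm{ad}_X)|}$ with $\lambda(x)=\frac2x\sinh\frac x2$. Let $\mathcal F(M)\subset\mathcal L(M)$ consist of those $f$ for which $(a,b)\mapsto\tilde f\bigl(a\exp(\tfrac12V),V\bigr)F(V)^{-1}$, where $V=\exp^{-1}(a^{-1}b)\in\mathcal O$ and $a^{-1}b\in\mathcal U$, extends to a smooth compactly supported function on $G\times G$. For $X,Y\in\mathcal O$ with $\exp X\exp Y\in\mathcal U$ let $X\diamond Y=\exp^{-1}(\exp X\exp Y)\in\mathcal O$ and $L(X,Y)=F(X)F(Y)/F(X\diamond Y)$, and let $L(X,Y)=0$ for all other pairs. The star-product of $f,g\in\mathcal F(M)$ is $$(f\star g)(q,p)=\int_{\mathfrak g\times\mathfrak g}\tilde f\bigl(q\exp(-\tfrac12(X\diamond Y))\exp(\tfrac12X),X\bigr)\,\tilde g\bigl(q\exp(\tfrac12(X\diamond Y))\exp(-\tfrac12Y),Y\bigr)e^{-\frac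 i\hbar\langle p,X\diamond Y\rangle}L(X,Y)\,dX\,dY .$$ It is extended to $\mathcal L(M)$ by $\|\cdot\|_2$-continuity. The functional $\int_M\cdot\,dl$ is defined on $\mathcal L(M)\star\mathcal L(M)$ by $\int_M\bar f\star g\,dl=(f,g)$; a statement about $\int_M u\,dl$ includes that $u\in\mathcal L(M)\star\mathcal L(M)$. Let $\mathcal A(M)$ be the $C^*$-algebra completing $\mathcal L(M)$, with product $\star$ and involution $f\mapsto\bar f$, in the norm $\|f\|=\sup\{\|f\star h\|_2: h\in\mathcal F(M),\ \|h\|_2=1\}$. A state is a continuous linear functional $\Lambda$ on $\mathcal A(M)$ with $\|\Lambda\|=1$ and $\Lambda(\bar f\star f)\ge0$ for all $f\in\mathcal A(M)$. **Theorem.** If $\rho\in\mathcal L(M)$ satisfies (i) $\bar\rho=\rho$, (ii) $\int_M\rho\,dl=1$, and (iii) $\int_M\bar f\star f\star\rho\,dl\ge0$ for every $f\in\mathcal F(M)$, then $$\Lambda_\rho(f)=\int_M f\star\rho\,dl=\int_M f\cdot\rho\,dl\qquad(f\in\mathcal L(M))$$ extends uniquely to a continuous linear functional $\Lambda_\rho$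 on $\mathcal A(M)$, and $\Lambda_\rho$ is a state. Conversely, for every state $\Lambda$ on $\mathcal A(M)$ there is a unique $\rho\in\mathcal L(M)$ satisfying (i)–(iii) such that $\Lambda=\Lambda_\rho$. -/

import Mathlib

open MeasureTheory Set Filter Topology
open scoped Manifold ContDiff ENNReal ComplexOrder ComplexConjugate

noncomputable section

namespace LieStar

/-! `G` is a finite-dimensional real Lie group modelled on `E`. Its Lie algebra `T_1 G` is, by the
definition of tangent spaces, the vector space `E`; the Lie bracket is the one of left-invariant
vector fields. The dual of the Lie algebra is `StrongDual ℝ E`, and the phase space `T^*G`, left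
trivialized, is `G × StrongDual ℝ E`. -/

/-! ### The exponential map and the domain `𝒪` -/

section LieGroupBasics

variable {E : Type*} [NormedAddCommGroup E] [NormedSpace ℝ E]
  {G : Type*} [TopologicalSpace G] [ChartedSpace E G] [Group G]

variable (G) in
/-- The exponential map: `exp X = γ 1`, with `γ` the integral curve through `1` of the
left-invariant vector field of `X`. -/
def lieExp (X : E) : G :=
  open Classical in
  if h : ∃ γ : ℝ → G, γ 0 = 1 ∧
      IsMIntegralCurve γ (mulInvariantVectorField (I := 𝓘(ℝ, E)) (G := G) X)
  then h.choose 1 else 1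

/-- The inverse of `exp|_𝒪`, defined on `𝒰 = exp 𝒪`. -/
def lieLog (𝒪 : Set E) (g : G) : E := Function.invFunOn (lieExp G) 𝒪 g

/-- `𝒪` is an open, star-shaped, symmetric neighbourhood of `0` in the Lie algebra which `exp` maps
diffeomorphically onto a subset `𝒰 = exp 𝒪` of `G` with null complement, and
`exp⁻¹ : 𝒰 → 𝒪` maps precompact sets to precompact sets. -/
structure IsExpDomain [MeasurableSpace G] (m : Measure G) (𝒪 : Set E) : Prop where
  isOpen : IsOpen 𝒪
  zero_mem : (0 : E) ∈ 𝒪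
  smul_mem : ∀ X ∈ 𝒪, ∀ t ∈ Icc (-1 : ℝ) 1, t • X ∈ 𝒪
  injOn : InjOn (lieExp G) 𝒪
  isOpen_image : IsOpen (lieExp G '' 𝒪)
  contMDiffOn_exp : ContMDiffOn 𝓘(ℝ, E) 𝓘(ℝ, E) ∞ (lieExp G) 𝒪
  contMDiffOn_log : ContMDiffOn 𝓘(ℝ, E) 𝓘(ℝ, E) ∞ (lieLog (G := G) 𝒪) (lieExp G '' 𝒪)
  null_compl : m (lieExp G '' 𝒪)ᶜ = 0
  precompact : ∀ S ⊆ lieExp G '' 𝒪, IsCompact (closure S) →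
    IsCompact (closure (lieLog 𝒪 '' S))

variable (G) in
/-- The Baker-Campbell-Hausdorff product `X ⋄ Y = exp⁻¹ (exp X exp Y)`. -/
def bch (𝒪 : Set E) (X Y : E) : E := lieLog 𝒪 (lieExp G X * lieExp G Y)

variable (G) in
/-- The domain `𝒱` of the Baker-Campbell-Hausdorff product. -/
def bchDomain (𝒪 : Set E) : Set (E × E) :=
  {Z | Z.1 ∈ 𝒪 ∧ Z.2 ∈ 𝒪 ∧ lieExp G Z.1 * lieExp G Z.2 ∈ lieExp G '' 𝒪}

instance [LieGroup 𝓘(ℝ, E) ∞ G] : LieGroup 𝓘(ℝ, E) (minSmoothness ℝ 3) G :=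
  LieGroup.of_le (n := ∞) (by
    rw [minSmoothness_of_isRCLikeNormedField]; exact WithTop.coe_le_coe.2 le_top)

variable [FiniteDimensional ℝ E] [LieGroup 𝓘(ℝ, E) ∞ G]

variable (G) in
/-- `ad_X` as a continuous linear operator on the Lie algebra. -/
def adOp (X : E) : E →L[ℝ] E :=
  LinearMap.toContinuousLinearMap (LieAlgebra.ad ℝ (GroupLieAlgebra 𝓘(ℝ, E) G) X : E →ₗ[ℝ] E)

variable (G) in
/-- `F X = √|det λ(ad_X)|`, where `λ(x) = (2 / x) sinh (x / 2) = ∑ x^(2k) / (4^k (2k+1)!)`. -/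
def jacF (X : E) : ℝ :=
  √|(∑' k : ℕ, ((4 : ℝ) ^ k * (2 * k + 1).factorial)⁻¹ • adOp G X ^ (2 * k)).det|

variable (G) in
/-- `L(X, Y) = F(X) F(Y) / F(X ⋄ Y)` on `𝒱`, and `0` outside. -/
def jacL (𝒪 : Set E) (X Y : E) : ℝ :=
  open Classical in
  if (X, Y) ∈ bchDomain G 𝒪 then jacF G X * jacF G Y / jacF G (bch G 𝒪 X Y) else 0

end LieGroupBasics

/-! ### Measures -/

section Measures

variable {E : Type*} [NormedAddCommGroup E] [NormedSpace ℝ E] [FiniteDimensional ℝ E]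
  [MeasurableSpace E] [BorelSpace E]

/-- `ν` is the Haar measure on the dual of `E` for which, with
`f̂(p) = ∫ f(X) e^{-i⟨p,X⟩} dμ(X)`, the inversion formula
`f(X) = (2π)^{-n} ∫ f̂(p) e^{i⟨p,X⟩} dν(p)` holds. -/
def IsDualMeasure (μ : Measure E) (ν : Measure (StrongDual ℝ E)) : Prop :=
  ν.IsAddHaarMeasure ∧
  ∀ f : E → ℂ, Continuous f → Integrable f μ →
    Integrable (fun p : StrongDual ℝ E => ∫ X, f X * Complex.exp (-Complex.I * (p X : ℂ)) ∂μ) ν →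
    ∀ X : E, f X = ((2 * Real.pi : ℂ) ^ Module.finrank ℝ E)⁻¹ *
      ∫ p, (∫ Y, f Y * Complex.exp (-Complex.I * (p Y : ℂ)) ∂μ) *
        Complex.exp (Complex.I * (p X : ℂ)) ∂ν

/-- The measure `dp` on the dual of `E` determined by the measure `μ = dX` on `E`. -/
def dualMeasure (μ : Measure E) : Measure (StrongDual ℝ E) :=
  Classical.epsilon (IsDualMeasure μ)

variable {G : Type*} [TopologicalSpace G] [ChartedSpace E G] [Group G] [MeasurableSpace G]

/-- The measure `dX` on the Lie algebra given by the value at the unit element of the invariant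
volume form of `m`: the translation-invariant measure which agrees with `m` (transported by `exp`)
infinitesimally at `0`. -/
def algMeasure (m : Measure G) : Measure E :=
  limUnder (𝓝[>] (0 : ℝ)) (fun r : ℝ =>
      m (lieExp G '' Metric.ball (0 : E) r) / (Measure.addHaar : Measure E) (Metric.ball 0 r)) •
    (Measure.addHaar : Measure E)

/-- The measure `dn = dm × dX` on `G × 𝔤`. -/
def measN (m : Measure G) : Measure (G × E) := m.prod (algMeasure m)

/-- The normalized Liouville measure `dl = |2πħ|^{-n} dm × dp` on the phase space. -/
def measL (ħ : ℝ) (m : Measure G) : Measure (G × StrongDual ℝ E) :=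
  ENNReal.ofReal ((|2 * Real.pi * ħ| ^ Module.finrank ℝ E)⁻¹) •
    m.prod (dualMeasure (algMeasure (E := E) m))

/-- The inverse momentum Fourier transform `∫ ψ(q,X) e^{-(i/ħ)⟨p,X⟩} dX`, as an integral. -/
def invMomentumFourier (ħ : ℝ) (m : Measure G) (ψ : G × E → ℂ) (x : G × StrongDual ℝ E) : ℂ :=
  ∫ X, ψ (x.1, X) * Complex.exp (-(Complex.I / ħ) * (x.2 X : ℂ)) ∂(algMeasure (E := E) m)

/-- The `L²` inverse momentum Fourier transform, as a subspace of pairs `(f̃, f)`: the integral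
transform on continuous compactly supported functions, extended by continuity in `L²`. -/
def invMomentumFourierL2 (ħ : ℝ) (m : Measure G) :
    Submodule ℂ (Lp ℂ 2 (measN (E := E) m) × Lp ℂ 2 (measL (E := E) ħ m)) :=
  (Submodule.span ℂ {u | ∃ ψ : G × E → ℂ, Continuous ψ ∧ HasCompactSupport ψ ∧
    u.1 =ᵐ[measN m] ψ ∧ u.2 =ᵐ[measL ħ m] invMomentumFourier ħ m ψ}).topologicalClosure

/-- The Hilbert space `L²(G × 𝒪, dn)` of square integrable functions on `G × 𝔤` with support in
`G × closure 𝒪`. -/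
def tildeL (m : Measure G) (𝒪 : Set E) : Submodule ℂ (Lp ℂ 2 (measN (E := E) m)) where
  carrier := {u | ∀ᵐ x ∂(measN (E := E) m), x.2 ∉ closure 𝒪 → u x = 0}
  zero_mem' := by
    filter_upwards [Lp.coeFn_zero ℂ 2 (measN (E := E) m)] with x hx _
    simpa using hx
  add_mem' := by
    intro u v hu hv
    filter_upwards [hu, hv, Lp.coeFn_add u v] with x h1 h2 h3 hx
    rw [h3, Pi.add_apply, h1 hx, h2 hx, add_zero]
  smul_mem' := by
    intro c u hu
    filter_upwards [hu, Lp.coeFn_smul c u] with x h1 h2 hx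
    rw [h2, Pi.smul_apply, h1 hx, smul_zero]

/-- The space `ℒ(M)` as a closed subspace of `L²(M, dl)`: the image of `L²(G × 𝒪, dn)` under the
inverse momentum Fourier transform. (The transform is isometric, so that the image is closed;
taking the closure only makes completeness evident.) -/
def subspaceL (ħ : ℝ) (m : Measure G) (𝒪 : Set E) : Submodule ℂ (Lp ℂ 2 (measL (E := E) ħ m)) :=
  Submodule.topologicalClosure <|
    ((tildeL m 𝒪).comap (LinearMap.fst ℂ _ _) ⊓ invMomentumFourierL2 ħ m).map
      (LinearMap.snd ℂ _ _)

instance (ħ : ℝ) (m : Measure G) (𝒪 : Set E) : CompleteSpace (subspaceL ħ m 𝒪) :=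
  (Submodule.isClosed_topologicalClosure _).completeSpace_coe

/-- The Hilbert space `ℒ(M)`, with the scalar product `(f, g) = ∫ conj f · g dl` of `L²(M, dl)`. -/
def LM (ħ : ℝ) (m : Measure G) (𝒪 : Set E) : Type _ := subspaceL ħ m 𝒪

namespace LM

variable {ħ : ℝ} {m : Measure G} {𝒪 : Set E}

instance : NormedAddCommGroup (LM ħ m 𝒪) := inferInstanceAs (NormedAddCommGroup (subspaceL ħ m 𝒪))

instance : InnerProductSpace ℂ (LM ħ m 𝒪) :=
  inferInstanceAs (InnerProductSpace ℂ (subspaceL ħ m 𝒪))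

instance : CompleteSpace (LM ħ m 𝒪) :=
  inferInstanceAs (CompleteSpace (subspaceL ħ m 𝒪))

/-- The inclusion of `ℒ(M)` into `L²(M, dl)`. -/
def toLp (f : LM ħ m 𝒪) : Lp ℂ 2 (measL (E := E) ħ m) := Subtype.val (p := (· ∈ subspaceL ħ m 𝒪)) f

/-- A function on the phase space (determined a.e.) representing an element of `ℒ(M)`. -/
def fn (f : LM ħ m 𝒪) : G × StrongDual ℝ E → ℂ := f.toLp

end LM

/-- Complex conjugation on `ℒ(M)`: the element of `ℒ(M)` which is a.e. equal to `conj f`. -/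
def conjLM {ħ : ℝ} {m : Measure G} {𝒪 : Set E} (f : LM ħ m 𝒪) : LM ħ m 𝒪 :=
  Classical.epsilon fun g : LM ħ m 𝒪 => g.fn =ᵐ[measL ħ m] fun x => conj (f.fn x)

end Measures

/-! ### The space `ℱ(M)`, the star-product, and its extension to `ℒ(M)` -/

section Star

variable {E : Type*} [NormedAddCommGroup E] [NormedSpace ℝ E] [FiniteDimensional ℝ E]
  [MeasurableSpace E] [BorelSpace E]
  {G : Type*} [TopologicalSpace G] [ChartedSpace E G] [Group G] [MeasurableSpace G]
  [LieGroup 𝓘(ℝ, E) ∞ G]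

/-- `f̃` belongs to the space `ℱ̃(M)`: it is supported in `G × 𝒪`, and the function
`(a, b) ↦ f̃(a exp(V/2), V) F(V)⁻¹` with `V = V_a(b) = exp⁻¹(a⁻¹ b)`, defined for `a⁻¹ b ∈ 𝒰`,
extends to a smooth compactly supported function `k` on `G × G`. -/
def IsTildeF (𝒪 : Set E) (f : G × E → ℂ) : Prop :=
  (∀ (q : G) (X : E), X ∉ 𝒪 → f (q, X) = 0) ∧
  ∃ k : G × G → ℂ, ContMDiff (𝓘(ℝ, E).prod 𝓘(ℝ, E)) 𝓘(ℝ, ℂ) ∞ k ∧ HasCompactSupport k ∧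
    ∀ a b : G, a⁻¹ * b ∈ lieExp G '' 𝒪 →
      k (a, b) = f (a * lieExp G ((1 / 2 : ℝ) • lieLog 𝒪 (a⁻¹ * b)), lieLog 𝒪 (a⁻¹ * b)) *
        ((jacF G (lieLog 𝒪 (a⁻¹ * b)))⁻¹ : ℝ)

/-- The space `ℱ(M)`: the inverse momentum Fourier transforms of the elements of `ℱ̃(M)`. -/
def FM (ħ : ℝ) (m : Measure G) (𝒪 : Set E) : Set (LM ħ m 𝒪) :=
  {f | ∃ φ : G × E → ℂ, IsTildeF 𝒪 φ ∧
    f.fn =ᵐ[measL ħ m] invMomentumFourier ħ m φ}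

/-- The integral formula for `f ⋆ g` in terms of the momentum Fourier transforms `φ = f̃` and
`χ = g̃`. -/
def starIntegral (ħ : ℝ) (m : Measure G) (𝒪 : Set E) (φ χ : G × E → ℂ)
    (x : G × StrongDual ℝ E) : ℂ :=
  ∫ Z : E × E,
    φ (x.1 * lieExp G (-(1 / 2 : ℝ) • bch G 𝒪 Z.1 Z.2) * lieExp G ((1 / 2 : ℝ) • Z.1), Z.1) *
    χ (x.1 * lieExp G ((1 / 2 : ℝ) • bch G 𝒪 Z.1 Z.2) * lieExp G (-(1 / 2 : ℝ) • Z.2), Z.2) *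
    Complex.exp (-(Complex.I / ħ) * (x.2 (bch G 𝒪 Z.1 Z.2) : ℂ)) *
    (jacL G 𝒪 Z.1 Z.2 : ℂ) ∂((algMeasure (E := E) m).prod (algMeasure (E := E) m))

/-- The graph of the star-product `ℱ(M) × ℱ(M) → ℱ(M)`. -/
def starGraph (ħ : ℝ) (m : Measure G) (𝒪 : Set E) :
    Set (LM ħ m 𝒪 × LM ħ m 𝒪 × LM ħ m 𝒪) :=
  {t | ∃ φ χ : G × E → ℂ, IsTildeF 𝒪 φ ∧ IsTildeF 𝒪 χ ∧
    t.1.fn =ᵐ[measL ħ m] invMomentumFourier ħ m φ ∧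
    t.2.1.fn =ᵐ[measL ħ m] invMomentumFourier ħ m χ ∧
    t.2.2.fn =ᵐ[measL ħ m] starIntegral ħ m 𝒪 φ χ}

/-- The star-product on `ℒ(M)`: the extension of the star-product of `ℱ(M)` by continuity in the
`L²` norm. -/
def starProd {ħ : ℝ} {m : Measure G} {𝒪 : Set E} (f g : LM ħ m 𝒪) : LM ħ m 𝒪 :=
  Classical.epsilon fun h => (f, g, h) ∈ closure (starGraph ħ m 𝒪)

/-- `HasTrace u t`: the element `u` of `ℒ(M)` lies in `ℒ(M) ⋆ ℒ(M)`, the domain of the functional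
`∫_M · dl` extended by `∫_M conj f ⋆ g dl = (f, g)`, and `∫_M u dl = t`. -/
def HasTrace {ħ : ℝ} {m : Measure G} {𝒪 : Set E} (u : LM ħ m 𝒪) (t : ℂ) : Prop :=
  ∃ f g : LM ħ m 𝒪, u = starProd (conjLM f) g ∧ t = inner ℂ f g

/-! ### The `C*`-algebra of observables and its states -/

/-- The bounded operator `h ↦ f ⋆ h` on `ℒ(M)`. -/
def leftMul {ħ : ℝ} {m : Measure G} {𝒪 : Set E} (f : LM ħ m 𝒪) :
    LM ħ m 𝒪 →L[ℂ] LM ħ m 𝒪 :=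
  Classical.epsilon fun T => ∀ h, T h = starProd f h

/-- The `C*`-algebra of observables `𝒜(M)`: the completion of `ℒ(M)` in the norm
`‖f‖ = sup {‖f ⋆ h‖₂ | ‖h‖₂ = 1}`, which is the operator norm of `h ↦ f ⋆ h`, realized as the
closed *-algebra of operators on `ℒ(M)` generated by these. -/
def AM (ħ : ℝ) (m : Measure G) (𝒪 : Set E) :
    NonUnitalStarSubalgebra ℂ (LM ħ m 𝒪 →L[ℂ] LM ħ m 𝒪) :=
  (NonUnitalStarAlgebra.adjoin ℂ (range (leftMul (ħ := ħ) (m := m) (𝒪 := 𝒪)))).topologicalClosure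

/-- The canonical map `ℒ(M) → 𝒜(M)`. -/
def toAM {ħ : ℝ} {m : Measure G} {𝒪 : Set E} (f : LM ħ m 𝒪) : AM ħ m 𝒪 :=
  ⟨leftMul f, NonUnitalStarSubalgebra.le_topologicalClosure _
    (NonUnitalStarAlgebra.subset_adjoin ℂ _ (mem_range_self f))⟩

/-- A state: a continuous linear functional on `𝒜(M)` of norm one with `Λ(a* a) ≥ 0`. -/
def IsState {ħ : ℝ} {m : Measure G} {𝒪 : Set E} (Λ : AM ħ m 𝒪 →L[ℂ] ℂ) : Prop :=
  ‖Λ‖ = 1 ∧ ∀ a : AM ħ m 𝒪, 0 ≤ Λ (star a * a)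

/-- The quasi-probability distributions: `ρ ∈ ℒ(M)` with `conj ρ = ρ`, `∫ ρ dl = 1` and
`∫ conj f ⋆ f ⋆ ρ dl ≥ 0` for all `f ∈ ℱ(M)`. -/
structure IsQuasiDensity {ħ : ℝ} {m : Measure G} {𝒪 : Set E} (ρ : LM ħ m 𝒪) : Prop where
  real : conjLM ρ = ρ
  integral_eq_one : HasTrace ρ 1
  nonneg : ∀ f ∈ FM ħ m 𝒪, ∃ t : ℂ, HasTrace (starProd (starProd (conjLM f) f) ρ) t ∧ 0 ≤ t

/-- `Λ = Λ_ρ`, i.e. `Λ` is the continuous linear functional on `𝒜(M)` with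
`Λ(f) = ∫ f ⋆ ρ dl = ∫ f · ρ dl` for `f ∈ ℒ(M)`. -/
def IsLambda {ħ : ℝ} {m : Measure G} {𝒪 : Set E} (ρ : LM ħ m 𝒪) (Λ : AM ħ m 𝒪 →L[ℂ] ℂ) : Prop :=
  ∀ f : LM ħ m 𝒪, HasTrace (starProd f ρ) (Λ (toAM f)) ∧
    Λ (toAM f) = ∫ x, f.fn x * ρ.fn x ∂(measL (E := E) ħ m)

end Star

end LieStar

end

set_option linter.unusedSectionVars false

noncomputable section

namespace LieStar

/-! ### The exponential map -/

section OneParameter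

variable {E : Type*} [NormedAddCommGroup E] [NormedSpace ℝ E] [FiniteDimensional ℝ E]
  {G : Type*} [TopologicalSpace G] [T2Space G] [ChartedSpace E G] [Group G]
  [LieGroup 𝓘(ℝ, E) ∞ G]

/-! The star-product is composition of integral kernels in disguise. The map `(q, X) ↦ (q exp(-X/2),
q exp(X/2))` parametrizes, up to a null set, the pairs of points of `G` by midpoint and difference,
and `f̃(q, X) = F(X) k(q exp(-X/2), q exp(X/2))` is unitary from `L²(G × G)` onto the functions
supported in `G × closure 𝒪`. Followed by the momentum Fourier transform, isometric by Plancherel,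
this gives a unitary map `quantization` from `L²(G × G)` onto `ℒ(M)`. It carries composition of
kernels to `⋆` (`starIntegral_symbolMap`, `starProd_quantization`), the adjoint kernel to complex
conjugation (`conjLM_quantization`), and smooth compactly supported kernels to `ℱ(M)`
(`mem_FM_iff`). So `ℒ(M)` is the algebra of Hilbert-Schmidt operators on `L²(G)`, and `∫ · dl` is
the trace on products of two of them. The theorem is then the correspondence between states of the
compact operators and density matrices.

The geometric input is that `F²` is the correct Jacobian. Let `J = |det|` of the left-trivialized
differential of `exp` and let `Δ` be the modular function. Haar measure is `J dX` in exponential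
coordinates (`map_lieExp`), and the differential is `exp(-ad/2) λ(ad)` (`leftDexp_eq`), hence `J(X)
J(-X) = F(X)⁴`. Inversion on `G` gives `J(-X) = Δ(exp X) J(X)` (`jacJ_neg`). Together `F² = J √Δ`
(`jacF_sq_eq`), which is what both unitarity and the factor `L(X, Y)` of the star-product require.
That `closure 𝒪` may replace `𝒪` rests on `algMeasure_boundary`.

The functional analysis is carried out in an abstract `HilbertAlgebra` having an increasing
approximate unit `e_i` of projections. If `⟨f, f ρ⟩ ≥ 0` for all `f` and `⟨e_i, ρ⟩` stays bounded,
then `ρ = σ σ` with `σ` self-adjoint (`exists_sqrt`). The functional of `ρ` is then the vector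
functional `a ↦ ⟨σ, a σ⟩`, which is positive of norm `‖σ‖² = ∫ ρ dl`. Conversely, a state restricted
to `ℒ(M)` is `L²`-continuous, hence represented by some `ρ` by Riesz. Its norm bounds `⟨e_i, ρ⟩`,
and `exists_sqrt` applies again (`exists_density`). -/

variable (G) in
/-- The left-invariant vector field of `X`. -/
abbrev leftField (X : E) (g : G) : TangentSpace 𝓘(ℝ, E) g :=
  mulInvariantVectorField (I := 𝓘(ℝ, E)) (G := G) X g


lemma leftField_contMDiff (X : E) :
    ContMDiff 𝓘(ℝ, E) 𝓘(ℝ, E).tangent 1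
      (fun g : G => (⟨g, leftField G X g⟩ : TangentBundle 𝓘(ℝ, E) G)) := by
  have h := contMDiff_mulInvariantVectorField (I := 𝓘(ℝ, E)) (G := G) X
  exact h.of_le (by rw [minSmoothness_of_isRCLikeNormedField]; norm_num)

lemma leftField_smul (c : ℝ) (X : E) : leftField G (c • X) = c • leftField G X :=
  mulInvariantVectorField_smul (I := 𝓘(ℝ, E)) (G := G) c X

lemma leftField_mul (g h : G) (X : E) :
    leftField G X (g * h) = mfderiv 𝓘(ℝ, E) 𝓘(ℝ, E) (fun x => g * x) h (leftField G X h) := by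
  have hd : ∀ a b : G, MDifferentiableAt 𝓘(ℝ, E) 𝓘(ℝ, E) (fun x => a * x) b := fun a b =>
    (contMDiff_mul_left (I := 𝓘(ℝ, E)) (n := ∞) (a := a)).mdifferentiable (by simp) b
  have hc : (fun x => g * h * x) = (fun x => g * x) ∘ (fun x => h * x) := by
    ext x; simp [mul_assoc]
  -- Tangent spaces depend on the base point, so `h * 1` cannot simply be rewritten to `h`.
  -- Quantifying over the point lets the equality be substituted instead.
  have key : ∀ k : G, h * 1 = k →
      (mfderiv 𝓘(ℝ, E) 𝓘(ℝ, E) ((fun x => g * x) ∘ (fun x => h * x)) (1 : G) X : E) =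
        mfderiv 𝓘(ℝ, E) 𝓘(ℝ, E) (fun x => g * x) k
          (mfderiv 𝓘(ℝ, E) 𝓘(ℝ, E) (fun x => h * x) (1 : G) X : E) := by
    rintro k rfl
    exact DFunLike.congr_fun (mfderiv_comp (I' := 𝓘(ℝ, E)) (1 : G) (hd g (h * 1)) (hd h 1)) X
  rw [← hc] at key
  exact key h (mul_one h)

/-- An integral curve of the left-invariant vector field of `X` through the unit element. -/
def IsExpCurve (X : E) (γ : ℝ → G) : Prop := γ 0 = 1 ∧ IsMIntegralCurve γ (leftField G X)

lemma IsExpCurve.unique {X : E} {γ γ' : ℝ → G} (h : IsExpCurve X γ) (h' : IsExpCurve X γ') :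
    γ = γ' :=
  isMIntegralCurve_Ioo_eq_of_contMDiff_boundaryless (I := 𝓘(ℝ, E)) (t₀ := 0)
    (leftField_contMDiff X) h.2 h'.2 (h.1.trans h'.1.symm)

lemma IsExpCurve.smul {X : E} {γ : ℝ → G} (h : IsExpCurve X γ) (c : ℝ) :
    IsExpCurve (c • X) (fun t => γ (t * c)) := by
  refine ⟨by simpa using h.1, ?_⟩
  rw [leftField_smul]
  exact h.2.comp_mul c

lemma IsExpCurve.lieExp_eq {X : E} {γ : ℝ → G} (h : IsExpCurve X γ) : lieExp G X = γ 1 := by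
  have hex : ∃ γ : ℝ → G, γ 0 = 1 ∧
      IsMIntegralCurve γ (mulInvariantVectorField (I := 𝓘(ℝ, E)) (G := G) X) := ⟨γ, h⟩
  rw [lieExp, dif_pos hex]
  exact congrFun (IsExpCurve.unique (X := X) hex.choose_spec h) 1

lemma IsExpCurve.lieExp_smul {X : E} {γ : ℝ → G} (h : IsExpCurve X γ) (t : ℝ) :
    lieExp G (t • X) = γ t := by
  simpa using (h.smul t).lieExp_eq

lemma isExpCurve_zero : IsExpCurve (0 : E) (fun _ => (1 : G)) := by
  refine ⟨rfl, fun t => ?_⟩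
  have h0 : leftField G (0 : E) (1 : G) = 0 :=
    map_zero (mfderiv 𝓘(ℝ, E) 𝓘(ℝ, E) (fun x : G => 1 * x) 1)
  have := hasMFDerivAt_const (I := 𝓘(ℝ, ℝ)) (I' := 𝓘(ℝ, E)) (1 : G) t
  have h1 : ContinuousLinearMap.smulRight (1 : ℝ →L[ℝ] ℝ) (leftField G (0 : E) (1 : G)) = 0 := by
    rw [h0]; exact ContinuousLinearMap.smulRight_zero _
  exact h1 ▸ this

lemma lieExp_zero : lieExp G (0 : E) = 1 := isExpCurve_zero.lieExp_eq

variable [MeasurableSpace G] {m : Measure G} {𝒪 : Set E}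

namespace IsExpDomain

lemma mem_nhds (h𝒪 : IsExpDomain m 𝒪) : 𝒪 ∈ 𝓝 (0 : E) := h𝒪.isOpen.mem_nhds h𝒪.zero_mem

/-- No completeness theorem for the left-invariant fields is needed. Where no integral curve exists,
`lieExp` takes the default value `1 = exp 0`, so injectivity on `𝒪` leaves only `X = 0`, which has
the constant curve. Rescaling time passes from `𝒪` to all of the Lie algebra. -/
lemma exists_isExpCurve (h𝒪 : IsExpDomain m 𝒪) (X : E) : ∃ γ : ℝ → G, IsExpCurve X γ := by
  have key : ∀ X ∈ 𝒪, ∃ γ : ℝ → G, IsExpCurve X γ := by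
    intro X hX
    by_contra hne
    have h1 : lieExp G X = 1 := by
      rw [lieExp, dif_neg]
      exact hne
    have : X = 0 := h𝒪.injOn hX h𝒪.zero_mem (h1.trans lieExp_zero.symm)
    exact hne ⟨_, this ▸ isExpCurve_zero⟩
  have hev : ∀ᶠ c in 𝓝 (0 : ℝ), c • X ∈ 𝒪 := by
    have : Tendsto (fun c : ℝ => c • X) (𝓝 0) (𝓝 ((0 : ℝ) • X)) :=
      (continuous_id.smul continuous_const).tendsto 0
    rw [zero_smul] at this
    exact this h𝒪.mem_nhds
  obtain ⟨c, hc, hc0⟩ := ((hev.filter_mono nhdsWithin_le_nhds).and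
    (self_mem_nhdsWithin (s := {0}ᶜ))).exists
  obtain ⟨γ, hγ⟩ := key _ hc
  have := hγ.smul c⁻¹
  rw [smul_smul, inv_mul_cancel₀ hc0, one_smul] at this
  exact ⟨_, this⟩

lemma isExpCurve (h𝒪 : IsExpDomain m 𝒪) (X : E) :
    IsExpCurve X (fun t : ℝ => lieExp G (t • X)) := by
  obtain ⟨γ, hγ⟩ := h𝒪.exists_isExpCurve X
  have : (fun t : ℝ => lieExp G (t • X)) = γ := funext hγ.lieExp_smul
  rwa [this]

/-- With `γ t = exp(tX)`, both `γ(· + s)` and `γ(s) γ(·)` are integral curves of the same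
left-invariant field with the same value at `0`. -/
lemma lieExp_add_smul (h𝒪 : IsExpDomain m 𝒪) (s t : ℝ) (X : E) :
    lieExp G ((s + t) • X) = lieExp G (s • X) * lieExp G (t • X) := by
  have hγ := h𝒪.isExpCurve X
  set γ := fun t : ℝ => lieExp G (t • X) with hγd
  have h1 : IsMIntegralCurve (γ ∘ (· + s)) (leftField G X) := hγ.2.comp_add s
  have h2 : IsMIntegralCurve (fun t => γ s * γ t) (leftField G X) := by
    intro t
    have hd : MDifferentiableAt 𝓘(ℝ, E) 𝓘(ℝ, E) (fun x => γ s * x) (γ t) :=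
      (contMDiff_mul_left (I := 𝓘(ℝ, E)) (n := ∞) (a := γ s)).mdifferentiable (by simp) _
    have := hd.hasMFDerivAt.comp t (hγ.2 t)
    have h1 : ContinuousLinearMap.smulRight (1 : ℝ →L[ℝ] ℝ) (leftField G X (γ s * γ t)) =
        (mfderiv 𝓘(ℝ, E) 𝓘(ℝ, E) (fun x => γ s * x) (γ t)).comp
          (ContinuousLinearMap.smulRight (1 : ℝ →L[ℝ] ℝ) (leftField G X (γ t))) := by
      rw [leftField_mul]
      refine ContinuousLinearMap.ext fun r => ?_
      exact (map_smul (mfderiv 𝓘(ℝ, E) 𝓘(ℝ, E) (fun x => γ s * x) (γ t)) r (leftField G X (γ t))).symm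
    exact h1 ▸ this
  have := isMIntegralCurve_Ioo_eq_of_contMDiff_boundaryless (I := 𝓘(ℝ, E)) (t₀ := 0)
    (leftField_contMDiff X) h1 h2 (by simp [hγ.1])
  have := congrFun this t
  simpa [hγd, add_comm] using this

lemma lieExp_neg (h𝒪 : IsExpDomain m 𝒪) (X : E) : lieExp G (-X) = (lieExp G X)⁻¹ := by
  have := h𝒪.lieExp_add_smul (-1) 1 X
  rw [neg_add_cancel, zero_smul, lieExp_zero, one_smul, neg_one_smul] at this
  exact (inv_eq_of_mul_eq_one_left this.symm).symm

lemma lieExp_nsmul (h𝒪 : IsExpDomain m 𝒪) (n : ℕ) (X : E) :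
    lieExp G ((n : ℝ) • X) = (lieExp G X ^ n : G) := by
  induction n with
  | zero => simp [lieExp_zero]
  | succ k ih => rw [Nat.cast_succ, h𝒪.lieExp_add_smul, ih, one_smul, pow_succ]

/-- Smoothness is assumed on `𝒪` only. It spreads to all of `E` through `exp X = (exp(X/n))^n` with
`X/n ∈ 𝒪` for large `n`. -/
lemma contMDiff_lieExp (h𝒪 : IsExpDomain m 𝒪) :
    ContMDiff 𝓘(ℝ, E) 𝓘(ℝ, E) ∞ (lieExp G : E → G) := by
  intro X
  have hev : ∀ᶠ n : ℕ in atTop, ((n : ℝ)⁻¹) • X ∈ 𝒪 := by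
    have h0 : Tendsto (fun n : ℕ => ((n : ℝ)⁻¹)) atTop (𝓝 0) := tendsto_inv_atTop_nhds_zero_nat
    have : Tendsto (fun n : ℕ => ((n : ℝ)⁻¹) • X) atTop (𝓝 ((0 : ℝ) • X)) :=
      h0.smul tendsto_const_nhds
    rw [zero_smul] at this
    exact this h𝒪.mem_nhds
  obtain ⟨n, hn, hn0⟩ := (hev.and (eventually_gt_atTop 0)).exists
  have hn0' : (n : ℝ) ≠ 0 := by positivity
  have heq : (lieExp G : E → G) = fun x : E => (lieExp G (((n : ℝ)⁻¹) • x) : G) ^ n := by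
    ext x
    rw [← h𝒪.lieExp_nsmul, smul_smul, mul_inv_cancel₀ hn0', one_smul]
  rw [heq]
  have h1 : ContMDiffAt 𝓘(ℝ, E) 𝓘(ℝ, E) ∞ (lieExp G : E → G) (((n : ℝ)⁻¹) • X) :=
    h𝒪.contMDiffOn_exp.contMDiffAt (h𝒪.isOpen.mem_nhds hn)
  have h2 : ContMDiffAt 𝓘(ℝ, E) 𝓘(ℝ, E) ∞ (fun x : E => lieExp G (((n : ℝ)⁻¹) • x)) X :=
    h1.comp X (contDiff_const_smul ((n : ℝ)⁻¹)).contMDiff.contMDiffAt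
  exact ((contMDiff_pow (I := 𝓘(ℝ, E)) (G := G) (n := ∞) n).contMDiffAt).comp X h2

lemma continuous_lieExp (h𝒪 : IsExpDomain m 𝒪) : Continuous (lieExp G : E → G) :=
  h𝒪.contMDiff_lieExp.continuous

lemma lieLog_lieExp (h𝒪 : IsExpDomain m 𝒪) {X : E} (hX : X ∈ 𝒪) :
    lieLog 𝒪 (lieExp G X) = X :=
  h𝒪.injOn.leftInvOn_invFunOn hX

end IsExpDomain

lemma lieExp_lieLog {g : G} (hg : g ∈ lieExp G '' 𝒪) : lieExp G (lieLog 𝒪 g) = g :=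
  Function.invFunOn_eq hg

lemma lieLog_mem {g : G} (hg : g ∈ lieExp G '' 𝒪) : lieLog 𝒪 g ∈ 𝒪 :=
  Function.invFunOn_mem hg

end OneParameter

/-! ### The differential of the exponential map in logarithmic coordinates -/

section LogChart

variable {E : Type*} [NormedAddCommGroup E] [NormedSpace ℝ E] [FiniteDimensional ℝ E]
  {G : Type*} [TopologicalSpace G] [T2Space G] [ChartedSpace E G] [Group G]
  [LieGroup 𝓘(ℝ, E) ∞ G]

variable (G) in
/-- The left-trivialized differential of the exponential map. -/
def leftDexp (𝒪 : Set E) (X : E) : E →L[ℝ] E :=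
  fderiv ℝ (fun x => lieLog 𝒪 (lieExp G (-X) * lieExp G x)) X

/-- The adjoint representation, in logarithmic coordinates. -/
def adRep (𝒪 : Set E) (g : G) : E →L[ℝ] E :=
  fderiv ℝ (fun y => lieLog 𝒪 (g * lieExp G y * g⁻¹)) 0

variable [MeasurableSpace G] {m : Measure G} {𝒪 : Set E}

namespace IsExpDomain

lemma one_mem (h𝒪 : IsExpDomain m 𝒪) : (1 : G) ∈ lieExp G '' 𝒪 := ⟨0, h𝒪.zero_mem, lieExp_zero⟩

lemma lieLog_one (h𝒪 : IsExpDomain m 𝒪) : lieLog 𝒪 (1 : G) = 0 := by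
  rw [← lieExp_zero (E := E) (G := G)]
  exact h𝒪.lieLog_lieExp h𝒪.zero_mem

lemma continuousOn_lieLog (h𝒪 : IsExpDomain m 𝒪) :
    ContinuousOn (lieLog (G := G) 𝒪) (lieExp G '' 𝒪) := h𝒪.contMDiffOn_log.continuousOn

lemma contDiffAt_lieLog_comp (h𝒪 : IsExpDomain m 𝒪) {F : Type*} [NormedAddCommGroup F]
    [NormedSpace ℝ F] {f : F → G} {x : F} (hf : ContMDiffAt 𝓘(ℝ, F) 𝓘(ℝ, E) ∞ f x)
    (hx : f x ∈ lieExp G '' 𝒪) : ContDiffAt ℝ ∞ (fun y => lieLog 𝒪 (f y)) x := by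
  rw [← contMDiffAt_iff_contDiffAt]
  exact ((h𝒪.contMDiffOn_log _ hx).contMDiffAt (h𝒪.isOpen_image.mem_nhds hx)).comp x hf

lemma contMDiffAt_exp_comp (h𝒪 : IsExpDomain m 𝒪) {F : Type*} [NormedAddCommGroup F]
    [NormedSpace ℝ F] {f : F → E} {x : F} (hf : ContDiffAt ℝ ∞ f x) :
    ContMDiffAt 𝓘(ℝ, F) 𝓘(ℝ, E) ∞ (fun y => lieExp G (f y)) x :=
  (h𝒪.contMDiff_lieExp _).comp x hf.contMDiffAt

lemma contMDiff_exp_mul_exp (h𝒪 : IsExpDomain m 𝒪) :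
    ContMDiff 𝓘(ℝ, E × E) 𝓘(ℝ, E) ∞ (fun Z : E × E => lieExp G Z.1 * lieExp G Z.2) :=
  fun _ => (h𝒪.contMDiffAt_exp_comp contDiffAt_fst).mul
    (h𝒪.contMDiffAt_exp_comp contDiffAt_snd)

lemma contDiffAt_bch (h𝒪 : IsExpDomain m 𝒪) {Z : E × E}
    (hZ : lieExp G Z.1 * lieExp G Z.2 ∈ lieExp G '' 𝒪) :
    ContDiffAt ℝ ∞ (fun Z : E × E => bch G 𝒪 Z.1 Z.2) Z :=
  h𝒪.contDiffAt_lieLog_comp (h𝒪.contMDiff_exp_mul_exp Z) hZ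

lemma contDiffAt_conjLog (h𝒪 : IsExpDomain m 𝒪) (g : G) :
    ContDiffAt ℝ ∞ (fun y : E => lieLog 𝒪 (g * lieExp G y * g⁻¹)) 0 := by
  refine h𝒪.contDiffAt_lieLog_comp ?_ (by simpa [lieExp_zero] using h𝒪.one_mem)
  exact (contMDiffAt_const.mul (h𝒪.contMDiffAt_exp_comp contDiffAt_id)).mul contMDiffAt_const

lemma contDiffAt_leftLog (h𝒪 : IsExpDomain m 𝒪) (g : G) {x : E}
    (hx : g * lieExp G x ∈ lieExp G '' 𝒪) :
    ContDiffAt ℝ ∞ (fun y : E => lieLog 𝒪 (g * lieExp G y)) x :=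
  h𝒪.contDiffAt_lieLog_comp (contMDiffAt_const.mul (h𝒪.contMDiffAt_exp_comp contDiffAt_id)) hx

lemma exp_neg_mul_mem (h𝒪 : IsExpDomain m 𝒪) (X : E) :
    lieExp G (-X) * lieExp G X ∈ lieExp G '' 𝒪 := by
  rw [h𝒪.lieExp_neg, inv_mul_cancel]; exact h𝒪.one_mem

lemma hasFDerivAt_leftDexp (h𝒪 : IsExpDomain m 𝒪) (X : E) :
    HasFDerivAt (fun x => lieLog 𝒪 (lieExp G (-X) * lieExp G x)) (leftDexp G 𝒪 X) X :=
  ((h𝒪.contDiffAt_leftLog _ (h𝒪.exp_neg_mul_mem X)).differentiableAt (by simp)).hasFDerivAt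

lemma hasFDerivAt_adRep (h𝒪 : IsExpDomain m 𝒪) (g : G) :
    HasFDerivAt (fun y => lieLog 𝒪 (g * lieExp G y * g⁻¹)) (adRep 𝒪 g) 0 :=
  ((h𝒪.contDiffAt_conjLog g).differentiableAt (by simp)).hasFDerivAt

lemma eventually_mem (h𝒪 : IsExpDomain m 𝒪) {F : Type*} [TopologicalSpace F] {f : F → G} {x : F}
    (hf : ContinuousAt f x) (hx : f x ∈ lieExp G '' 𝒪) : ∀ᶠ y in 𝓝 x, f y ∈ lieExp G '' 𝒪 :=
  hf.eventually (h𝒪.isOpen_image.mem_nhds hx)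

lemma adRep_mul (h𝒪 : IsExpDomain m 𝒪) (g h : G) :
    adRep 𝒪 (g * h) = (adRep 𝒪 g).comp (adRep 𝒪 h) := by
  have := topologicalGroup_of_lieGroup 𝓘(ℝ, E) ∞ (G := G)
  have h1 := h𝒪.hasFDerivAt_adRep h
  have h0 : lieLog 𝒪 (h * lieExp G (0 : E) * h⁻¹) = 0 := by
    simpa [lieExp_zero] using h𝒪.lieLog_one
  have h2 : HasFDerivAt (fun y => lieLog 𝒪 (g * lieExp G y * g⁻¹)) (adRep 𝒪 g)
      (lieLog 𝒪 (h * lieExp G (0 : E) * h⁻¹)) := by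
    rw [h0]; exact h𝒪.hasFDerivAt_adRep g
  have h3 := h2.comp (0 : E) h1
  refine (h𝒪.hasFDerivAt_adRep (g * h)).unique (h3.congr_of_eventuallyEq ?_)
  have hc : ContinuousAt (fun y : E => h * lieExp G y * h⁻¹) 0 :=
    ((continuous_const.mul h𝒪.continuous_lieExp).mul continuous_const).continuousAt
  filter_upwards [h𝒪.eventually_mem hc (by simpa [lieExp_zero] using h𝒪.one_mem)] with y hy
  simp only [Function.comp_apply]
  rw [lieExp_lieLog hy]
  simp [mul_assoc]

lemma bch_zero_right (h𝒪 : IsExpDomain m 𝒪) :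
    ∀ x ∈ 𝒪, bch G 𝒪 x 0 = x := by
  intro x hx
  rw [bch, lieExp_zero, mul_one, h𝒪.lieLog_lieExp hx]

lemma bch_zero_left (h𝒪 : IsExpDomain m 𝒪) :
    ∀ x ∈ 𝒪, bch G 𝒪 0 x = x := by
  intro x hx
  rw [bch, lieExp_zero, one_mul, h𝒪.lieLog_lieExp hx]

lemma hasFDerivAt_bch (h𝒪 : IsExpDomain m 𝒪) {Z : E × E}
    (hZ : lieExp G Z.1 * lieExp G Z.2 ∈ lieExp G '' 𝒪) :
    HasFDerivAt (fun Z : E × E => bch G 𝒪 Z.1 Z.2)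
      (fderiv ℝ (fun Z : E × E => bch G 𝒪 Z.1 Z.2) Z) Z :=
  ((h𝒪.contDiffAt_bch hZ).differentiableAt (by simp)).hasFDerivAt

lemma fderiv_bch_inl (h𝒪 : IsExpDomain m 𝒪) {x : E} (hx : x ∈ 𝒪) (Y : E) :
    fderiv ℝ (fun Z : E × E => bch G 𝒪 Z.1 Z.2) (x, 0) (Y, 0) = Y := by
  have hZ : lieExp G x * lieExp G (0 : E) ∈ lieExp G '' 𝒪 := by
    rw [lieExp_zero, mul_one]; exact mem_image_of_mem _ hx
  have h1 := (h𝒪.hasFDerivAt_bch (Z := (x, 0)) hZ).comp x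
    (hasFDerivAt_prodMk_left (𝕜 := ℝ) x (0 : E))
  have h2 : HasFDerivAt (fun y : E => y) (ContinuousLinearMap.id ℝ E) x := hasFDerivAt_id x
  have h3 := h1.unique (h2.congr_of_eventuallyEq (by
    filter_upwards [h𝒪.isOpen.mem_nhds hx] with y hy
    exact h𝒪.bch_zero_right y hy))
  simpa using DFunLike.congr_fun h3 Y

lemma fderiv_bch_inr_zero (h𝒪 : IsExpDomain m 𝒪) (Y : E) :
    fderiv ℝ (fun Z : E × E => bch G 𝒪 Z.1 Z.2) (0, 0) (0, Y) = Y := by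
  have hZ : lieExp G (0 : E) * lieExp G (0 : E) ∈ lieExp G '' 𝒪 := by
    rw [lieExp_zero, mul_one]; exact h𝒪.one_mem
  have h1 := (h𝒪.hasFDerivAt_bch (Z := (0, 0)) hZ).comp (0 : E)
    (hasFDerivAt_prodMk_right (𝕜 := ℝ) (0 : E) (0 : E))
  have h2 : HasFDerivAt (fun y : E => y) (ContinuousLinearMap.id ℝ E) 0 := hasFDerivAt_id 0
  have h3 := h1.unique (h2.congr_of_eventuallyEq (by
    filter_upwards [h𝒪.mem_nhds] with y hy
    exact h𝒪.bch_zero_left y hy))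
  simpa using DFunLike.congr_fun h3 Y

/-- As a partial derivative of one smooth function of two variables, the differential visibly
depends continuously on `X`. -/
lemma leftDexp_eq_fderiv_bch (h𝒪 : IsExpDomain m 𝒪) (X : E) :
    leftDexp G 𝒪 X = (fderiv ℝ (fun Z : E × E => bch G 𝒪 Z.1 Z.2) (-X, X)).comp
      (ContinuousLinearMap.inr ℝ E E) := by
  have h1 := (h𝒪.hasFDerivAt_bch (Z := (-X, X)) (h𝒪.exp_neg_mul_mem X)).comp X
    (hasFDerivAt_prodMk_right (𝕜 := ℝ) (-X) X)
  exact (h𝒪.hasFDerivAt_leftDexp X).unique h1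

lemma continuous_leftDexp (h𝒪 : IsExpDomain m 𝒪) : Continuous (leftDexp G 𝒪) := by
  rw [continuous_iff_continuousAt]
  intro X
  have h1 : ContinuousAt (fderiv ℝ (fun Z : E × E => bch G 𝒪 Z.1 Z.2)) (-X, X) :=
    (h𝒪.contDiffAt_bch (Z := (-X, X)) (h𝒪.exp_neg_mul_mem X)).continuousAt_fderiv (by simp)
  have h2 : ContinuousAt (fun X : E => ((-X, X) : E × E)) X := by fun_prop
  have h3 : ContinuousAt (fun X : E => fderiv ℝ (fun Z : E × E => bch G 𝒪 Z.1 Z.2) (-X, X)) X :=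
    ContinuousAt.comp (f := fun X : E => ((-X, X) : E × E)) h1 h2
  have h4 := h3.clm_comp (continuousAt_const (y := ContinuousLinearMap.inr ℝ E E))
  convert h4 using 1
  funext X
  exact h𝒪.leftDexp_eq_fderiv_bch X

lemma leftDexp_zero (h𝒪 : IsExpDomain m 𝒪) : leftDexp G 𝒪 (0 : E) = 1 := by
  ext Y
  rw [h𝒪.leftDexp_eq_fderiv_bch, neg_zero]
  simpa using h𝒪.fderiv_bch_inr_zero (G := G) Y

/-- For `x` near `X`, `exp(-(s+t)X) exp((s+t)x)` is the conjugate of `exp(-tX) exp(tx)` by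
`exp(-sX)`, times `exp(-sX) exp(sx)`. Taking logarithms and differentiating at `x = X` gives the
identity, since the differential of `⋄` at the origin is addition. -/
lemma leftDexp_cocycle (h𝒪 : IsExpDomain m 𝒪) (X : E) (s t : ℝ) :
    (s + t) • leftDexp G 𝒪 ((s + t) • X) = s • leftDexp G 𝒪 (s • X) +
      (adRep 𝒪 (lieExp G (-s • X))).comp (t • leftDexp G 𝒪 (t • X)) := by
  have := topologicalGroup_of_lieGroup 𝓘(ℝ, E) ∞ (G := G)
  have hG : ∀ r : ℝ, HasFDerivAt (fun x : E => lieLog 𝒪 (lieExp G (-(r • X)) * lieExp G (r • x)))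
      (r • leftDexp G 𝒪 (r • X)) X := by
    intro r
    have h1 : HasFDerivAt (fun x : E => r • x) (r • ContinuousLinearMap.id ℝ E) X :=
      (hasFDerivAt_id X).const_smul r
    have h2 := (h𝒪.hasFDerivAt_leftDexp (r • X)).comp X h1
    have e : (leftDexp G 𝒪 (r • X)).comp (r • ContinuousLinearMap.id ℝ E) =
        r • leftDexp G 𝒪 (r • X) := by ext; simp
    rw [e] at h2
    exact h2
  have hv : ∀ r : ℝ, lieLog 𝒪 (lieExp G (-(r • X)) * lieExp G (r • X)) = 0 := by
    intro r; rw [h𝒪.lieExp_neg, inv_mul_cancel, h𝒪.lieLog_one]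
  have hA : HasFDerivAt (fun y => lieLog 𝒪 (lieExp G (-s • X) * lieExp G y *
      (lieExp G (-s • X))⁻¹)) (adRep 𝒪 (lieExp G (-s • X)))
      (lieLog 𝒪 (lieExp G (-(t • X)) * lieExp G (t • X))) := by
    rw [hv]; exact h𝒪.hasFDerivAt_adRep _
  have h1 := hA.comp X (hG t)
  have hb : HasFDerivAt (fun Z : E × E => bch G 𝒪 Z.1 Z.2)
      (fderiv ℝ (fun Z : E × E => bch G 𝒪 Z.1 Z.2) (0, 0)) (0, 0) := by
    refine h𝒪.hasFDerivAt_bch (Z := (0, 0)) ?_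
    rw [lieExp_zero, mul_one]; exact h𝒪.one_mem
  have h2 := h1.prodMk (hG s)
  have hb' : HasFDerivAt (fun Z : E × E => bch G 𝒪 Z.1 Z.2)
      (fderiv ℝ (fun Z : E × E => bch G 𝒪 Z.1 Z.2) (0, 0))
      (((fun y => lieLog 𝒪 (lieExp G (-s • X) * lieExp G y * (lieExp G (-s • X))⁻¹)) ∘
        (fun x : E => lieLog 𝒪 (lieExp G (-(t • X)) * lieExp G (t • x)))) X,
        lieLog 𝒪 (lieExp G (-(s • X)) * lieExp G (s • X))) := by
    have : ((fun y => lieLog 𝒪 (lieExp G (-s • X) * lieExp G y * (lieExp G (-s • X))⁻¹)) ∘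
        (fun x : E => lieLog 𝒪 (lieExp G (-(t • X)) * lieExp G (t • x)))) X = 0 := by
      simp only [Function.comp_apply]
      rw [hv, lieExp_zero, mul_one, mul_inv_cancel, h𝒪.lieLog_one]
    rw [this, hv]; exact hb
  have h3 := hb'.comp X h2
  have hcont : ∀ r : ℝ, Continuous (fun x : E => lieExp G (-(r • X)) * lieExp G (r • x)) :=
    fun r => continuous_const.mul (h𝒪.continuous_lieExp.comp (continuous_const_smul r))
  have hmem : ∀ r : ℝ, ∀ᶠ x in 𝓝 X,
      lieExp G (-(r • X)) * lieExp G (r • x) ∈ lieExp G '' 𝒪 := fun r =>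
    h𝒪.eventually_mem (hcont r).continuousAt (h𝒪.exp_neg_mul_mem _)
  have hmem2 : ∀ᶠ x in 𝓝 X, lieExp G (-s • X) * (lieExp G (-(t • X)) * lieExp G (t • x)) *
      (lieExp G (-s • X))⁻¹ ∈ lieExp G '' 𝒪 := by
    refine h𝒪.eventually_mem
      ((continuous_const.mul (hcont t)).mul continuous_const).continuousAt ?_
    rw [h𝒪.lieExp_neg (t • X), inv_mul_cancel, mul_one, mul_inv_cancel]
    exact h𝒪.one_mem
  have h4 := (hG (s + t)).unique (h3.congr_of_eventuallyEq (by
    filter_upwards [hmem s, hmem t, hmem2] with x hs ht hst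
    simp only [Function.comp_apply, bch]
    rw [lieExp_lieLog ht, lieExp_lieLog hst, lieExp_lieLog hs]
    congr 1
    have e1 : lieExp G (-((s + t) • X)) = lieExp G (-s • X) * lieExp G (-(t • X)) := by
      rw [← neg_smul, neg_add, h𝒪.lieExp_add_smul, ← neg_smul]
    rw [e1, add_comm s t, h𝒪.lieExp_add_smul, neg_smul]
    group))
  rw [h4]
  ext Y
  have hsplit : ∀ u v : E, fderiv ℝ (fun Z : E × E => bch G 𝒪 Z.1 Z.2) (0, 0) (u, v) = u + v := by
    intro u v
    have : (u, v) = (u, (0 : E)) + (0, v) := by simp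
    rw [this, map_add, h𝒪.fderiv_bch_inl h𝒪.zero_mem, h𝒪.fderiv_bch_inr_zero]
  simp [hsplit, add_comm]

end IsExpDomain

end LogChart

/-! ### The adjoint representation and the Lie bracket -/

section Bracket

variable {E : Type*} [NormedAddCommGroup E] [NormedSpace ℝ E] [FiniteDimensional ℝ E]
  {G : Type*} [TopologicalSpace G] [T2Space G] [ChartedSpace E G] [Group G]
  [LieGroup 𝓘(ℝ, E) ∞ G]

variable (G) in
/-- The differential of the exponential map, as an endomorphism of the model space. -/
def dexp (x : E) : E →L[ℝ] E := mfderiv 𝓘(ℝ, E) 𝓘(ℝ, E) (lieExp G : E → G) x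

lemma mlieBracket_vectorSpace (V W : E → E) (x : E) :
    (VectorField.mlieBracket 𝓘(ℝ, E) (M := E) V W x : E) =
      fderiv ℝ W x (V x) - fderiv ℝ V x (W x) := by
  have h := VectorField.mlieBracketWithin_eq_lieBracketWithin (𝕜 := ℝ) (E := E) (V := V) (W := W)
    (s := univ)
  have h1 := congrFun h x
  rw [VectorField.lieBracketWithin_univ, VectorField.lieBracket_eq] at h1
  refine Eq.trans ?_ h1
  exact congrFun (VectorField.mlieBracketWithin_univ (I := 𝓘(ℝ, E)) (V := V) (W := W)).symm x

lemma leftField_one (Y : E) : (leftField G Y 1 : E) = Y := by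
  have h : (fun x : G => 1 * x) = id := by ext x; simp
  have key : (mfderiv 𝓘(ℝ, E) 𝓘(ℝ, E) (id : G → G) 1 Y : E) = Y := by
    rw [mfderiv_id]; rfl
  rw [← h] at key
  exact key

variable [MeasurableSpace G] {m : Measure G} {𝒪 : Set E}

namespace IsExpDomain

lemma hasMFDerivAt_lieExp (h𝒪 : IsExpDomain m 𝒪) (x : E) :
    HasMFDerivAt 𝓘(ℝ, E) 𝓘(ℝ, E) (lieExp G : E → G) x (dexp (E := E) G x) :=
  (h𝒪.contMDiff_lieExp.mdifferentiable (by simp) x).hasMFDerivAt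

lemma dexp_zero (h𝒪 : IsExpDomain m 𝒪) (Y : E) : dexp G 0 Y = Y := by
  have h1 : HasMFDerivAt 𝓘(ℝ, ℝ) 𝓘(ℝ, E) (fun t : ℝ => t • Y) 0
      ((1 : ℝ →L[ℝ] ℝ).smulRight Y) := by
    have := ((hasDerivAt_id (0 : ℝ)).smul_const Y).hasFDerivAt.hasMFDerivAt
    simp only [one_smul] at this
    exact this
  have h2 : HasMFDerivAt 𝓘(ℝ, E) 𝓘(ℝ, E) (lieExp G : E → G) ((0 : ℝ) • Y) (dexp (E := E) G 0) := by
    rw [zero_smul]; exact h𝒪.hasMFDerivAt_lieExp 0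
  have h3 := h2.comp (0 : ℝ) h1
  have h4 := (h𝒪.isExpCurve Y).2 0
  have h5 := hasMFDerivAt_unique h3 h4
  have h6 := DFunLike.congr_fun h5 (1 : ℝ)
  have h7 : dexp G (0 : E) ((1 : ℝ) • Y) = (1 : ℝ) • (leftField G Y (lieExp G ((0 : ℝ) • Y)) : E) :=
    h6
  rw [one_smul, one_smul, zero_smul, lieExp_zero] at h7
  rw [h7]
  exact leftField_one Y

/-- Obtained by differentiating `exp x · exp y = exp(x ⋄ y)` in `y` at `0`. It expresses
left-invariant fields in the exponential chart by a partial derivative of `⋄`, the form needed to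
compute their brackets. -/
lemma dexp_fderiv_bch (h𝒪 : IsExpDomain m 𝒪) {x : E} (hx : x ∈ 𝒪) (Y : E) :
    dexp G x (fderiv ℝ (fun Z : E × E => bch G 𝒪 Z.1 Z.2) (x, 0) (0, Y)) =
      (leftField G Y (lieExp G x) : E) := by
  have := topologicalGroup_of_lieGroup 𝓘(ℝ, E) ∞ (G := G)
  have hZ : lieExp G x * lieExp G (0 : E) ∈ lieExp G '' 𝒪 := by
    rw [lieExp_zero, mul_one]; exact mem_image_of_mem _ hx
  have h1 : HasMFDerivAt 𝓘(ℝ, E) 𝓘(ℝ, E) (fun y : E => bch G 𝒪 x y) 0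
      ((fderiv ℝ (fun Z : E × E => bch G 𝒪 Z.1 Z.2) (x, 0)).comp
        (ContinuousLinearMap.inr ℝ E E)) :=
    ((h𝒪.hasFDerivAt_bch (Z := (x, 0)) hZ).comp (0 : E)
      (hasFDerivAt_prodMk_right (𝕜 := ℝ) x (0 : E))).hasMFDerivAt
  have h2 : HasMFDerivAt 𝓘(ℝ, E) 𝓘(ℝ, E) (lieExp G : E → G) (bch G 𝒪 x 0) (dexp (E := E) G x) := by
    rw [h𝒪.bch_zero_right x hx]; exact h𝒪.hasMFDerivAt_lieExp x
  have h3 := h2.comp (0 : E) h1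
  have h4 : HasMFDerivAt 𝓘(ℝ, E) 𝓘(ℝ, E) (fun g : G => lieExp G x * g) (lieExp G (0 : E))
      (mfderiv 𝓘(ℝ, E) 𝓘(ℝ, E) (fun g : G => lieExp G x * g) 1 : E →L[ℝ] E) := by
    rw [lieExp_zero]
    exact ((contMDiff_mul_left (I := 𝓘(ℝ, E)) (n := ∞) (a := lieExp G x)).mdifferentiable
      (by simp) 1).hasMFDerivAt
  have h5 := h4.comp (0 : E) (h𝒪.hasMFDerivAt_lieExp 0)
  have hev : (fun g : G => lieExp G x * g) ∘ (lieExp G : E → G) =ᶠ[𝓝 0]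
      (lieExp G : E → G) ∘ (fun y : E => bch G 𝒪 x y) := by
    have hc : ContinuousAt (fun y : E => lieExp G x * lieExp G y) 0 :=
      (continuous_const.mul h𝒪.continuous_lieExp).continuousAt
    filter_upwards [h𝒪.eventually_mem hc hZ] with y hy
    simp only [Function.comp_apply, bch]
    rw [lieExp_lieLog hy]
  have h6 := hasMFDerivAt_unique h5 (h3.congr_of_eventuallyEq hev)
  have h7 : (mfderiv 𝓘(ℝ, E) 𝓘(ℝ, E) (fun g : G => lieExp G x * g) 1 : E →L[ℝ] E)
      (dexp G (0 : E) Y) = dexp G x (fderiv ℝ (fun Z : E × E => bch G 𝒪 Z.1 Z.2) (x, 0)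
        (ContinuousLinearMap.inr ℝ E E Y)) := DFunLike.congr_fun h6 Y
  rw [h𝒪.dexp_zero] at h7
  exact h7.symm

/-- The derivative of the logarithm is a left inverse of the differential; in finite dimension it is
therefore two-sided. -/
lemma dexp_inverse_apply (h𝒪 : IsExpDomain m 𝒪) {x : E} (hx : x ∈ 𝒪) (v : E) :
    (dexp G x).inverse (dexp G x v) = v := by
  have hlog : HasMFDerivAt 𝓘(ℝ, E) 𝓘(ℝ, E) (lieLog (G := G) 𝒪) (lieExp G x)
      (mfderiv 𝓘(ℝ, E) 𝓘(ℝ, E) (lieLog (G := G) 𝒪) (lieExp G x)) :=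
    (((h𝒪.contMDiffOn_log _ (mem_image_of_mem _ hx)).contMDiffAt
      (h𝒪.isOpen_image.mem_nhds (mem_image_of_mem _ hx))).mdifferentiableAt (by simp)).hasMFDerivAt
  have h1 := hlog.comp x (h𝒪.hasMFDerivAt_lieExp x)
  have h2 : HasMFDerivAt 𝓘(ℝ, E) 𝓘(ℝ, E) (lieLog (G := G) 𝒪 ∘ lieExp G) x
      (ContinuousLinearMap.id ℝ E) := by
    refine (hasFDerivAt_id x).hasMFDerivAt.congr_of_eventuallyEq ?_
    filter_upwards [h𝒪.isOpen.mem_nhds hx] with y hy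
    exact h𝒪.lieLog_lieExp hy
  have h3 := hasMFDerivAt_unique h1 h2
  set L : E →L[ℝ] E := mfderiv 𝓘(ℝ, E) 𝓘(ℝ, E) (lieLog (G := G) 𝒪) (lieExp G x)
  have h4 : L.comp (dexp G x) = ContinuousLinearMap.id ℝ E := h3
  have h5 : (dexp G x).comp L = ContinuousLinearMap.id ℝ E := by
    have e : (L : E →ₗ[ℝ] E) * (dexp G x : E →ₗ[ℝ] E) = 1 := by
      ext w; exact DFunLike.congr_fun h4 w
    ext w; exact DFunLike.congr_fun (mul_eq_one_comm.1 e) w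
  rw [ContinuousLinearMap.inverse_eq h5 h4]
  exact DFunLike.congr_fun h4 v

lemma mpullback_leftField (h𝒪 : IsExpDomain m 𝒪) {x : E} (hx : x ∈ 𝒪) (Y : E) :
    (VectorField.mpullback 𝓘(ℝ, E) 𝓘(ℝ, E) (lieExp G : E → G) (leftField G Y) x : E) =
      fderiv ℝ (fun Z : E × E => bch G 𝒪 Z.1 Z.2) (x, 0) (0, Y) := by
  have h := h𝒪.dexp_inverse_apply (G := G) hx
    (fderiv ℝ (fun Z : E × E => bch G 𝒪 Z.1 Z.2) (x, 0) (0, Y))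
  rw [h𝒪.dexp_fderiv_bch hx] at h
  exact h

variable (G 𝒪) in
/-- The second derivative of the Baker-Campbell-Hausdorff product at the origin. -/
def _root_.LieStar.bchHess : E × E →L[ℝ] E × E →L[ℝ] E :=
  fderiv ℝ (fderiv ℝ (fun Z : E × E => bch G 𝒪 Z.1 Z.2)) (0, 0)

lemma zero_mul_zero_mem (h𝒪 : IsExpDomain m 𝒪) :
    lieExp G ((0 : E), (0 : E)).1 * lieExp G ((0 : E), (0 : E)).2 ∈ lieExp G '' 𝒪 := by
  simpa [lieExp_zero] using h𝒪.one_mem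

lemma hasFDerivAt_fderiv_bch (h𝒪 : IsExpDomain m 𝒪) :
    HasFDerivAt (fderiv ℝ (fun Z : E × E => bch G 𝒪 Z.1 Z.2)) (bchHess G 𝒪) (0, 0) :=
  (((h𝒪.contDiffAt_bch h𝒪.zero_mul_zero_mem).fderiv_right (m := 1)
    (by norm_cast)).differentiableAt (by simp)).hasFDerivAt

lemma bchHess_symm (h𝒪 : IsExpDomain m 𝒪) (u v : E × E) :
    bchHess G 𝒪 u v = bchHess G 𝒪 v u :=
  ((h𝒪.contDiffAt_bch h𝒪.zero_mul_zero_mem).isSymmSndFDerivAt (by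
    rw [minSmoothness_of_isRCLikeNormedField]; norm_cast)) u v

/-- Since `x ⋄ 0 = x` near the origin, the first partial derivative is constant along the slice `(x,
0)`. -/
lemma bchHess_inl (h𝒪 : IsExpDomain m 𝒪) (X Y : E) : bchHess G 𝒪 (X, 0) (Y, 0) = 0 := by
  have h0 : HasFDerivAt (fderiv ℝ (fun Z : E × E => bch G 𝒪 Z.1 Z.2)) (bchHess G 𝒪)
      ((fun x : E => (x, (0 : E))) 0) := h𝒪.hasFDerivAt_fderiv_bch
  have h1 := (HasFDerivAt.comp (f := fun x : E => (x, (0 : E))) (0 : E) h0 (hasFDerivAt_prodMk_left (𝕜 := ℝ) (0 : E) (0 : E))).clm_apply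
    (hasFDerivAt_const ((Y, 0) : E × E) (0 : E))
  have h2 := h1.unique ((hasFDerivAt_const Y (0 : E)).congr_of_eventuallyEq (by
    filter_upwards [h𝒪.mem_nhds] with x hx
    exact h𝒪.fderiv_bch_inl hx Y))
  simpa using DFunLike.congr_fun h2 X

/-- Brackets commute with pullback along `exp`, whose differential at `0` is the identity. In the
chart the left-invariant fields are `x ↦ ∂₂(⋄)(x, 0) W`, and their bracket at the origin is the
antisymmetrized mixed second derivative of `⋄`. -/
lemma adOp_eq (h𝒪 : IsExpDomain m 𝒪) (X Y : E) :
    adOp G X Y = bchHess G 𝒪 (X, 0) (0, Y) - bchHess G 𝒪 (Y, 0) (0, X) := by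
  have hd : ∀ W : E, MDifferentiableAt 𝓘(ℝ, E) 𝓘(ℝ, E).tangent
      (fun g : G => (⟨g, leftField G W g⟩ : TangentBundle 𝓘(ℝ, E) G)) (lieExp G (0 : E)) :=
    fun W => (leftField_contMDiff W).mdifferentiable (by simp) _
  have h1 := VectorField.mpullback_mlieBracket (x₀ := (0 : E)) (n := ∞) (hd X) (hd Y)
    (h𝒪.contMDiff_lieExp 0) (by rw [minSmoothness_of_isRCLikeNormedField]; norm_cast)
  have hev : ∀ W : E, VectorField.mpullback 𝓘(ℝ, E) 𝓘(ℝ, E) (lieExp G : E → G) (leftField G W)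
      =ᶠ[𝓝 0] (fun x : E =>
        fderiv ℝ (fun Z : E × E => bch G 𝒪 Z.1 Z.2) (x, 0) (0, W)) := by
    intro W
    filter_upwards [h𝒪.mem_nhds] with x hx
    exact h𝒪.mpullback_leftField hx W
  have hder : ∀ W : E, HasFDerivAt
      (fun x : E => fderiv ℝ (fun Z : E × E => bch G 𝒪 Z.1 Z.2) (x, 0) (0, W))
      (((bchHess G 𝒪).comp (ContinuousLinearMap.inl ℝ E E)).flip (0, W)) 0 := by
    intro W
    have h0 : HasFDerivAt (fderiv ℝ (fun Z : E × E => bch G 𝒪 Z.1 Z.2)) (bchHess G 𝒪)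
      ((fun x : E => (x, (0 : E))) 0) := h𝒪.hasFDerivAt_fderiv_bch
    have := (HasFDerivAt.comp (f := fun x : E => (x, (0 : E))) (0 : E) h0 (hasFDerivAt_prodMk_left (𝕜 := ℝ) (0 : E) (0 : E))).clm_apply
      (hasFDerivAt_const ((0, W) : E × E) (0 : E))
    have e : ((bchHess G 𝒪).comp (ContinuousLinearMap.inl ℝ E E)).flip (0, W) =
        (fderiv ℝ (fun Z : E × E => bch G 𝒪 Z.1 Z.2) ((0 : E), (0 : E))).comp
          (0 : E →L[ℝ] E × E) +
        ((bchHess G 𝒪).comp (ContinuousLinearMap.inl ℝ E E)).flip (0, W) := by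
      ext; simp
    rw [e]
    exact this
  have h2 : (VectorField.mlieBracket 𝓘(ℝ, E)
      (VectorField.mpullback 𝓘(ℝ, E) 𝓘(ℝ, E) (lieExp G : E → G) (leftField G X))
      (VectorField.mpullback 𝓘(ℝ, E) 𝓘(ℝ, E) (lieExp G : E → G) (leftField G Y)) 0 : E) =
      bchHess G 𝒪 (X, 0) (0, Y) - bchHess G 𝒪 (Y, 0) (0, X) := by
    refine (Filter.EventuallyEq.mlieBracket_vectorField_eq (hev X) (hev Y)).trans ?_
    refine (mlieBracket_vectorSpace _ _ 0).trans ?_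
    simp only [(hder _).fderiv, h𝒪.fderiv_bch_inr_zero]
    rfl
  have h3 : (VectorField.mlieBracket 𝓘(ℝ, E) (leftField G X) (leftField G Y)
      (lieExp G (0 : E)) : E) = adOp G X Y := by
    rw [lieExp_zero]; rfl
  rw [← h2]
  refine Eq.trans ?_ h1
  have h4 := h𝒪.dexp_inverse_apply (G := G) h𝒪.zero_mem (adOp G X Y)
  rw [h𝒪.dexp_zero] at h4
  rw [← h4, ← h3]
  rfl

/-- Conjugation by `exp(sX)` factors as `y ↦ (sX ⋄ y) ⋄ (-sX)`, so `Ad(exp(sX))` is a product of two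
first partial derivatives of `⋄`. The product rule at `s = 0` yields two Hessian terms, which
`adOp_eq` recognizes as the bracket. -/
lemma hasDerivAt_adRep_exp (h𝒪 : IsExpDomain m 𝒪) (X : E) :
    HasDerivAt (fun s : ℝ => adRep 𝒪 (lieExp G (s • X))) (adOp G X) 0 := by
  have hsm : ∀ᶠ s : ℝ in 𝓝 0, s • X ∈ 𝒪 := by
    have : Tendsto (fun c : ℝ => c • X) (𝓝 0) (𝓝 ((0 : ℝ) • X)) :=
      (continuous_id.smul continuous_const).tendsto 0
    rw [zero_smul] at this
    exact this h𝒪.mem_nhds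
  set f := fderiv ℝ (fun Z : E × E => bch G 𝒪 Z.1 Z.2) with hf
  have heq : (fun s : ℝ => adRep 𝒪 (lieExp G (s • X))) =ᶠ[𝓝 0] fun s : ℝ =>
      ((f (s • X, -(s • X))).comp (ContinuousLinearMap.inl ℝ E E)).comp
        ((f (s • X, 0)).comp (ContinuousLinearMap.inr ℝ E E)) := by
    filter_upwards [hsm] with s hs
    have := topologicalGroup_of_lieGroup 𝓘(ℝ, E) ∞ (G := G)
    have hZ : lieExp G (s • X) * lieExp G (0 : E) ∈ lieExp G '' 𝒪 := by
      rw [lieExp_zero, mul_one]; exact mem_image_of_mem _ hs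
    have h1 := (h𝒪.hasFDerivAt_bch (Z := (s • X, 0)) hZ).comp (0 : E)
      (hasFDerivAt_prodMk_right (𝕜 := ℝ) (s • X) (0 : E))
    have hb : HasFDerivAt (fun u : E => bch G 𝒪 u (-(s • X)))
        ((f (s • X, -(s • X))).comp (ContinuousLinearMap.inl ℝ E E)) (bch G 𝒪 (s • X) 0) := by
      rw [h𝒪.bch_zero_right _ hs]
      refine (h𝒪.hasFDerivAt_bch (Z := (s • X, -(s • X))) ?_).comp (s • X)
        (hasFDerivAt_prodMk_left (𝕜 := ℝ) (s • X) (-(s • X)))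
      simp only [h𝒪.lieExp_neg, mul_inv_cancel]
      exact h𝒪.one_mem
    have h2 := hb.comp (0 : E) h1
    refine (h𝒪.hasFDerivAt_adRep _).unique (h2.congr_of_eventuallyEq ?_)
    have hc : ContinuousAt (fun y : E => lieExp G (s • X) * lieExp G y) 0 :=
      (continuous_const.mul h𝒪.continuous_lieExp).continuousAt
    filter_upwards [h𝒪.eventually_mem hc hZ] with y hy
    simp only [Function.comp_apply, bch]
    rw [lieExp_lieLog hy, h𝒪.lieExp_neg]
  refine HasDerivAt.congr_of_eventuallyEq ?_ heq
  have hF := h𝒪.hasFDerivAt_fderiv_bch (G := G)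
  have hid : HasDerivAt (fun s : ℝ => s • X) X 0 := by
    simpa using (hasDerivAt_id (0 : ℝ)).smul_const X
  have p1 : HasDerivAt (fun s : ℝ => f (s • X, -(s • X))) (bchHess G 𝒪 (X, -X)) 0 := by
    have h0 : HasFDerivAt f (bchHess G 𝒪) ((0 : ℝ) • X, -((0 : ℝ) • X)) := by
      simpa using hF
    exact h0.comp_hasDerivAt (0 : ℝ) (hid.prodMk hid.neg)
  have p2 : HasDerivAt (fun s : ℝ => f (s • X, 0)) (bchHess G 𝒪 (X, 0)) 0 := by
    have h0 : HasFDerivAt f (bchHess G 𝒪) ((0 : ℝ) • X, (0 : E)) := by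
      simpa using hF
    exact h0.comp_hasDerivAt (0 : ℝ) (hid.prodMk (hasDerivAt_const (0 : ℝ) (0 : E)))
  have p3 := (p1.clm_comp (hasDerivAt_const (0 : ℝ) (ContinuousLinearMap.inl ℝ E E))).clm_comp
    (p2.clm_comp (hasDerivAt_const (0 : ℝ) (ContinuousLinearMap.inr ℝ E E)))
  have e1 : ∀ Y : E, bchHess G 𝒪 (X, -X) (Y, 0) = - bchHess G 𝒪 (Y, 0) (0, X) := by
    intro Y
    have : (X, -X) = (X, (0 : E)) - (0, X) := by simp
    rw [this, map_sub, sub_apply, h𝒪.bchHess_inl, zero_sub, h𝒪.bchHess_symm (0, X)]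
  refine p3.congr_deriv ?_
  ext Y
  simp [hf, h𝒪.adOp_eq, h𝒪.fderiv_bch_inl h𝒪.zero_mem, h𝒪.fderiv_bch_inr_zero, e1]
  abel

lemma adRep_one (h𝒪 : IsExpDomain m 𝒪) : adRep 𝒪 (1 : G) = 1 := by
  refine (h𝒪.hasFDerivAt_adRep 1).unique ((hasFDerivAt_id (0 : E)).congr_of_eventuallyEq ?_)
  filter_upwards [h𝒪.mem_nhds] with y hy
  simp [h𝒪.lieLog_lieExp hy]

/-- A one-parameter group of operators `A` with `A'(0) = a` satisfies `A' = A a`, so `A(s) exp(-s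
a)` is constant. -/
lemma adRep_exp (h𝒪 : IsExpDomain m 𝒪) (X : E) (s : ℝ) :
    adRep 𝒪 (lieExp G (s • X)) = NormedSpace.exp (s • adOp G X) := by
  set a := adOp G X with ha
  set A : ℝ → E →L[ℝ] E := fun s => adRep 𝒪 (lieExp G (s • X)) with hA
  have hadd : ∀ s t, A (s + t) = A s * A t := fun s t => by
    simp only [hA, h𝒪.lieExp_add_smul, h𝒪.adRep_mul]; rfl
  have hderiv : ∀ s, HasDerivAt A (A s * a) s := by
    intro s
    have h1 : HasDerivAt A a (s - s) := by
      rw [sub_self]; exact h𝒪.hasDerivAt_adRep_exp X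
    have h2 : HasDerivAt (fun r => A s * A (r - s)) (A s * a) s :=
      (h1.comp_sub_const s s).const_mul (A s)
    convert h2 using 1
    funext r
    rw [← hadd]; congr 1; ring
  have hconst : ∀ s, A s * NormedSpace.exp (s • (-a)) = 1 := by
    have hd : ∀ s, HasDerivAt (fun s => A s * NormedSpace.exp (s • (-a))) 0 s := by
      intro s
      refine ((hderiv s).mul (hasDerivAt_exp_smul_const' (𝕂 := ℝ) (-a) s)).congr_deriv ?_
      simp [mul_assoc]
    intro s
    have := is_const_of_deriv_eq_zero (fun s => (hd s).differentiableAt) (fun s => (hd s).deriv) s 0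
    rw [this]
    simp [hA, lieExp_zero, h𝒪.adRep_one]
  have hinv : NormedSpace.exp (s • (-a)) * NormedSpace.exp (s • a) = 1 := by
    let _ : NormedAlgebra ℚ (E →L[ℝ] E) := NormedAlgebra.restrictScalars ℚ ℝ _
    rw [← NormedSpace.exp_add_of_commute]
    · simp
    · simp [Commute, SemiconjBy]
  calc A s = A s * (NormedSpace.exp (s • (-a)) * NormedSpace.exp (s • a)) := by rw [hinv, mul_one]
    _ = _ := by rw [← mul_assoc, hconst, one_mul]

/-- With `C(t) = t · leftDexp(tX)`, the cocycle identity reads `C(r) = C(s) + Ad(exp(-sX)) C(r -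
s)`, and `C'(0) = 1`; so the derivative at `s` is `Ad(exp(-sX))`. -/
lemma hasDerivAt_smul_leftDexp (h𝒪 : IsExpDomain m 𝒪) (X : E) (s : ℝ) :
    HasDerivAt (fun t : ℝ => t • leftDexp G 𝒪 (t • X)) (NormedSpace.exp (s • (-adOp G X))) s := by
  set C : ℝ → E →L[ℝ] E := fun t => t • leftDexp G 𝒪 (t • X) with hC
  have h0 : HasDerivAt C 1 (s - s) := by
    rw [sub_self, hasDerivAt_iff_tendsto_slope_zero]
    have h1 : Tendsto (fun t : ℝ => leftDexp G 𝒪 (t • X)) (𝓝[≠] 0) (𝓝 1) := by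
      have : Continuous (fun t : ℝ => leftDexp G 𝒪 (t • X)) :=
        h𝒪.continuous_leftDexp.comp (continuous_id.smul continuous_const)
      have h2 := this.tendsto 0
      rw [zero_smul, h𝒪.leftDexp_zero] at h2
      exact h2.mono_left nhdsWithin_le_nhds
    refine h1.congr' ?_
    filter_upwards [self_mem_nhdsWithin] with t ht
    have ht' : t ≠ 0 := ht
    simp [hC, smul_smul, inv_mul_cancel₀ ht']
  have h1 : HasDerivAt (fun r => C s + NormedSpace.exp (s • (-adOp G X)) * C (r - s))
      (NormedSpace.exp (s • (-adOp G X))) s := by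
    have := ((h0.comp_sub_const s s).const_mul (NormedSpace.exp (s • (-adOp G X)))).const_add (C s)
    rwa [mul_one] at this
  convert h1 using 1
  funext r
  have := h𝒪.leftDexp_cocycle (G := G) X s (r - s)
  rw [add_sub_cancel, h𝒪.adRep_exp] at this
  simp only [hC]
  rw [this, neg_smul, smul_neg]
  rfl

end IsExpDomain

end Bracket

/-! ### The series `2 sinh (a / 2) / a` and the Jacobian of the exponential map -/

section Sinhc

open NormedSpace in
/-- `λ(a) = ∑ a^(2k) / (4^k (2k+1)!)`, that is `2 sinh (a / 2) / a`. -/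
def sinhc {𝔸 : Type*} [NormedRing 𝔸] [NormedAlgebra ℝ 𝔸] (a : 𝔸) : 𝔸 :=
  ∑' k : ℕ, ((4 : ℝ) ^ k * (2 * k + 1).factorial)⁻¹ • a ^ (2 * k)

variable {𝔸 : Type*} [NormedRing 𝔸] [NormedAlgebra ℝ 𝔸]

lemma sinhc_neg (a : 𝔸) : sinhc (-a) = sinhc a := by
  simp [sinhc, pow_mul]

lemma sinhc_zero : sinhc (0 : 𝔸) = 1 := by
  rw [sinhc, tsum_eq_single 0]
  · simp
  · intro k hk
    simp [hk]

lemma integral_half_sub_pow (n : ℕ) :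
    ∫ s in (0 : ℝ)..1, (1 / 2 - s) ^ n = ((1 / 2) ^ (n + 1) - (-(1 / 2)) ^ (n + 1)) / (n + 1) := by
  rw [intervalIntegral.integral_comp_sub_left (fun x => x ^ n), integral_pow]
  norm_num

variable [CompleteSpace 𝔸]

/-- The exponential series is integrated termwise, dominated by the series of `a` because `|1/2 - s|
≤ 1`. Centring at `1/2` makes the integrand symmetric, which leaves only even powers. -/
lemma integral_exp_half_sub (a : 𝔸) :
    ∫ s in (0 : ℝ)..1, NormedSpace.exp ((1 / 2 - s) • a) = sinhc a := by
  have h := intervalIntegral.hasSum_integral_of_dominated_convergence (μ := volume) (a := 0)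
    (b := 1) (F := fun (n : ℕ) (s : ℝ) => (n.factorial : ℝ)⁻¹ • ((1 / 2 - s) • a) ^ n)
    (f := fun s => NormedSpace.exp ((1 / 2 - s) • a))
    (fun n _ => ‖((n.factorial : ℝ)⁻¹) • a ^ n‖)
    (fun n => (by fun_prop : Continuous fun s : ℝ =>
      (n.factorial : ℝ)⁻¹ • ((1 / 2 - s) • a) ^ n).aestronglyMeasurable)
    (fun n => by
      refine Eventually.of_forall fun s hs => ?_
      rw [uIoc_of_le zero_le_one] at hs
      rw [smul_pow, smul_comm, norm_smul]
      refine mul_le_of_le_one_left (norm_nonneg _) ?_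
      rw [norm_pow]
      refine pow_le_one₀ (norm_nonneg _) ?_
      rw [Real.norm_eq_abs, abs_le]
      constructor <;> linarith [hs.1, hs.2])
    (Eventually.of_forall fun s _ => NormedSpace.norm_expSeries_summable' a)
    intervalIntegrable_const
    (Eventually.of_forall fun s _ => NormedSpace.exp_series_hasSum_exp' (𝕂 := ℝ) _)
  have hF : ∀ n : ℕ, ∫ s in (0 : ℝ)..1, (n.factorial : ℝ)⁻¹ • ((1 / 2 - s) • a) ^ n =
      ((n.factorial : ℝ)⁻¹ * (((1 / 2) ^ (n + 1) - (-(1 / 2)) ^ (n + 1)) / (n + 1))) • a ^ n := by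
    intro n
    simp_rw [smul_pow]
    rw [intervalIntegral.integral_smul, intervalIntegral.integral_smul_const,
      integral_half_sub_pow, smul_smul]
  simp_rw [hF] at h
  have hinj : Function.Injective (fun k : ℕ => 2 * k) := fun a b h => by simpa using h
  rw [← hinj.hasSum_iff] at h
  · rw [sinhc, ← h.tsum_eq]
    congr 1
    funext k
    simp only [Function.comp_apply]
    congr 1
    have h1 : (-(1 / 2 : ℝ)) ^ (2 * k + 1) = -(1 / 2) ^ (2 * k + 1) := Odd.neg_pow ⟨k, rfl⟩ _
    have h2 : ((2 * k + 1).factorial : ℝ) = (2 * k + 1) * (2 * k).factorial := by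
      push_cast [Nat.factorial_succ]; ring
    have h3 : (1 / 2 : ℝ) ^ (2 * k + 1) = 1 / 2 * (4 ^ k)⁻¹ := by
      rw [pow_succ, pow_mul, ← inv_pow, mul_comm]; norm_num
    rw [h1, h3, h2]
    have : (2 * (k : ℝ) + 1) ≠ 0 := by positivity
    have h5 : ((2 * k).factorial : ℝ) ≠ 0 := by positivity
    push_cast
    field_simp
    ring
  -- An odd power of `1/2 - s` has integral zero over `[0, 1]`.
  · intro n hn
    have : Even (n + 1) := by
      rw [Nat.even_add_one, Nat.not_even_iff_odd, ← Nat.not_even_iff_odd]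
      rintro ⟨k, hk⟩
      exact hn ⟨k, by simp; omega⟩
    rw [this.neg_pow]
    simp

/-- As a function of `a²` this is a power series with scalar coefficients and infinite radius of
convergence, by the ratio test. -/
lemma analyticAt_sinhc (a : 𝔸) : AnalyticAt ℝ (sinhc : 𝔸 → 𝔸) a := by
  set c : ℕ → ℝ := fun k => ((4 : ℝ) ^ k * (2 * k + 1).factorial)⁻¹ with hc
  have hpos : ∀ k, 0 < c k := fun k => by positivity
  have hr : (FormalMultilinearSeries.ofScalars 𝔸 c).radius = ⊤ := by
    refine FormalMultilinearSeries.ofScalars_radius_eq_top_of_tendsto 𝔸 c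
      (Eventually.of_forall fun k => (hpos k).ne') ?_
    refine squeeze_zero (fun k => by positivity) (fun k => ?_)
      (tendsto_one_div_add_atTop_nhds_zero_nat (𝕜 := ℝ))
    rw [Real.norm_of_nonneg (hpos _).le, Real.norm_of_nonneg (hpos _).le,
      div_le_div_iff₀ (hpos k) (by positivity), one_mul]
    have e : c k = c k.succ * (4 * ((2 * k + 3) * (2 * k + 2))) := by
      simp only [hc]
      have : ((2 * (k.succ : ℕ) + 1).factorial : ℝ) =
          (2 * k + 3) * ((2 * k + 2) * (2 * k + 1).factorial) := by
        rw [show 2 * k.succ + 1 = (2 * k + 1) + 1 + 1 by omega, Nat.factorial_succ,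
          Nat.factorial_succ]
        push_cast; ring
      rw [this]
      have h5 : ((2 * k + 1).factorial : ℝ) ≠ 0 := by positivity
      have h6 : (2 * (k : ℝ) + 3) ≠ 0 := by positivity
      have h7 : (2 * (k : ℝ) + 2) ≠ 0 := by positivity
      rw [pow_succ]
      field_simp
    rw [e]
    refine mul_le_mul_of_nonneg_left ?_ (hpos _).le
    have : (0 : ℝ) ≤ k := by positivity
    nlinarith
  have h1 := (FormalMultilinearSeries.ofScalars 𝔸 c).hasFPowerSeriesOnBall (by rw [hr]; simp)
  have h2 : AnalyticAt ℝ (FormalMultilinearSeries.ofScalarsSum (E := 𝔸) c) (a ^ 2) :=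
    h1.analyticAt_of_mem (by rw [hr]; simp)
  have h3 : (sinhc : 𝔸 → 𝔸) = (FormalMultilinearSeries.ofScalarsSum (E := 𝔸) c) ∘ fun x => x ^ 2 := by
    funext x
    rw [Function.comp_apply, FormalMultilinearSeries.ofScalars_sum_eq, sinhc]
    simp_rw [← pow_mul]
    rfl
  rw [h3]
  exact AnalyticAt.comp (f := fun x : 𝔸 => x ^ 2) h2 (by fun_prop)

end Sinhc

/-! ### Determinants of endomorphisms -/

section Det

variable {E : Type*} [NormedAddCommGroup E] [NormedSpace ℝ E] [FiniteDimensional ℝ E]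

lemma analyticAt_det (A : E →L[ℝ] E) :
    AnalyticAt ℝ (fun A : E →L[ℝ] E => A.det) A := by
  let b := Module.finBasis ℝ E
  have h : (fun A : E →L[ℝ] E => A.det) = fun A => ∑ σ : Equiv.Perm (Fin (Module.finrank ℝ E)),
      ((Equiv.Perm.sign σ : ℤ) : ℝ) * ∏ i, b.repr (A (b i)) (σ i) := by
    funext A
    rw [ContinuousLinearMap.det, ← LinearMap.det_toMatrix b, Matrix.det_apply']
    simp [LinearMap.toMatrix_apply]
  rw [h]
  refine Finset.analyticAt_fun_sum _ fun σ _ => analyticAt_const.mul ?_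
  refine Finset.analyticAt_fun_prod _ fun i _ => ?_
  let L : (E →L[ℝ] E) →ₗ[ℝ] ℝ :=
    { toFun := fun A => b.repr (A (b i)) (σ i)
      map_add' := fun A B => by simp
      map_smul' := fun c A => by simp }
  exact (LinearMap.toContinuousLinearMap L).analyticAt A

lemma det_comp (A B : E →L[ℝ] E) : (A * B).det = A.det * B.det := by
  simp only [ContinuousLinearMap.det, ContinuousLinearMap.toLinearMap_mul, map_mul]

lemma det_one' : (1 : E →L[ℝ] E).det = 1 := by
  simp [ContinuousLinearMap.det]

lemma exp_neg_mul_exp (A : E →L[ℝ] E) : NormedSpace.exp (-A) * NormedSpace.exp A = 1 := by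
  let _ : NormedAlgebra ℚ (E →L[ℝ] E) := NormedAlgebra.restrictScalars ℚ ℝ _
  rw [← NormedSpace.exp_add_of_commute]
  · simp
  · simp [Commute, SemiconjBy]

end Det

/-! ### The Jacobian of the exponential map -/

section Jacobian

variable {E : Type*} [NormedAddCommGroup E] [NormedSpace ℝ E] [FiniteDimensional ℝ E]
  {G : Type*} [TopologicalSpace G] [T2Space G] [ChartedSpace E G] [Group G]
  [LieGroup 𝓘(ℝ, E) ∞ G]

lemma jacF_def (X : E) : jacF G X = √|(sinhc (adOp G X)).det| := rfl

lemma adOp_smul (c : ℝ) (X : E) : adOp G (c • X) = c • adOp G X := by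
  ext Y
  exact smul_lie (L := GroupLieAlgebra 𝓘(ℝ, E) G) (M := GroupLieAlgebra 𝓘(ℝ, E) G) c X Y

lemma adOp_add (X Y : E) : adOp G (X + Y) = adOp G X + adOp G Y := by
  ext Z
  exact add_lie (L := GroupLieAlgebra 𝓘(ℝ, E) G) (M := GroupLieAlgebra 𝓘(ℝ, E) G) X Y Z

lemma adOp_neg (X : E) : adOp G (-X) = -adOp G X := by
  simpa using adOp_smul (G := G) (-1) X

lemma continuous_adOp : Continuous (adOp G : E → E →L[ℝ] E) := by
  let L : E →ₗ[ℝ] (E →L[ℝ] E) :=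
    { toFun := adOp G, map_add' := adOp_add, map_smul' := adOp_smul }
  exact L.continuous_of_finiteDimensional

lemma jacF_neg (X : E) : jacF G (-X) = jacF G X := by
  rw [jacF_def, jacF_def, adOp_neg, sinhc_neg]

lemma jacF_nonneg (X : E) : 0 ≤ jacF G X := Real.sqrt_nonneg _

lemma jacF_sq (X : E) : jacF G X ^ 2 = |(sinhc (adOp G X)).det| := Real.sq_sqrt (abs_nonneg _)

lemma continuous_jacF : Continuous (jacF G : E → ℝ) := by
  have h1 : Continuous (sinhc : (E →L[ℝ] E) → E →L[ℝ] E) :=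
    continuous_iff_continuousAt.2 fun a => (analyticAt_sinhc a).continuousAt
  exact Real.continuous_sqrt.comp (ContinuousLinearMap.continuous_det.comp
    (h1.comp continuous_adOp)).abs

variable (G) in
/-- The density of the Haar measure in exponential coordinates. -/
def jacJ (𝒪 : Set E) (X : E) : ℝ := |(leftDexp G 𝒪 X).det|

variable [MeasurableSpace G] {m : Measure G} {𝒪 : Set E}

namespace IsExpDomain

/-- Integrating the derivative of `s ↦ s · leftDexp(sX)` over `[0, 1]` gives `∫ exp(-s ad)`; pulling
out `exp(-ad/2)` leaves the symmetric integral computed above. -/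
lemma leftDexp_eq (h𝒪 : IsExpDomain m 𝒪) (X : E) :
    leftDexp G 𝒪 X = NormedSpace.exp (-((1 / 2 : ℝ) • adOp G X)) * sinhc (adOp G X) := by
  let _ : NormedAlgebra ℚ (E →L[ℝ] E) := NormedAlgebra.restrictScalars ℚ ℝ _
  have hc : Continuous (fun s : ℝ => NormedSpace.exp (s • (-adOp G X))) :=
    NormedSpace.exp_continuous.comp (continuous_id.smul continuous_const)
  have h := intervalIntegral.integral_eq_sub_of_hasDerivAt (a := 0) (b := 1)
    (fun s _ => h𝒪.hasDerivAt_smul_leftDexp (G := G) X s) (hc.intervalIntegrable _ _)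
  simp only [one_smul, zero_smul, sub_zero] at h
  rw [← h, ← integral_exp_half_sub]
  have h2 : ∀ s : ℝ, NormedSpace.exp (s • (-adOp G X)) =
      NormedSpace.exp (-((1 / 2 : ℝ) • adOp G X)) *
        NormedSpace.exp ((1 / 2 - s) • adOp G X) := by
    intro s
    rw [← NormedSpace.exp_add_of_commute]
    · congr 1; module
    · exact (((Commute.refl (adOp G X)).smul_left _).smul_right _).neg_left
  simp_rw [h2]
  have hc2 : Continuous (fun s : ℝ => NormedSpace.exp ((1 / 2 - s) • adOp G X)) :=
    NormedSpace.exp_continuous.comp (by fun_prop)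
  exact (ContinuousLinearMap.mul ℝ (E →L[ℝ] E)
    (NormedSpace.exp (-((1 / 2 : ℝ) • adOp G X)))).intervalIntegral_comp_comm
    (hc2.intervalIntegrable _ _)

lemma det_exp_ne_zero (A : E →L[ℝ] E) : (NormedSpace.exp A).det ≠ 0 := by
  intro h
  have := congrArg ContinuousLinearMap.det (exp_neg_mul_exp A)
  rw [det_comp, h, mul_zero, det_one'] at this
  exact zero_ne_one this

lemma jacJ_eq (h𝒪 : IsExpDomain m 𝒪) (X : E) :
    jacJ G 𝒪 X = |(NormedSpace.exp (-((1 / 2 : ℝ) • adOp G X))).det| * jacF G X ^ 2 := by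
  rw [jacJ, h𝒪.leftDexp_eq, det_comp, abs_mul, jacF_sq]

/-- `F` is even, while the factors `|det exp(∓ad/2)|` are inverse to each other and cancel. This is
one of the two relations determining `F²` in terms of the density of Haar measure. -/
lemma jacJ_mul_neg (h𝒪 : IsExpDomain m 𝒪) (X : E) :
    jacJ G 𝒪 X * jacJ G 𝒪 (-X) = jacF G X ^ 4 := by
  rw [h𝒪.jacJ_eq, h𝒪.jacJ_eq, jacF_neg, adOp_neg, smul_neg, neg_neg]
  have h : |(NormedSpace.exp (-((1 / 2 : ℝ) • adOp G X))).det| *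
      |(NormedSpace.exp ((1 / 2 : ℝ) • adOp G X)).det| = 1 := by
    rw [← abs_mul, ← det_comp, exp_neg_mul_exp, det_one', abs_one]
  linear_combination (jacF G X ^ 4) * h

lemma continuous_jacJ (h𝒪 : IsExpDomain m 𝒪) : Continuous (jacJ G 𝒪 : E → ℝ) :=
  (ContinuousLinearMap.continuous_det.comp h𝒪.continuous_leftDexp).abs

lemma jacJ_zero (h𝒪 : IsExpDomain m 𝒪) : jacJ G 𝒪 (0 : E) = 1 := by
  rw [jacJ, h𝒪.leftDexp_zero, det_one', abs_one]

lemma jacJ_nonneg (X : E) : 0 ≤ jacJ G 𝒪 X := abs_nonneg _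

/-- On `𝒪` the map `x ↦ log(exp(-X) exp x)` has the local left inverse `y ↦ log(exp X exp y)`, so
its derivative has nonzero determinant. -/
lemma jacJ_pos (h𝒪 : IsExpDomain m 𝒪) {X : E} (hX : X ∈ 𝒪) : 0 < jacJ G 𝒪 X := by
  have := topologicalGroup_of_lieGroup 𝓘(ℝ, E) ∞ (G := G)
  have hv : lieLog 𝒪 (lieExp G (-X) * lieExp G X) = 0 := by
    rw [h𝒪.lieExp_neg, inv_mul_cancel, h𝒪.lieLog_one]
  have h0 : lieExp G X * lieExp G (0 : E) ∈ lieExp G '' 𝒪 := by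
    rw [lieExp_zero, mul_one]; exact mem_image_of_mem _ hX
  have h1 : HasFDerivAt (fun y : E => lieLog 𝒪 (lieExp G X * lieExp G y))
      (fderiv ℝ (fun y : E => lieLog 𝒪 (lieExp G X * lieExp G y)) 0)
      (lieLog 𝒪 (lieExp G (-X) * lieExp G X)) := by
    rw [hv]
    exact ((h𝒪.contDiffAt_leftLog _ h0).differentiableAt (by simp)).hasFDerivAt
  have h2 := h1.comp X (h𝒪.hasFDerivAt_leftDexp X)
  have hc : ContinuousAt (fun x : E => lieExp G (-X) * lieExp G x) X :=
    (continuous_const.mul h𝒪.continuous_lieExp).continuousAt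
  have h3 := h2.unique ((hasFDerivAt_id X).congr_of_eventuallyEq (by
    filter_upwards [h𝒪.eventually_mem hc (h𝒪.exp_neg_mul_mem X), h𝒪.isOpen.mem_nhds hX]
      with x hx hx'
    simp only [Function.comp_apply]
    rw [lieExp_lieLog hx, h𝒪.lieExp_neg, mul_inv_cancel_left, h𝒪.lieLog_lieExp hx', id]))
  refine abs_pos.2 fun h => ?_
  have h4 := congrArg ContinuousLinearMap.det h3
  have h5 := det_comp (fderiv ℝ (fun y : E => lieLog 𝒪 (lieExp G X * lieExp G y)) 0)
    (leftDexp G 𝒪 X)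
  rw [h, mul_zero] at h5
  have h6 : (0 : ℝ) = 1 := h5.symm.trans (h4.trans det_one')
  exact zero_ne_one h6

lemma jacF_pos (h𝒪 : IsExpDomain m 𝒪) {X : E} (hX : X ∈ 𝒪) : 0 < jacF G X := by
  refine (jacF_nonneg X).lt_of_ne' fun h => ?_
  have := h𝒪.jacJ_pos hX
  rw [h𝒪.jacJ_eq, h] at this
  simp at this

/-- Along the line through `X` the determinant of `λ(t ad_X)` is analytic in `t` and equals `1` at
`t = 0`, so its zeros form a null set. -/
lemma ae_smul_det_ne_zero (h𝒪 : IsExpDomain m 𝒪) (X : E) :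
    ∀ᵐ t : ℝ, jacJ G 𝒪 (t • X) ≠ 0 := by
  have ha : AnalyticOnNhd ℝ (fun t : ℝ => (sinhc (t • adOp G X)).det) univ := by
    intro t _
    have h1 : AnalyticAt ℝ (fun t : ℝ => t • adOp G X) t :=
      analyticAt_id.smul analyticAt_const
    exact AnalyticAt.comp (f := fun t : ℝ => sinhc (t • adOp G X)) (analyticAt_det _)
      (AnalyticAt.comp (f := fun t : ℝ => t • adOp G X) (analyticAt_sinhc _) h1)
  have h0 : (fun t : ℝ => (sinhc (t • adOp G X)).det) 0 ≠ 0 := by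
    simp [sinhc_zero, det_one']
  have h1 := ha.preimage_zero_mem_codiscrete h0
  have h2 := ae_restrict_le_codiscreteWithin (μ := (volume : Measure ℝ)) MeasurableSet.univ h1
  rw [Measure.restrict_univ] at h2
  filter_upwards [h2] with t ht
  rw [h𝒪.jacJ_eq, adOp_smul, jacF_sq, adOp_smul]
  exact mul_ne_zero (abs_ne_zero.2 (det_exp_ne_zero _)) (abs_ne_zero.2 ht)

variable [MeasurableSpace E] [BorelSpace E]

/-- The singular set of the exponential map is Lebesgue null. -/
lemma ae_det_ne_zero (h𝒪 : IsExpDomain m 𝒪) :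
    ∀ᵐ X ∂(Measure.addHaar : Measure E), jacJ G 𝒪 X ≠ 0 := by
  set Z : Set E := {X | jacJ G 𝒪 X = 0} with hZ
  have hZm : MeasurableSet Z := (isClosed_eq h𝒪.continuous_jacJ continuous_const).measurableSet
  have hm : MeasurableSet {p : E × ℝ | p.2 • p.1 ∈ Z} :=
    (measurable_snd.smul measurable_fst) hZm
  set μ : Measure E := Measure.addHaar
  -- The null sets along lines are assembled by Fubini on `E × (1, 2)`: some single `t` works for
  -- almost every `X`. As `t ≠ 0` on this interval, scaling by `t` preserves null sets.
  set ν : Measure ℝ := volume.restrict (Ioo 1 2)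
  have h1 : (μ.prod ν) {p : E × ℝ | p.2 • p.1 ∈ Z} = 0 := by
    rw [Measure.prod_apply hm]
    simp only [lintegral_eq_zero_iff (measurable_measure_prodMk_left hm)]
    refine Eventually.of_forall fun X => ?_
    have := ae_restrict_of_ae (s := Ioo 1 2) (h𝒪.ae_smul_det_ne_zero (G := G) X)
    rw [ae_iff] at this
    simpa only [hZ, not_not, ne_eq, mem_ofPred_eq] using! this
  rw [Measure.prod_apply_symm hm, lintegral_eq_zero_iff (measurable_measure_prodMk_right hm)] at h1
  have hν : ν ≠ 0 := by
    intro h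
    have : ν univ = 0 := by simp [h]
    simp [ν] at this
  have : NeBot (ae ν) := ae_neBot.2 hν
  obtain ⟨t, ht, ht2⟩ := (h1.and (ae_restrict_mem measurableSet_Ioo)).exists
  have ht0 : t ≠ 0 := by linarith [ht2.1]
  have h3 : μ ((fun X : E => t • X) ⁻¹' Z) = 0 := ht
  rw [Measure.addHaar_preimage_smul μ ht0] at h3
  rw [ae_iff]
  rcases mul_eq_zero.1 h3 with h | h
  · exfalso
    rw [ENNReal.ofReal_eq_zero] at h
    have : 0 < |(t ^ Module.finrank ℝ E)⁻¹| := by positivity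
    linarith
  · simpa [hZ] using h

end IsExpDomain

end Jacobian

/-! ### Haar measure in exponential coordinates -/

section HaarExp

variable {E : Type*} [NormedAddCommGroup E] [NormedSpace ℝ E] [FiniteDimensional ℝ E]
  [MeasurableSpace E] [BorelSpace E]
  {G : Type*} [TopologicalSpace G] [T2Space G] [SecondCountableTopology G]
  [ChartedSpace E G] [Group G] [LieGroup 𝓘(ℝ, E) ∞ G]
  [MeasurableSpace G] [BorelSpace G]

variable (G) in
/-- The measure on `G` with density `jacJ` in exponential coordinates on `𝒪`. -/
def expMeasure (𝒪 : Set E) : Measure G :=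
  (((Measure.addHaar : Measure E).restrict 𝒪).withDensity
    (fun X => ENNReal.ofReal (jacJ G 𝒪 X))).map (lieExp G)

variable {m : Measure G} {𝒪 : Set E}

namespace IsExpDomain

lemma measurable_lieExp (h𝒪 : IsExpDomain m 𝒪) : Measurable (lieExp G : E → G) :=
  h𝒪.continuous_lieExp.measurable

lemma measurableSet_image (h𝒪 : IsExpDomain m 𝒪) : MeasurableSet (lieExp G '' 𝒪) :=
  h𝒪.isOpen_image.measurableSet

lemma expMeasure_apply (h𝒪 : IsExpDomain m 𝒪) {A : Set G} (hA : MeasurableSet A) :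
    expMeasure G 𝒪 A = ∫⁻ X in 𝒪 ∩ lieExp G ⁻¹' A, ENNReal.ofReal (jacJ G 𝒪 X)
      ∂(Measure.addHaar : Measure E) := by
  rw [expMeasure, Measure.map_apply h𝒪.measurable_lieExp hA,
    withDensity_apply _ (h𝒪.measurable_lieExp hA), Measure.restrict_restrict
    (h𝒪.measurable_lieExp hA), inter_comm]

lemma expMeasure_inter (h𝒪 : IsExpDomain m 𝒪) {A : Set G} (hA : MeasurableSet A) :
    expMeasure G 𝒪 (A ∩ lieExp G '' 𝒪) = expMeasure G 𝒪 A := by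
  rw [h𝒪.expMeasure_apply hA, h𝒪.expMeasure_apply (hA.inter h𝒪.measurableSet_image)]
  congr 2
  ext X
  constructor
  · rintro ⟨h1, h2, -⟩; exact ⟨h1, h2⟩
  · rintro ⟨h1, h2⟩; exact ⟨h1, h2, mem_image_of_mem _ h1⟩

/-- With `T y = log(g exp y)`, left translation cancels in `exp(-x) exp y = exp(-Tx) exp(Ty)`; the
chain rule at `y = x` does the rest. -/
lemma leftDexp_leftLog (h𝒪 : IsExpDomain m 𝒪) {g : G} {x : E}
    (hgx : g * lieExp G x ∈ lieExp G '' 𝒪) :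
    leftDexp G 𝒪 x = leftDexp G 𝒪 (lieLog 𝒪 (g * lieExp G x)) *
      fderiv ℝ (fun y : E => lieLog 𝒪 (g * lieExp G y)) x := by
  have := topologicalGroup_of_lieGroup 𝓘(ℝ, E) ∞ (G := G)
  have h1 := ((h𝒪.contDiffAt_leftLog g hgx).differentiableAt (by simp)).hasFDerivAt
  have h2 := (h𝒪.hasFDerivAt_leftDexp (lieLog 𝒪 (g * lieExp G x))).comp x h1
  refine (h𝒪.hasFDerivAt_leftDexp x).unique (h2.congr_of_eventuallyEq ?_)
  have hc : ContinuousAt (fun y : E => g * lieExp G y) x :=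
    (continuous_const.mul h𝒪.continuous_lieExp).continuousAt
  filter_upwards [h𝒪.eventually_mem hc hgx] with y hy
  simp only [Function.comp_apply]
  rw [lieExp_lieLog hy, h𝒪.lieExp_neg (lieLog 𝒪 (g * lieExp G x)), lieExp_lieLog hgx,
    h𝒪.lieExp_neg]
  congr 1
  group

/-- In logarithmic coordinates left translation by `g` is the change of variables `T y = log(g exp
y)`. The preceding chain rule says exactly that its Jacobian is absorbed by the density. -/
lemma expMeasure_preimage_mul (h𝒪 : IsExpDomain m 𝒪) (g : G) {A : Set G} (hA : MeasurableSet A)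
    (hA1 : A ⊆ lieExp G '' 𝒪) (hA2 : (fun x => g * x) ⁻¹' A ⊆ lieExp G '' 𝒪) :
    expMeasure G 𝒪 ((fun x => g * x) ⁻¹' A) = expMeasure G 𝒪 A := by
  have := topologicalGroup_of_lieGroup 𝓘(ℝ, E) ∞ (G := G)
  have hgA : MeasurableSet ((fun x => g * x) ⁻¹' A) := (continuous_const_mul g).measurable hA
  rw [h𝒪.expMeasure_apply hgA, h𝒪.expMeasure_apply hA]
  set S := 𝒪 ∩ lieExp G ⁻¹' ((fun x => g * x) ⁻¹' A) with hS
  set T : E → E := fun y => lieLog 𝒪 (g * lieExp G y) with hT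
  have hSm : MeasurableSet S := h𝒪.isOpen.measurableSet.inter (h𝒪.measurable_lieExp hgA)
  have himg : T '' S = 𝒪 ∩ lieExp G ⁻¹' A := by
    ext y
    constructor
    · rintro ⟨x, ⟨hx, hx2⟩, rfl⟩
      have hx3 : g * lieExp G x ∈ A := hx2
      refine ⟨lieLog_mem (hA1 hx3), ?_⟩
      simp only [mem_preimage, hT, lieExp_lieLog (hA1 hx3)]
      exact hx3
    · rintro ⟨hy, hy2⟩
      have hy3 : g⁻¹ * lieExp G y ∈ (fun x => g * x) ⁻¹' A := by simpa using hy2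
      refine ⟨lieLog 𝒪 (g⁻¹ * lieExp G y), ⟨lieLog_mem (hA2 hy3), ?_⟩, ?_⟩
      · rw [mem_preimage, lieExp_lieLog (hA2 hy3)]; exact hy3
      · simp only [hT, lieExp_lieLog (hA2 hy3), mul_inv_cancel_left, h𝒪.lieLog_lieExp hy]
  have hinj : InjOn T S := by
    rintro x ⟨hx, hx2⟩ y ⟨hy, hy2⟩ hxy
    have h1 : lieExp G (T x) = lieExp G (T y) := by rw [hxy]
    have hx3 : g * lieExp G x ∈ A := hx2
    have hy3 : g * lieExp G y ∈ A := hy2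
    simp only [hT, lieExp_lieLog (hA1 hx3), lieExp_lieLog (hA1 hy3), mul_right_inj] at h1
    exact h𝒪.injOn hx hy h1
  have hd : ∀ x ∈ S, HasFDerivWithinAt T (fderiv ℝ T x) S x := fun x hx =>
    ((h𝒪.contDiffAt_leftLog g (hA1 hx.2)).differentiableAt (by simp)).hasFDerivAt.hasFDerivWithinAt
  rw [← himg, lintegral_image_eq_lintegral_abs_det_fderiv_mul _ hSm hd hinj]
  refine setLIntegral_congr_fun hSm fun x hx => ?_
  rw [← ENNReal.ofReal_mul (abs_nonneg _), jacJ, jacJ, h𝒪.leftDexp_leftLog (hA1 hx.2), det_comp,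
    abs_mul, mul_comm]

/-- The measure `expMeasure` agrees up to a factor with the Haar measure. -/
lemma exists_expMeasure_eq (h𝒪 : IsExpDomain m 𝒪) [m.IsHaarMeasure] :
    ∃ c : NNReal, c ≠ 0 ∧ m = c • expMeasure G 𝒪 := by
  have := topologicalGroup_of_lieGroup 𝓘(ℝ, E) ∞ (G := G)
  have := Manifold.locallyCompact_of_finiteDimensional 𝓘(ℝ, E) (M := G)
  have hU := h𝒪.isOpen_image (G := G)
  have hml : ∀ g : G, Measurable (fun x : G => g * x) := fun g => (continuous_const_mul g).measurable
  let g : ℕ → G := TopologicalSpace.denseSeq G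
  let W : ℕ → Set G := fun n => (fun x => (g n)⁻¹ * x) ⁻¹' (lieExp G '' 𝒪)
  have hWm : ∀ n, MeasurableSet (W n) := fun n => hml _ h𝒪.measurableSet_image
  have hWu : ⋃ n, W n = univ := by
    refine eq_univ_of_forall fun x => ?_
    have hop : IsOpen {h : G | h⁻¹ * x ∈ lieExp G '' 𝒪} :=
      hU.preimage (continuous_inv.mul continuous_const)
    obtain ⟨n, hn⟩ := (TopologicalSpace.denseRange_denseSeq G).exists_mem_open hop
      ⟨x, by simpa using h𝒪.one_mem⟩
    exact mem_iUnion.2 ⟨n, hn⟩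
  let P : ℕ → Set G := disjointed W
  have hPm : ∀ n, MeasurableSet (P n) := fun n => MeasurableSet.disjointed hWm n
  have hPW : ∀ n, P n ⊆ W n := fun n => disjointed_subset W n
  have hPu : ⋃ n, P n = univ := by rw [iUnion_disjointed, hWu]
  have hPd : Pairwise (Function.onFun Disjoint P) := disjoint_disjointed W
  -- Countably many translates of `𝒰` cover `G`. The corresponding translates of `expMeasure` are
  -- glued along a disjoint refinement of this cover into a measure on all of `G`, to which
  -- uniqueness of Haar measure can be applied.
  let μ : Measure G := Measure.sum fun n =>
    ((expMeasure G 𝒪).map (fun x => g n * x)).restrict (P n)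
  have hμ : ∀ {B : Set G}, MeasurableSet B →
      μ B = ∑' n, expMeasure G 𝒪 ((fun x => g n * x) ⁻¹' (B ∩ P n)) := by
    intro B hB
    rw [Measure.sum_apply _ hB]
    congr 1; funext n
    rw [Measure.restrict_apply hB, Measure.map_apply (hml _) (hB.inter (hPm n))]
  -- Inside a single translate `h𝒰` the glued measure is the translate of `expMeasure` by `h`,
  -- because local invariance makes all pieces agree. In particular the construction does not depend
  -- on the cover, and left invariance follows piece by piece.
  have key : ∀ (h : G) {B : Set G}, MeasurableSet B → (∀ x ∈ B, h⁻¹ * x ∈ lieExp G '' 𝒪) →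
      μ B = expMeasure G 𝒪 ((fun x => h * x) ⁻¹' B) := by
    intro h B hB hBh
    have e1 : ∀ n, expMeasure G 𝒪 ((fun x => g n * x) ⁻¹' (B ∩ P n)) =
        expMeasure G 𝒪 ((fun x => h * x) ⁻¹' (B ∩ P n)) := by
      intro n
      have := h𝒪.expMeasure_preimage_mul (h⁻¹ * g n)
        (A := (fun x => h * x) ⁻¹' (B ∩ P n)) (hml h (hB.inter (hPm n)))
        (fun x hx => by simpa using hBh _ hx.1)
        (fun x hx => by
          have : g n * x ∈ P n := by simpa [mul_assoc] using hx.2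
          simpa [W] using hPW n this)
      rw [← this]
      congr 1
      ext x
      simp [mul_assoc]
    rw [hμ hB]
    simp_rw [e1]
    rw [← measure_iUnion]
    · rw [← preimage_iUnion, ← inter_iUnion, hPu, inter_univ]
    · exact fun i j hij => ((hPd hij).mono inter_subset_right inter_subset_right).preimage _
    · exact fun n => hml h (hB.inter (hPm n))
  have hinv : μ.IsMulLeftInvariant := by
    refine ⟨fun k => ?_⟩
    ext A hA
    rw [Measure.map_apply (hml k) hA]
    have e2 : ∀ {B : Set G}, MeasurableSet B →
        μ ((fun x => k * x) ⁻¹' B) = ∑' n, μ ((fun x => k * x) ⁻¹' (B ∩ P n)) := by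
      intro B hB
      rw [← measure_iUnion, ← preimage_iUnion, ← inter_iUnion, hPu, inter_univ]
      · exact fun i j hij => ((hPd hij).mono inter_subset_right inter_subset_right).preimage _
      · exact fun n => hml k (hB.inter (hPm n))
    rw [e2 hA, hμ hA]
    congr 1; funext n
    rw [key (k⁻¹ * g n) (hml k (hA.inter (hPm n)))]
    · congr 1
      ext x
      simp [mul_assoc]
    · intro x hx
      have : k * x ∈ P n := hx.2
      simpa [W, mul_assoc] using hPW n this
  have hμU : ∀ {B : Set G}, MeasurableSet B → B ⊆ lieExp G '' 𝒪 → μ B = expMeasure G 𝒪 B := by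
    intro B hB hBU
    rw [key 1 hB fun x hx => by simpa using hBU hx]
    simp
  -- For a left-invariant measure it suffices that one nonempty open set has finite measure. The
  -- exponential image of a ball on which the density is below `2` serves.
  have hfin : IsFiniteMeasureOnCompacts μ := by
    obtain ⟨r, hr, hr2⟩ := Metric.mem_nhds_iff.1 (inter_mem h𝒪.mem_nhds
      (h𝒪.continuous_jacJ.continuousAt.eventually_lt (continuousAt_const (y := (2 : ℝ)))
        (by rw [h𝒪.jacJ_zero]; norm_num)))
    let V : Set G := lieExp G '' 𝒪 ∩ lieLog 𝒪 ⁻¹' Metric.ball (0 : E) r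
    have hV : IsOpen V := h𝒪.continuousOn_lieLog.isOpen_inter_preimage hU Metric.isOpen_ball
    have hVn : V.Nonempty := ⟨1, h𝒪.one_mem, by
      rw [mem_preimage, h𝒪.lieLog_one]; exact Metric.mem_ball_self hr⟩
    have hVt : μ V ≠ ⊤ := by
      rw [hμU hV.measurableSet inter_subset_left, h𝒪.expMeasure_apply hV.measurableSet]
      have hsub : 𝒪 ∩ lieExp G ⁻¹' V ⊆ Metric.ball (0 : E) r := by
        rintro x ⟨hx, -, hx2⟩
        rwa [mem_preimage, h𝒪.lieLog_lieExp hx] at hx2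
      refine ((lintegral_mono_set hsub).trans_lt ?_).ne
      calc ∫⁻ X in Metric.ball (0 : E) r, ENNReal.ofReal (jacJ G 𝒪 X) ∂Measure.addHaar
          ≤ ∫⁻ X in Metric.ball (0 : E) r, ENNReal.ofReal 2 ∂Measure.addHaar :=
            setLIntegral_mono' measurableSet_ball fun X hX =>
              ENNReal.ofReal_le_ofReal (le_of_lt (hr2 hX).2)
        _ < ⊤ := by
          rw [setLIntegral_const]
          exact ENNReal.mul_lt_top ENNReal.ofReal_lt_top measure_ball_lt_top
    exact ⟨fun K hK => measure_lt_top_of_isCompact_of_isMulLeftInvariant V hV hVn hVt hK⟩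
  have huniq := Measure.isMulLeftInvariant_eq_smul μ m
  set c := Measure.haarScalarFactor μ m
  have hUpos : μ (lieExp G '' 𝒪) ≠ 0 := by
    rw [hμU h𝒪.measurableSet_image subset_rfl, h𝒪.expMeasure_apply h𝒪.measurableSet_image]
    rw [inter_eq_left.2 (subset_preimage_image _ _)]
    refine ((setLIntegral_pos_iff
      (h𝒪.continuous_jacJ.measurable.ennreal_ofReal)).2 ?_).ne'
    rw [inter_eq_right.2]
    · exact h𝒪.isOpen.measure_pos _ ⟨0, h𝒪.zero_mem⟩
    · intro X hX
      rw [Function.mem_support]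
      exact (ENNReal.ofReal_pos.2 (h𝒪.jacJ_pos hX)).ne'
  have hc : c ≠ 0 := by
    intro h
    rw [h, zero_smul] at huniq
    exact hUpos (by rw [huniq]; simp)
  have hm : m = c⁻¹ • μ := by
    rw [huniq, smul_smul, inv_mul_cancel₀ hc, one_smul]
  refine ⟨c⁻¹, inv_ne_zero hc, ?_⟩
  ext A hA
  -- The glued measure was compared with `expMeasure` on `𝒰` only; both `m` and `expMeasure` ignore
  -- the complement of `𝒰`.
  have h1 : m A = m (A ∩ lieExp G '' 𝒪) := by
    refine le_antisymm ?_ (measure_mono inter_subset_left)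
    have := measure_union_le (μ := m) (A ∩ lieExp G '' 𝒪) (lieExp G '' 𝒪)ᶜ
    rw [h𝒪.null_compl, add_zero] at this
    refine (measure_mono fun x hx => ?_).trans this
    by_cases h : x ∈ lieExp G '' 𝒪
    · exact Or.inl ⟨hx, h⟩
    · exact Or.inr h
  rw [h1, hm, Measure.smul_apply, Measure.smul_apply,
    hμU (hA.inter h𝒪.measurableSet_image) inter_subset_right, h𝒪.expMeasure_inter hA]

/-- The ratio is `c` times the mean over a small ball of a continuous density with value `1` at the
origin. So the `limUnder` in `algMeasure` is a genuine limit. -/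
lemma tendsto_ratio (h𝒪 : IsExpDomain m 𝒪) {c : NNReal} (hm : m = c • expMeasure G 𝒪) :
    Tendsto (fun r : ℝ => m (lieExp G '' Metric.ball (0 : E) r) /
      (Measure.addHaar : Measure E) (Metric.ball 0 r)) (𝓝[>] (0 : ℝ)) (𝓝 (c : ℝ≥0∞)) := by
  set μ : Measure E := Measure.addHaar
  have hev : ∀ᶠ r : ℝ in 𝓝[>] 0, Metric.ball (0 : E) r ⊆ 𝒪 := by
    obtain ⟨r, hr, hr2⟩ := Metric.mem_nhds_iff.1 h𝒪.mem_nhds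
    filter_upwards [Ioo_mem_nhdsGT hr] with s hs
    exact (Metric.ball_subset_ball hs.2.le).trans hr2
  set f : ℝ → ℝ≥0∞ := fun r => (∫⁻ X in Metric.ball (0 : E) r, ENNReal.ofReal (jacJ G 𝒪 X) ∂μ) /
    μ (Metric.ball 0 r) with hf
  have h1 : ∀ᶠ r : ℝ in 𝓝[>] 0, m (lieExp G '' Metric.ball (0 : E) r) / μ (Metric.ball 0 r) =
      c * f r := by
    filter_upwards [hev] with r hr
    have hop : lieExp G '' Metric.ball (0 : E) r =
        lieExp G '' 𝒪 ∩ lieLog 𝒪 ⁻¹' Metric.ball (0 : E) r := by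
      ext x
      constructor
      · rintro ⟨y, hy, rfl⟩
        exact ⟨mem_image_of_mem _ (hr hy), by rwa [mem_preimage, h𝒪.lieLog_lieExp (hr hy)]⟩
      · rintro ⟨hx, hx2⟩
        exact ⟨_, hx2, lieExp_lieLog hx⟩
    have hmeas : MeasurableSet (lieExp G '' Metric.ball (0 : E) r) := by
      rw [hop]
      exact (h𝒪.continuousOn_lieLog.isOpen_inter_preimage h𝒪.isOpen_image
        Metric.isOpen_ball).measurableSet
    have hset : 𝒪 ∩ lieExp G ⁻¹' (lieExp G '' Metric.ball (0 : E) r) = Metric.ball 0 r := by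
      ext x
      constructor
      · rintro ⟨hx, y, hy, hxy⟩
        rwa [← h𝒪.injOn (hr hy) hx hxy]
      · exact fun hx => ⟨hr hx, mem_image_of_mem _ hx⟩
    rw [hm, Measure.smul_apply, h𝒪.expMeasure_apply hmeas, hset, hf]
    simp only [ENNReal.smul_def, smul_eq_mul, mul_div_assoc]
    rfl
  have hball : ∀ r : ℝ, 0 < r → μ (Metric.ball (0 : E) r) ≠ 0 ∧ μ (Metric.ball (0 : E) r) ≠ ⊤ :=
    fun r hr => ⟨(Metric.measure_ball_pos μ _ hr).ne', measure_ball_lt_top.ne⟩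
  have hcont : Tendsto (fun X : E => ENNReal.ofReal (jacJ G 𝒪 X)) (𝓝 0) (𝓝 1) := by
    have := (ENNReal.continuous_ofReal.comp (h𝒪.continuous_jacJ (G := G))).tendsto (0 : E)
    simpa [h𝒪.jacJ_zero, Function.comp_def] using this
  have h2 : Tendsto f (𝓝[>] 0) (𝓝 1) := by
    refine tendsto_order.2 ⟨fun a ha => ?_, fun a ha => ?_⟩
    · obtain ⟨b, hab, hb⟩ := exists_between ha
      obtain ⟨r, hr, hr2⟩ := Metric.eventually_nhds_iff_ball.1 (hcont.eventually (lt_mem_nhds hb))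
      filter_upwards [Ioo_mem_nhdsGT hr] with s hs
      refine hab.trans_le ?_
      rw [hf, ENNReal.le_div_iff_mul_le (Or.inl (hball s hs.1).1) (Or.inl (hball s hs.1).2),
        ← setLIntegral_const]
      exact setLIntegral_mono' measurableSet_ball fun X hX =>
        (hr2 X (Metric.ball_subset_ball hs.2.le hX)).le
    · obtain ⟨b, hb, hab⟩ := exists_between ha
      obtain ⟨r, hr, hr2⟩ := Metric.eventually_nhds_iff_ball.1 (hcont.eventually (gt_mem_nhds hb))
      filter_upwards [Ioo_mem_nhdsGT hr] with s hs
      refine lt_of_le_of_lt ?_ hab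
      rw [hf, ENNReal.div_le_iff_le_mul (Or.inl (hball s hs.1).1) (Or.inl (hball s hs.1).2),
        ← setLIntegral_const]
      exact setLIntegral_mono' measurableSet_ball fun X hX =>
        (hr2 X (Metric.ball_subset_ball hs.2.le hX)).le
  have h3 := ENNReal.Tendsto.const_mul (a := (c : ℝ≥0∞)) h2 (Or.inl one_ne_zero)
  rw [mul_one] at h3
  exact h3.congr' (h1.mono fun r hr => hr.symm)

/-- The point is that the same constant `c` occurs twice, so that no normalizing factor remains
between `m` and `algMeasure m` in exponential coordinates. -/
lemma exists_algMeasure_eq (h𝒪 : IsExpDomain m 𝒪) [m.IsHaarMeasure] :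
    ∃ c : NNReal, c ≠ 0 ∧ algMeasure (E := E) m = c • Measure.addHaar ∧
      m = c • expMeasure G 𝒪 := by
  obtain ⟨c, hc, hm⟩ := h𝒪.exists_expMeasure_eq
  refine ⟨c, hc, ?_, hm⟩
  rw [algMeasure, (h𝒪.tendsto_ratio hm).limUnder_eq]
  rfl

lemma isAddHaarMeasure_algMeasure (h𝒪 : IsExpDomain m 𝒪) [m.IsHaarMeasure] :
    (algMeasure (E := E) m).IsAddHaarMeasure := by
  obtain ⟨c, hc, h, -⟩ := h𝒪.exists_algMeasure_eq
  rw [h]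
  exact Measure.IsAddHaarMeasure.smul _ (by simpa using hc) (by simp)

/-- Haar measure in exponential coordinates. -/
lemma map_lieExp (h𝒪 : IsExpDomain m 𝒪) [m.IsHaarMeasure] :
    (((algMeasure (E := E) m).restrict 𝒪).withDensity
      (fun X => ENNReal.ofReal (jacJ G 𝒪 X))).map (lieExp G) = m := by
  obtain ⟨c, hc, h, hm⟩ := h𝒪.exists_algMeasure_eq
  conv_rhs => rw [hm]
  have h' : algMeasure (E := E) m = (c : ℝ≥0∞) • Measure.addHaar := h
  rw [h', Measure.restrict_smul, withDensity_smul_measure, Measure.map_smul]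
  rfl

end IsExpDomain

end HaarExp

/-! ### The modular function and the boundary of the exponential domain -/

section Modular

variable {G : Type*} [TopologicalSpace G] [T2Space G] [SecondCountableTopology G] [Group G]
  [IsTopologicalGroup G] [LocallyCompactSpace G] [MeasurableSpace G] [BorelSpace G]
  {m : Measure G} [m.IsHaarMeasure]

/-- For a bump function `f` the modular function is the quotient of `∫ f(x g) dx` by `∫ f`. The
numerator is a convolution integral against the image of Haar measure under inversion, hence
continuous in `g`. -/
lemma continuous_modularCharacterFun : Continuous (Measure.modularCharacterFun : G → NNReal) := by
  let μ : Measure G := Measure.haar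
  obtain ⟨⟨f, f_cont⟩, f_comp, f_nonneg, f_one⟩ :
    ∃ f : C(G, ℝ), HasCompactSupport f ∧ 0 ≤ f ∧ f 1 ≠ 0 := exists_continuous_nonneg_pos 1
  have hpos : 0 < ∫ x, f x ∂μ :=
    f_cont.integral_pos_of_hasCompactSupport_nonneg_nonzero f_comp f_nonneg f_one
  have hfin : IsFiniteMeasureOnCompacts (μ.map (fun x => x⁻¹)) :=
    Measure.IsFiniteMeasureOnCompacts.map μ (Homeomorph.inv G)
  have h1 := continuous_integral_apply_inv_mul (μ := μ.map (fun x => x⁻¹)) f_cont f_comp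
  have h2 : ∀ g : G, ∫ y, f (y⁻¹ * g) ∂(μ.map (fun x => x⁻¹)) =
      Measure.modularCharacterFun g * ∫ x, f x ∂μ := by
    intro g
    rw [integral_map (measurable_inv.aemeasurable) (by
      exact (f_cont.comp (by fun_prop)).aestronglyMeasurable)]
    simp only [inv_inv]
    have := integral_map (μ := μ) (φ := fun x => x * g) (by fun_prop) (f := f)
      f_cont.aestronglyMeasurable
    rw [Measure.map_right_mul_eq_modularCharacterFun_smul, integral_smul_nnreal_measure] at this
    rw [← this, NNReal.smul_def, smul_eq_mul]
  have h3 : Continuous fun g : G => ((Measure.modularCharacterFun g : NNReal) : ℝ) := by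
    have : (fun g : G => ((Measure.modularCharacterFun g : NNReal) : ℝ)) =
        fun g => (∫ y, f (y⁻¹ * g) ∂(μ.map (fun x => x⁻¹))) / ∫ x, f x ∂μ := by
      funext g
      rw [h2, mul_div_cancel_right₀ _ hpos.ne']
    rw [this]
    exact h1.div_const _
  exact continuous_induced_rng.2 h3

lemma lintegral_mul_right_eq_modular (u : G → ℝ≥0∞) (hu : Measurable u) (g : G) :
    ∫⁻ x, u (x * g) ∂m = Measure.modularCharacterFun g * ∫⁻ x, u x ∂m := by
  have h := lintegral_map (μ := m) hu (show Measurable (fun x : G => x * g) from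
    (continuous_mul_const g).measurable)
  rw [← h, Measure.map_right_mul_eq_modularCharacterFun_smul, lintegral_smul_measure]
  rfl

lemma modularCharacterFun_inv_mul (g : G) :
    Measure.modularCharacterFun g⁻¹ * Measure.modularCharacterFun g = 1 := by
  rw [← Measure.modularCharacterFun_map_mul, inv_mul_cancel, Measure.modularCharacterFun_map_one]

/-- The image of `Δ · m` under inversion is left invariant and finite on compact sets, hence equal
to `c · m`. As inversion is an involution, `c² = 1`. -/
lemma lintegral_inv_mul_modular (u : G → ℝ≥0∞) (hu : Measurable u) :
    ∫⁻ x, u x⁻¹ * Measure.modularCharacterFun x ∂m = ∫⁻ x, u x ∂m := by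
  have hδ : Measurable (fun x : G => (Measure.modularCharacterFun x : ℝ≥0∞)) :=
    continuous_modularCharacterFun.measurable.coe_nnreal_ennreal
  have hinvm : Measurable (fun x : G => x⁻¹) := measurable_inv
  let ν : Measure G := (m.withDensity fun x => (Measure.modularCharacterFun x : ℝ≥0∞)).map fun x => x⁻¹
  have hν : ∀ v : G → ℝ≥0∞, Measurable v →
      ∫⁻ x, v x ∂ν = ∫⁻ x, v x⁻¹ * Measure.modularCharacterFun x ∂m := by
    intro v hv
    rw [lintegral_map hv hinvm]
    refine (lintegral_withDensity_eq_lintegral_mul _ hδ (hv.comp hinvm)).trans ?_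
    exact lintegral_congr fun x => mul_comm _ _
  have hinv : ν.IsMulLeftInvariant := by
    refine ⟨fun k => ?_⟩
    ext A hA
    have hk : Measurable (fun x : G => k * x) := (continuous_const_mul k).measurable
    rw [Measure.map_apply hk hA, ← lintegral_indicator_one (hk hA), ← lintegral_indicator_one hA,
      hν _ (measurable_one.indicator (hk hA)), hν _ (measurable_one.indicator hA)]
    have e : ∀ x : G, ((fun x => k * x) ⁻¹' A).indicator (1 : G → ℝ≥0∞) x⁻¹ *
        Measure.modularCharacterFun x = Measure.modularCharacterFun k * (A.indicator (1 : G → ℝ≥0∞) (x * k⁻¹)⁻¹ *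
        Measure.modularCharacterFun (x * k⁻¹)) := by
      intro x
      rw [Measure.modularCharacterFun_map_mul]
      have h1 : (Measure.modularCharacterFun k⁻¹ : ℝ≥0∞) * Measure.modularCharacterFun k = 1 := by
        exact_mod_cast modularCharacterFun_inv_mul k
      have h2 : ((fun x => k * x) ⁻¹' A).indicator (1 : G → ℝ≥0∞) x⁻¹ =
          A.indicator (1 : G → ℝ≥0∞) (x * k⁻¹)⁻¹ := by
        have h3 : (x * k⁻¹)⁻¹ = k * x⁻¹ := by rw [mul_inv_rev, inv_inv]
        rw [h3]
        rfl
      rw [h2]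
      push_cast
      calc _ = A.indicator (1 : G → ℝ≥0∞) (x * k⁻¹)⁻¹ * Measure.modularCharacterFun x *
            (Measure.modularCharacterFun k⁻¹ * Measure.modularCharacterFun k) := by rw [h1, mul_one]
        _ = _ := by ring
    simp_rw [e]
    have hw : Measurable fun x : G => A.indicator (1 : G → ℝ≥0∞) x⁻¹ * Measure.modularCharacterFun x :=
      ((measurable_one.indicator hA).comp hinvm).mul hδ
    have hw' : Measurable fun x : G => A.indicator (1 : G → ℝ≥0∞) (x * k⁻¹)⁻¹ *
        Measure.modularCharacterFun (x * k⁻¹) := hw.comp (continuous_mul_const k⁻¹).measurable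
    rw [lintegral_const_mul _ hw',
      lintegral_mul_right_eq_modular (fun x : G => A.indicator (1 : G → ℝ≥0∞) x⁻¹ *
        Measure.modularCharacterFun x) hw, ← mul_assoc]
    have h1 : (Measure.modularCharacterFun k : ℝ≥0∞) * Measure.modularCharacterFun k⁻¹ = 1 := by
      rw [mul_comm]; exact_mod_cast modularCharacterFun_inv_mul k
    rw [h1, one_mul]
  have hfin : IsFiniteMeasureOnCompacts ν := by
    refine ⟨fun K hK => ?_⟩
    rw [Measure.map_apply hinvm hK.measurableSet, withDensity_apply _ (hinvm hK.measurableSet)]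
    have hK' : IsCompact ((fun x : G => x⁻¹) ⁻¹' K) := by
      simpa using! hK.inv
    obtain ⟨C, hC⟩ := hK'.bddAbove_image continuous_modularCharacterFun.continuousOn
    calc _ ≤ ∫⁻ x in (fun x : G => x⁻¹) ⁻¹' K, (C : ℝ≥0∞) ∂m :=
          setLIntegral_mono' (hinvm hK.measurableSet) fun x hx => by
            exact_mod_cast hC (mem_image_of_mem _ hx)
      _ < ⊤ := by
        rw [setLIntegral_const]
        exact ENNReal.mul_lt_top ENNReal.coe_lt_top hK'.measure_lt_top
  have huniq := Measure.isMulLeftInvariant_eq_smul ν m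
  set c := Measure.haarScalarFactor ν m
  have hc : ∀ v : G → ℝ≥0∞, Measurable v →
      ∫⁻ x, v x⁻¹ * Measure.modularCharacterFun x ∂m = c * ∫⁻ x, v x ∂m := by
    intro v hv
    rw [← hν v hv, huniq, lintegral_smul_measure]
    rfl
  -- Applying the formula twice restores the original integral, because `Δ(x⁻¹) Δ(x) = 1`.
  have hc2 : ∀ v : G → ℝ≥0∞, Measurable v → ∫⁻ x, v x ∂m = c * (c * ∫⁻ x, v x ∂m) := by
    intro v hv
    rw [← hc v hv]
    refine Eq.trans ?_ (hc _ ((hv.comp hinvm).mul hδ))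
    refine lintegral_congr fun x => ?_
    simp only [inv_inv, mul_assoc]
    have h1 : (Measure.modularCharacterFun x⁻¹ : ℝ≥0∞) * Measure.modularCharacterFun x = 1 := by
      exact_mod_cast modularCharacterFun_inv_mul x
    rw [h1, mul_one]
  obtain ⟨K, hK, hK1⟩ := exists_compact_mem_nhds (1 : G)
  have hKf : m K ≠ ⊤ := hK.measure_lt_top.ne
  have hK0 : m K ≠ 0 := (Measure.measure_pos_of_mem_nhds m hK1).ne'
  have h4 := hc2 (K.indicator 1) (measurable_one.indicator hK.measurableSet)
  rw [lintegral_indicator_one hK.measurableSet, ← mul_assoc] at h4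
  have h5 : (c : ℝ≥0∞) * c = 1 := by
    have : 1 * m K = (c * c : ℝ≥0∞) * m K := by rw [one_mul]; exact h4
    exact ((ENNReal.mul_left_inj hK0 hKf).1 this).symm
  have h6 : c = 1 := by
    have h7 : c * c = 1 := by exact_mod_cast h5
    exact_mod_cast (pow_eq_one_iff_of_nonneg (a := (c : ℝ)) c.2 two_ne_zero).1
      (by rw [pow_two]; exact_mod_cast h7)
  rw [hc u hu, h6, ENNReal.coe_one, one_mul]

end Modular

/-! ### The Jacobian under inversion, and nullity of the boundary of `𝒪` -/

section HaarExp

variable {E : Type*} [NormedAddCommGroup E] [NormedSpace ℝ E] [FiniteDimensional ℝ E]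
  [MeasurableSpace E] [BorelSpace E]
  {G : Type*} [TopologicalSpace G] [T2Space G] [SecondCountableTopology G]
  [ChartedSpace E G] [Group G] [LieGroup 𝓘(ℝ, E) ∞ G]
  [MeasurableSpace G] [BorelSpace G] {m : Measure G} [m.IsHaarMeasure] {𝒪 : Set E}
  [IsTopologicalGroup G] [LocallyCompactSpace G]

/-- The square root of the modular function. -/
def modSqrt (g : G) : ℝ := √(Measure.modularCharacterFun g : ℝ)

lemma modSqrt_mul (g h : G) : modSqrt (g * h) = modSqrt g * modSqrt h := by
  rw [modSqrt, Measure.modularCharacterFun_map_mul, NNReal.coe_mul,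
    Real.sqrt_mul (NNReal.coe_nonneg _)]
  rfl

lemma modSqrt_pos (g : G) : 0 < modSqrt g :=
  Real.sqrt_pos.2 (by exact_mod_cast Measure.modularCharacterFun_pos g)

lemma modSqrt_one : modSqrt (1 : G) = 1 := by
  simp [modSqrt, Measure.modularCharacterFun_map_one]

lemma modSqrt_inv (g : G) : modSqrt g⁻¹ = (modSqrt g)⁻¹ := by
  refine eq_inv_of_mul_eq_one_left ?_
  rw [← modSqrt_mul, inv_mul_cancel, modSqrt_one]

lemma modSqrt_sq (g : G) : modSqrt g ^ 2 = Measure.modularCharacterFun g :=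
  Real.sq_sqrt (NNReal.coe_nonneg _)

lemma continuous_modSqrt : Continuous (modSqrt : G → ℝ) :=
  Real.continuous_sqrt.comp (NNReal.continuous_coe.comp continuous_modularCharacterFun)

namespace IsExpDomain

omit [IsTopologicalGroup G] [LocallyCompactSpace G] in
lemma lintegral_lieExp (h𝒪 : IsExpDomain m 𝒪) (u : G → ℝ≥0∞) (hu : Measurable u) :
    ∫⁻ X in 𝒪, ENNReal.ofReal (jacJ G 𝒪 X) * u (lieExp G X) ∂(algMeasure (E := E) m) =
      ∫⁻ x, u x ∂m := by
  conv_rhs => rw [← h𝒪.map_lieExp]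
  rw [lintegral_map hu h𝒪.measurable_lieExp]
  exact (lintegral_withDensity_eq_lintegral_mul _
    h𝒪.continuous_jacJ.measurable.ennreal_ofReal (hu.comp h𝒪.measurable_lieExp)).symm

omit [m.IsHaarMeasure] [SecondCountableTopology G] [BorelSpace E] [BorelSpace G]
  [IsTopologicalGroup G] [LocallyCompactSpace G] in
lemma neg_mem (h𝒪 : IsExpDomain m 𝒪) {X : E} (hX : X ∈ 𝒪) : -X ∈ 𝒪 := by
  simpa using h𝒪.smul_mem X hX (-1) ⟨le_rfl, by norm_num⟩

/-- In exponential coordinates inversion on `G` is `X ↦ -X`. Comparing the densities of Haar measure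
before and after inversion yields the equality almost everywhere on `𝒪`, hence everywhere there by
continuity. -/
lemma jacJ_neg (h𝒪 : IsExpDomain m 𝒪) {X : E} (hX : X ∈ 𝒪) :
    jacJ G 𝒪 (-X) = Measure.modularCharacterFun (lieExp G X) * jacJ G 𝒪 X := by
  have hh := h𝒪.isAddHaarMeasure_algMeasure
  set μ := algMeasure (E := E) m
  have hδ : Measurable (fun x : G => (Measure.modularCharacterFun x : ℝ≥0∞)) :=
    continuous_modularCharacterFun.measurable.coe_nnreal_ennreal
  have hJ : Measurable (fun X : E => ENNReal.ofReal (jacJ G 𝒪 X)) :=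
    h𝒪.continuous_jacJ.measurable.ennreal_ofReal
  have hcδ : Continuous fun X : E => ((Measure.modularCharacterFun (lieExp G X) : NNReal) : ℝ) :=
    NNReal.continuous_coe.comp (continuous_modularCharacterFun.comp h𝒪.continuous_lieExp)
  have key : ∀ A : Set G, MeasurableSet A →
      ∫⁻ X in 𝒪, A.indicator 1 (lieExp G X) * ENNReal.ofReal (jacJ G 𝒪 (-X)) ∂μ =
      ∫⁻ X in 𝒪, A.indicator 1 (lieExp G X) *
        ENNReal.ofReal (Measure.modularCharacterFun (lieExp G X) * jacJ G 𝒪 X) ∂μ := by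
    intro A hA
    have hu : Measurable (A.indicator (1 : G → ℝ≥0∞)) := measurable_one.indicator hA
    have h1 := lintegral_inv_mul_modular (m := m) (fun x => A.indicator (1 : G → ℝ≥0∞) x⁻¹)
      (hu.comp measurable_inv)
    simp only [inv_inv] at h1
    rw [← h𝒪.lintegral_lieExp (fun x => A.indicator (1 : G → ℝ≥0∞) x *
      Measure.modularCharacterFun x) (hu.mul hδ),
      ← h𝒪.lintegral_lieExp (fun x => A.indicator (1 : G → ℝ≥0∞) x⁻¹)
      (hu.comp measurable_inv)] at h1
    have h2 : ∫⁻ X in 𝒪, A.indicator 1 (lieExp G X) * ENNReal.ofReal (jacJ G 𝒪 (-X)) ∂μ =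
        ∫⁻ X in 𝒪, ENNReal.ofReal (jacJ G 𝒪 X) * A.indicator 1 (lieExp G X)⁻¹ ∂μ := by
      have hmp := Measure.measurePreserving_neg μ
      have hpre : (fun X : E => -X) ⁻¹' 𝒪 = 𝒪 := by
        ext X; exact ⟨fun h => by simpa using h𝒪.neg_mem h, fun h => h𝒪.neg_mem h⟩
      have h3 := (hmp.restrict_preimage h𝒪.isOpen.measurableSet).lintegral_comp
        (f := fun X => A.indicator 1 (lieExp G X) * ENNReal.ofReal (jacJ G 𝒪 (-X)))
        ((hu.comp h𝒪.measurable_lieExp).mul (hJ.comp measurable_neg))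
      have hpre' : (Neg.neg : E → E) ⁻¹' 𝒪 = 𝒪 := hpre
      rw [hpre'] at h3
      rw [← h3]
      refine lintegral_congr fun X => ?_
      rw [neg_neg, h𝒪.lieExp_neg, mul_comm]
    rw [h2]
    refine Eq.trans h1.symm (lintegral_congr fun X => ?_)
    rw [ENNReal.ofReal_mul (NNReal.coe_nonneg _), ENNReal.ofReal_coe_nnreal]
    ring
  have hf : Measurable fun X : E => ENNReal.ofReal (jacJ G 𝒪 (-X)) := hJ.comp measurable_neg
  have hg : Measurable fun X : E =>
      ENNReal.ofReal (Measure.modularCharacterFun (lieExp G X) * jacJ G 𝒪 X) :=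
    (hcδ.mul h𝒪.continuous_jacJ).measurable.ennreal_ofReal
  have hae : (fun X : E => ENNReal.ofReal (jacJ G 𝒪 (-X))) =ᵐ[μ.restrict 𝒪]
      fun X : E => ENNReal.ofReal (Measure.modularCharacterFun (lieExp G X) * jacJ G 𝒪 X) := by
    refine ae_eq_of_forall_setLIntegral_eq_of_sigmaFinite hf hg fun s hs _ => ?_
    have hA : MeasurableSet (lieExp G '' (s ∩ 𝒪)) :=
      (hs.inter h𝒪.isOpen.measurableSet).image_of_continuousOn_injOn
        h𝒪.continuous_lieExp.continuousOn (h𝒪.injOn.mono inter_subset_right)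
    have hk := key _ hA
    have e : ∀ v : E → ℝ≥0∞, ∫⁻ X in 𝒪, (lieExp G '' (s ∩ 𝒪)).indicator 1 (lieExp G X) * v X ∂μ =
        ∫⁻ X in s, v X ∂(μ.restrict 𝒪) := by
      intro v
      rw [← lintegral_indicator hs]
      refine setLIntegral_congr_fun h𝒪.isOpen.measurableSet fun X hX => ?_
      have : lieExp G X ∈ lieExp G '' (s ∩ 𝒪) ↔ X ∈ s :=
        ⟨fun ⟨Y, hY, hYX⟩ => h𝒪.injOn hY.2 hX hYX ▸ hY.1, fun h => ⟨X, ⟨h, hX⟩, rfl⟩⟩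
      by_cases h : X ∈ s
      · simp [h, this.2 h]
      · simp [h, mt this.1 h]
    rwa [e, e] at hk
  have hae' : (fun X : E => jacJ G 𝒪 (-X)) =ᵐ[μ.restrict 𝒪]
      fun X : E => (Measure.modularCharacterFun (lieExp G X) : ℝ) * jacJ G 𝒪 X := by
    filter_upwards [hae] with X hX
    exact (ENNReal.ofReal_eq_ofReal_iff (jacJ_nonneg _)
      (mul_nonneg (NNReal.coe_nonneg _) (jacJ_nonneg _))).1 hX
  exact Measure.eqOn_open_of_ae_eq hae' h𝒪.isOpen
    (h𝒪.continuous_jacJ.comp continuous_neg).continuousOn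
    (hcδ.mul h𝒪.continuous_jacJ).continuousOn hX

/-- Combining `J(X) J(-X) = F(X)⁴` with `J(-X) = Δ(exp X) J(X)` gives the square of the claim, and
both sides are nonnegative. Thus `|det exp(ad_X / 2)|` never has to be identified with `√Δ`
separately. -/
lemma jacF_sq_eq (h𝒪 : IsExpDomain m 𝒪) {X : E} (hX : X ∈ 𝒪) :
    jacF G X ^ 2 = jacJ G 𝒪 X * modSqrt (lieExp G X) := by
  have h1 := h𝒪.jacJ_mul_neg X
  rw [h𝒪.jacJ_neg hX, ← modSqrt_sq] at h1
  have h2 : (jacF G X ^ 2) ^ 2 = (jacJ G 𝒪 X * modSqrt (lieExp G X)) ^ 2 := by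
    rw [← pow_mul, ← h1]; ring
  exact (pow_left_inj₀ (by positivity) (mul_nonneg (jacJ_nonneg _) (modSqrt_pos _).le)
    two_ne_zero).1 h2

omit [m.IsHaarMeasure] [SecondCountableTopology G] [BorelSpace E] [BorelSpace G]
  [IsTopologicalGroup G] [LocallyCompactSpace G] in
-- If `exp X` were in `𝒰`, then `log ∘ exp` would be continuous at `X`. It is the identity on `𝒪`,
-- which accumulates at `X`, so `X = log(exp X)` would lie in `𝒪`.
lemma lieExp_notMem_of_mem_boundary (h𝒪 : IsExpDomain m 𝒪) {X : E} (hX : X ∈ closure 𝒪)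
    (hX' : X ∉ 𝒪) : lieExp G X ∉ lieExp G '' 𝒪 := by
  intro hmem
  have h1 : Tendsto (fun Y : E => lieLog 𝒪 (lieExp G Y)) (𝓝[𝒪] X)
      (𝓝 (lieLog 𝒪 (lieExp G X))) :=
    ((h𝒪.continuousOn_lieLog.continuousAt (h𝒪.isOpen_image.mem_nhds hmem)).tendsto.comp
      h𝒪.continuous_lieExp.continuousAt.tendsto).mono_left nhdsWithin_le_nhds
  have h2 : Tendsto (fun Y : E => lieLog 𝒪 (lieExp G Y)) (𝓝[𝒪] X) (𝓝 X) := by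
    refine (tendsto_id.mono_left nhdsWithin_le_nhds).congr' ?_
    filter_upwards [self_mem_nhdsWithin] with Y hY
    exact (h𝒪.lieLog_lieExp hY).symm
  have : (𝓝[𝒪] X).NeBot := mem_closure_iff_nhdsWithin_neBot.1 hX
  have h3 := tendsto_nhds_unique h1 h2
  exact hX' (h3 ▸ lieLog_mem hmem)

/-- Off the singular set of `exp`, which is null, a left translate of `exp` read through the
logarithm is a local diffeomorphism into `𝒪`. There the density of Haar measure is positive, so
preimages of null sets are null. Local nullity suffices. -/
lemma addHaar_preimage_null (h𝒪 : IsExpDomain m 𝒪) {A : Set G} (hA : MeasurableSet A)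
    (hm : m A = 0) : (Measure.addHaar : Measure E) (lieExp G ⁻¹' A) = 0 := by
  have hE : MeasurableSet (lieExp G ⁻¹' A : Set E) := h𝒪.measurable_lieExp hA
  have hJ0 := h𝒪.ae_det_ne_zero
  -- The case inside `𝒪`, stated for all translates `g⁻¹ A`, which are null too.
  have hin : ∀ g : G, (Measure.addHaar : Measure E)
      (𝒪 ∩ (fun X => lieExp G X) ⁻¹' ((fun x => g * x) ⁻¹' A)) = 0 := by
    intro g
    have hB : MeasurableSet ((fun x => g * x) ⁻¹' A) := (continuous_const_mul g).measurable hA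
    have h1 := h𝒪.lintegral_lieExp (((fun x => g * x) ⁻¹' A).indicator 1)
      (measurable_one.indicator hB)
    rw [lintegral_indicator_one hB, measure_preimage_mul, hm] at h1
    obtain ⟨c, hc, hμ, -⟩ := h𝒪.exists_algMeasure_eq
    have h2 := (lintegral_eq_zero_iff (by
      exact h𝒪.continuous_jacJ.measurable.ennreal_ofReal.mul
        ((measurable_one.indicator hB).comp h𝒪.measurable_lieExp))).1 h1
    have h3 := (ae_restrict_iff' h𝒪.isOpen.measurableSet).1 h2
    have hμ' : algMeasure (E := E) m = (c : ℝ≥0∞) • Measure.addHaar := hμ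
    rw [hμ', Measure.ae_ennreal_smul_measure_eq (by simpa using hc)] at h3
    refine measure_mono_null ?_ h3
    rintro X ⟨hX, hXB⟩ hcon
    have h4 := hcon hX
    have h5 := h𝒪.jacJ_pos hX
    have h6 : ((fun x => g * x) ⁻¹' A).indicator (1 : G → ℝ≥0∞) (lieExp G X) = 1 :=
      indicator_of_mem (show lieExp G X ∈ _ from hXB) _
    simp only [h6, mul_one, Pi.zero_apply, ENNReal.ofReal_eq_zero] at h4
    exact absurd h4 (not_le.2 h5)
  have hnull : (Measure.addHaar : Measure E) {X | ¬ jacJ G 𝒪 X ≠ 0} = 0 := hJ0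
  have hS : (Measure.addHaar : Measure E) (lieExp G ⁻¹' A ∩ {X | jacJ G 𝒪 X ≠ 0}) = 0 := by
    refine measure_null_of_locally_null _ fun X₀ hX₀ => ?_
    set T : E → E := fun x => lieLog 𝒪 (lieExp G (-X₀) * lieExp G x) with hT
    have hdet : (leftDexp G 𝒪 X₀).det ≠ 0 := fun h => hX₀.2 (by rw [jacJ, h, abs_zero])
    have hstrict : HasStrictFDerivAt T
        ((leftDexp G 𝒪 X₀).toContinuousLinearEquivOfDetNeZero hdet : E →L[ℝ] E) X₀ := by
      have h1 := (h𝒪.contDiffAt_leftLog _ (h𝒪.exp_neg_mul_mem X₀)).hasStrictFDerivAt'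
        (h𝒪.hasFDerivAt_leftDexp X₀) (by simp)
      exact h1
    let e := hstrict.toOpenPartialHomeomorph T
    have he : X₀ ∈ e.source := hstrict.mem_toOpenPartialHomeomorph_source
    have hW : {x : E | lieExp G (-X₀) * lieExp G x ∈ lieExp G '' 𝒪} ∈ 𝓝 X₀ :=
      h𝒪.eventually_mem (continuousAt_const.mul h𝒪.continuous_lieExp.continuousAt)
        (h𝒪.exp_neg_mul_mem X₀)
    have hWm : MeasurableSet {x : E | lieExp G (-X₀) * lieExp G x ∈ lieExp G '' 𝒪} :=
      (h𝒪.isOpen_image.preimage (continuous_const.mul h𝒪.continuous_lieExp)).measurableSet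
    set W := e.source ∩ {x : E | lieExp G (-X₀) * lieExp G x ∈ lieExp G '' 𝒪} with hWdef
    set S := (lieExp G ⁻¹' A ∩ {X | jacJ G 𝒪 X ≠ 0}) ∩ W with hSdef
    have hSm : MeasurableSet S :=
      (hE.inter (h𝒪.continuous_jacJ.measurable (measurableSet_singleton 0).compl)).inter
        (e.open_source.measurableSet.inter hWm)
    refine ⟨S, inter_mem self_mem_nhdsWithin (mem_nhdsWithin_of_mem_nhds
      (inter_mem (e.open_source.mem_nhds he) hW)), ?_⟩
    have hder : ∀ x ∈ S, HasFDerivWithinAt T (fderiv ℝ T x) S x := fun x hx =>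
      ((h𝒪.contDiffAt_leftLog _ hx.2.2).differentiableAt (by simp)).hasFDerivAt.hasFDerivWithinAt
    have hinj : InjOn T S := fun x hx y hy h => e.injOn hx.2.1 hy.2.1 h
    have hcv := lintegral_abs_det_fderiv_eq_addHaar_image Measure.addHaar hSm hder hinj
    -- `T` moves the piece `S` near `X₀` into the part of `𝒪` which `exp` sends to `exp(X₀)⁻¹ A`. As
    -- the Jacobian of `T` vanishes nowhere on `S`, a null image forces `S` to be null.
    have himg : (Measure.addHaar : Measure E) (T '' S) = 0 := by
      refine measure_mono_null ?_ (hin (lieExp G X₀))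
      rintro _ ⟨x, hx, rfl⟩
      refine ⟨lieLog_mem hx.2.2, ?_⟩
      rw [mem_preimage, mem_preimage, hT]
      simp only
      rw [lieExp_lieLog hx.2.2, h𝒪.lieExp_neg, mul_inv_cancel_left]
      exact hx.1.1
    rw [himg] at hcv
    have hpos : ∀ x ∈ S, ENNReal.ofReal |(fderiv ℝ T x).det| ≠ 0 := by
      intro x hx h0
      refine hx.1.2 ?_
      have h1 := h𝒪.leftDexp_leftLog hx.2.2
      rw [ENNReal.ofReal_eq_zero] at h0
      have h2 : (fderiv ℝ T x).det = 0 := abs_eq_zero.1 (le_antisymm h0 (abs_nonneg _))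
      rw [jacJ, h1, ContinuousLinearMap.det, ContinuousLinearMap.toLinearMap_mul, map_mul]
      have h3 : LinearMap.det ((fderiv ℝ T x : E →L[ℝ] E) : E →ₗ[ℝ] E) = 0 := h2
      rw [h3, mul_zero, abs_zero]
    by_contra hne
    have h6 : 0 < ∫⁻ x in S, ENNReal.ofReal |(fderiv ℝ T x).det| ∂Measure.addHaar := by
      have hmeas : Measurable fun x => ENNReal.ofReal |(fderiv ℝ T x).det| :=
        (ContinuousLinearMap.continuous_det.measurable.comp
          (measurable_fderiv ℝ T)).abs.ennreal_ofReal
      rw [setLIntegral_pos_iff hmeas]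
      refine lt_of_lt_of_le (pos_iff_ne_zero.2 hne) (measure_mono fun x hx => ⟨hpos x hx, hx⟩)
    exact h6.ne' hcv
  refine measure_mono_null (fun X hX => ?_) (measure_union_null hS hnull)
  by_cases h : jacJ G 𝒪 X = 0
  · exact Or.inr (by simpa using h)
  · exact Or.inl ⟨hX, h⟩

/-- Boundary points are sent by `exp` outside `𝒰`, that is, into a Haar null set. Hence support in
`G × closure 𝒪` and vanishing outside `G × 𝒪` mean the same almost everywhere. -/
lemma algMeasure_boundary (h𝒪 : IsExpDomain m 𝒪) :
    algMeasure (E := E) m (closure 𝒪 \ 𝒪) = 0 := by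
  obtain ⟨c, hc, hμ, -⟩ := h𝒪.exists_algMeasure_eq
  have h0 : (Measure.addHaar : Measure E) (closure 𝒪 \ 𝒪) = 0 :=
    measure_mono_null (fun X hX => h𝒪.lieExp_notMem_of_mem_boundary hX.1 hX.2)
      (h𝒪.addHaar_preimage_null h𝒪.measurableSet_image.compl h𝒪.null_compl)
  have hμ' : algMeasure (E := E) m = (c : ℝ≥0∞) • Measure.addHaar := hμ
  rw [hμ', Measure.smul_apply, h0, smul_zero]

end IsExpDomain

end HaarExp

/-! ### The Fourier transform on a finite-dimensional space with a Haar measure -/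

section FourierEuclidean

open FourierTransform

variable {V : Type*} [NormedAddCommGroup V] [InnerProductSpace ℝ V] [FiniteDimensional ℝ V]
  [MeasurableSpace V] [BorelSpace V]

/-- The `L²` transform agrees with that of tempered distributions, where it is moved onto a test
function; Fubini does the same for the integral. So both sides have equal integrals against all
smooth compactly supported functions. -/
lemma coeFn_fourier_toLp {f : V → ℂ} (h1 : Integrable f) (h2 : MemLp f 2) :
    (𝓕 (h2.toLp f) : Lp ℂ 2 (volume : Measure V)) =ᵐ[volume] 𝓕 f := by
  have hc : Continuous (𝓕 f) := VectorFourier.fourierIntegral_continuous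
    Real.continuous_fourierChar (L := innerₗ V) continuous_inner h1
  refine ae_eq_of_integral_contDiff_smul_eq
    ((Lp.memLp _).locallyIntegrable (by norm_num)) hc.locallyIntegrable ?_
  intro g hg hgs
  have hg1 : HasCompactSupport (Complex.ofRealCLM ∘ g) := hgs.comp_left rfl
  have hg2 : ContDiff ℝ ∞ (Complex.ofRealCLM ∘ g) := by fun_prop
  have h3 := congrArg (fun T => T (hg1.toSchwartzMap hg2))
    (Lp.fourier_toTemperedDistribution_eq (h2.toLp f))
  simp only [TemperedDistribution.fourier_apply, Lp.toTemperedDistribution_apply] at h3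
  have h4 := VectorFourier.integral_fourierIntegral_smul_eq_flip (μ := (volume : Measure V))
    (ν := (volume : Measure V)) (L := innerₗ V)
    Real.continuous_fourierChar continuous_inner (hg1.toSchwartzMap hg2).integrable h1
  have h5 : ∫ x, 𝓕 (hg1.toSchwartzMap hg2) x • f x = ∫ x, (g x : ℂ) • 𝓕 f x := by
    simpa using! h4
  have h6 : ∫ x, 𝓕 (hg1.toSchwartzMap hg2) x • (h2.toLp f : V → ℂ) x =
      ∫ x, 𝓕 (hg1.toSchwartzMap hg2) x • f x :=
    integral_congr_ae (by filter_upwards [h2.coeFn_toLp] with x hx; rw [hx])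
  rw [h6, h5] at h3
  simp only [HasCompactSupport.toSchwartzMap_toFun, Function.comp_apply, Complex.ofRealCLM_apply,
    smul_eq_mul] at h3
  simpa using h3.symm

lemma lintegral_fourier_sq {f : V → ℂ} (h1 : Integrable f) (h2 : MemLp f 2) :
    ∫⁻ w, ‖𝓕 f w‖ₑ ^ 2 = ∫⁻ v, ‖f v‖ₑ ^ 2 := by
  have h3 := Lp.norm_fourier_eq (h2.toLp f)
  have h4 : eLpNorm (𝓕 f) 2 volume = eLpNorm f 2 volume := by
    rw [← eLpNorm_congr_ae (coeFn_fourier_toLp h1 h2), ← eLpNorm_congr_ae h2.coeFn_toLp]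
    rw [Lp.norm_def, Lp.norm_def] at h3
    exact (ENNReal.toReal_eq_toReal_iff' (Lp.eLpNorm_ne_top _) (Lp.eLpNorm_ne_top _)).1 h3
  have h5 := congrArg (fun t => t ^ (2 : ℕ)) h4
  have h6 : ∀ u : V → ℂ, eLpNorm u 2 volume ^ (2 : ℕ) = ∫⁻ v, ‖u v‖ₑ ^ 2 := by
    intro u
    simpa using eLpNorm_nnreal_pow_eq_lintegral (f := u) (μ := volume) (p := 2) two_ne_zero
  simpa only [h6] using h5

end FourierEuclidean

/-! ### The dual measure and Plancherel's theorem -/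

section DualMeasure

open FourierTransform Module

variable {E : Type*} [NormedAddCommGroup E] [NormedSpace ℝ E] [FiniteDimensional ℝ E]
  [MeasurableSpace E] [BorelSpace E]

/-- The linear equivalence `w ↦ 2π ⟨w, ·⟩` between a Euclidean space and the dual of `E`. -/
def dualEquiv (E : Type*) [NormedAddCommGroup E] [NormedSpace ℝ E] [FiniteDimensional ℝ E] :
    EuclideanSpace ℝ (Fin (finrank ℝ E)) ≃L[ℝ] StrongDual ℝ E :=
  (ContinuousLinearEquiv.smulLeft (Units.mk0 (2 * Real.pi) (by positivity))).trans
    ((InnerProductSpace.toDual ℝ _).toContinuousLinearEquiv.trans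
      ((toEuclidean (E := E)).symm.arrowCongr (ContinuousLinearEquiv.refl ℝ ℝ)))

lemma dualEquiv_apply (w : EuclideanSpace ℝ (Fin (finrank ℝ E))) (X : E) :
    dualEquiv E w X = 2 * Real.pi * inner ℝ (toEuclidean X) w := by
  have : dualEquiv E w X = inner ℝ ((2 * Real.pi) • w) (toEuclidean X) := rfl
  rw [this, inner_smul_left, real_inner_comm]
  rfl

variable (μ : Measure E) [μ.IsAddHaarMeasure]

instance : (μ.map (toEuclidean (E := E))).IsAddHaarMeasure :=
  (toEuclidean (E := E)).isAddHaarMeasure_map μ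

/-- The density of `μ` with respect to the volume of the Euclidean structure. -/
def haarScale : NNReal :=
  Measure.addHaarScalarFactor (μ.map (toEuclidean (E := E))) volume

lemma map_toEuclidean : μ.map (toEuclidean (E := E)) = haarScale μ • volume := by
  exact Measure.isAddLeftInvariant_eq_smul _ _

lemma haarScale_ne_zero : haarScale μ ≠ 0 := by
  exact (Measure.addHaarScalarFactor_pos_of_isAddHaarMeasure _ _).ne'

lemma integral_eq_haarScale {F : Type*} [NormedAddCommGroup F] [NormedSpace ℝ F] (f : E → F) :
    ∫ X, f X ∂μ = (haarScale μ : ℝ) • ∫ v, f (toEuclidean.symm v) := by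
  have h := (toEuclidean (E := E)).toHomeomorph.measurableEmbedding.integral_map (μ := μ)
    (fun v => f (toEuclidean.symm v))
  simp only [ContinuousLinearEquiv.coe_toHomeomorph, ContinuousLinearEquiv.symm_apply_apply] at h
  rw [← h, map_toEuclidean, integral_smul_nnreal_measure]
  rfl

lemma lintegral_eq_haarScale (f : E → ℝ≥0∞) :
    ∫⁻ X, f X ∂μ = haarScale μ * ∫⁻ v, f (toEuclidean.symm v) := by
  have h := (toEuclidean (E := E)).toHomeomorph.measurableEmbedding.lintegral_map (μ := μ)
    (fun v => f (toEuclidean.symm v))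
  simp only [ContinuousLinearEquiv.coe_toHomeomorph, ContinuousLinearEquiv.symm_apply_apply] at h
  rw [← h, map_toEuclidean, lintegral_smul_measure]
  rfl

lemma integrable_comp_toEuclidean_symm {F : Type*} [NormedAddCommGroup F] {f : E → F} :
    Integrable (fun v => f ((toEuclidean (E := E)).symm v)) volume ↔ Integrable f μ := by
  have h := (toEuclidean (E := E)).toHomeomorph.measurableEmbedding.integrable_map_iff (μ := μ)
    (g := fun v => f ((toEuclidean (E := E)).symm v))
  have e : (fun v => f ((toEuclidean (E := E)).symm v)) ∘ (toEuclidean (E := E)).toHomeomorph = f := by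
    ext X; simp
  rw [e] at h
  rw [← h]
  have h' : μ.map (toEuclidean (E := E)).toHomeomorph = (haarScale μ : ℝ≥0∞) • volume :=
    map_toEuclidean μ
  rw [h', integrable_smul_measure (by simpa using haarScale_ne_zero μ) (by simp)]

/-- The dual Haar measure, written with the help of the Euclidean structure. -/
def dualHaar : Measure (StrongDual ℝ E) :=
  (((2 * Real.pi).toNNReal ^ finrank ℝ E * (haarScale μ)⁻¹ : NNReal)) •
    (volume.map (dualEquiv E))

instance : (dualHaar μ).IsAddHaarMeasure := by
  have := (dualEquiv E).isAddHaarMeasure_map volume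
  have h0 : (2 * Real.pi).toNNReal ^ finrank ℝ E * (haarScale μ)⁻¹ ≠ 0 :=
    mul_ne_zero (pow_ne_zero _ (by simpa using Real.pi_pos)) (inv_ne_zero (haarScale_ne_zero μ))
  exact Measure.IsAddHaarMeasure.smul _ (by exact_mod_cast h0) ENNReal.coe_ne_top

lemma integral_exp_dualEquiv (f : E → ℂ) (w : EuclideanSpace ℝ (Fin (finrank ℝ E))) :
    ∫ X, f X * Complex.exp (-Complex.I * (dualEquiv E w X : ℂ)) ∂μ =
      (haarScale μ : ℝ) • 𝓕 (fun v => f (toEuclidean.symm v)) w := by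
  rw [integral_eq_haarScale, Real.fourier_eq']
  congr 1
  refine integral_congr_ae (Eventually.of_forall fun v => ?_)
  simp only [dualEquiv_apply, ContinuousLinearEquiv.apply_symm_apply, smul_eq_mul]
  rw [mul_comm]
  congr 2
  push_cast
  ring

lemma integral_dualHaar (g : StrongDual ℝ E → ℂ) :
    ∫ p, g p ∂(dualHaar μ) =
      ((2 * Real.pi) ^ finrank ℝ E * (haarScale μ : ℝ)⁻¹) • ∫ w, g (dualEquiv E w) := by
  have h := (dualEquiv E).toHomeomorph.measurableEmbedding.integral_map (μ := volume) g
  have h' : ∫ p, g p ∂(volume.map (dualEquiv E)) = ∫ w, g (dualEquiv E w) := h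
  rw [dualHaar, integral_smul_nnreal_measure, h', NNReal.smul_def]
  push_cast
  rw [Real.coe_toNNReal _ (by positivity)]

lemma lintegral_dualHaar (g : StrongDual ℝ E → ℝ≥0∞) :
    ∫⁻ p, g p ∂(dualHaar μ) =
      ENNReal.ofReal ((2 * Real.pi) ^ finrank ℝ E * (haarScale μ : ℝ)⁻¹) *
        ∫⁻ w, g (dualEquiv E w) := by
  have h : dualHaar μ = ENNReal.ofReal ((2 * Real.pi) ^ finrank ℝ E * (haarScale μ : ℝ)⁻¹) •
      (volume.map (dualEquiv E)) := by
    rw [dualHaar, ENNReal.smul_def]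
    congr 1
    rw [ENNReal.ofReal, Real.toNNReal_mul (p := (2 * Real.pi) ^ finrank ℝ E) (by positivity),
      Real.toNNReal_pow (x := 2 * Real.pi) (by positivity), Real.toNNReal_inv,
      Real.toNNReal_coe]
  have h2 := (dualEquiv E).toHomeomorph.measurableEmbedding.lintegral_map (μ := volume) g
  rw [h, lintegral_smul_measure]
  exact congrArg _ h2

lemma integrable_dualHaar {g : StrongDual ℝ E → ℂ} :
    Integrable g (dualHaar μ) ↔ Integrable (fun w => g (dualEquiv E w)) := by
  have h0 : (2 * Real.pi).toNNReal ^ finrank ℝ E * (haarScale μ)⁻¹ ≠ 0 :=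
    mul_ne_zero (pow_ne_zero _ (by simpa using Real.pi_pos)) (inv_ne_zero (haarScale_ne_zero μ))
  rw [dualHaar, ENNReal.smul_def, integrable_smul_measure (by exact_mod_cast h0) ENNReal.coe_ne_top]
  exact (dualEquiv E).toHomeomorph.measurableEmbedding.integrable_map_iff (μ := volume)

/-- Fourier inversion on a Euclidean space, transported by linear coordinates. The factors
`haarScale μ` of the inner and outer integrals cancel, and `dualEquiv` absorbs the `2π` of the
exponent. -/
lemma isDualMeasure_dualHaar : IsDualMeasure μ (dualHaar μ) := by
  refine ⟨inferInstance, fun f hf hfi hF X => ?_⟩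
  have hc : (haarScale μ : ℝ) ≠ 0 := by exact_mod_cast haarScale_ne_zero μ
  rw [integrable_dualHaar] at hF
  simp only [integral_exp_dualEquiv] at hF
  have hF' : Integrable (𝓕 (fun v => f (toEuclidean.symm v))) := by
    have := hF.smul (haarScale μ : ℝ)⁻¹
    refine this.congr (Eventually.of_forall fun w => ?_)
    simp only [Pi.smul_apply]
    rw [smul_smul, inv_mul_cancel₀ hc, one_smul]
  have hinv := Continuous.fourierInv_fourier_eq (f := fun v => f (toEuclidean.symm v))
    (hf.comp (toEuclidean (E := E)).symm.continuous)
    ((integrable_comp_toEuclidean_symm μ).2 hfi) hF'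
  have h1 := congrFun hinv (toEuclidean X)
  rw [Real.fourierInv_eq'] at h1
  simp only [ContinuousLinearEquiv.symm_apply_apply] at h1
  rw [integral_dualHaar]
  simp only [integral_exp_dualEquiv]
  rw [← h1]
  have h2 : ∀ w : EuclideanSpace ℝ (Fin (finrank ℝ E)),
      (haarScale μ : ℝ) • 𝓕 (fun v => f (toEuclidean.symm v)) w *
        Complex.exp (Complex.I * (dualEquiv E w X : ℂ)) =
      (haarScale μ : ℝ) • (Complex.exp (((2 * Real.pi * inner ℝ w (toEuclidean X) : ℝ) : ℂ) *
        Complex.I) • 𝓕 (fun v => f (toEuclidean.symm v)) w) := by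
    intro w
    rw [dualEquiv_apply, real_inner_comm, smul_mul_assoc, smul_eq_mul, mul_comm Complex.I,
      mul_comm (Complex.exp _)]
  simp only [h2]
  rw [integral_smul, smul_smul, mul_assoc, inv_mul_cancel₀ hc, mul_one, Complex.real_smul,
    ← mul_assoc]
  push_cast
  rw [inv_mul_cancel₀ (pow_ne_zero _ (by simp [Real.pi_ne_zero])), one_mul]

lemma exists_fourier_test : ∃ f : E → ℂ, Continuous f ∧ Integrable f μ ∧
    Integrable (fun p : StrongDual ℝ E => ∫ X, f X * Complex.exp (-Complex.I * (p X : ℂ)) ∂μ)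
      (dualHaar μ) ∧ f 0 ≠ 0 := by
  obtain ⟨g, -, hgs, hg, -, hg0⟩ := exists_contDiff_tsupport_subset (n := ⊤)
    (E := EuclideanSpace ℝ (Fin (finrank ℝ E))) (x := 0) univ_mem
  have hg1 : HasCompactSupport (Complex.ofRealCLM ∘ g) := hgs.comp_left rfl
  have hg2 : ContDiff ℝ ∞ (Complex.ofRealCLM ∘ g) := Complex.ofRealCLM.contDiff.comp hg
  set S := hg1.toSchwartzMap hg2
  refine ⟨fun X => S (toEuclidean X), S.continuous.comp (toEuclidean (E := E)).continuous,
    ?_, ?_, ?_⟩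
  · rw [← integrable_comp_toEuclidean_symm μ]
    simpa using S.integrable
  · rw [integrable_dualHaar]
    simp only [integral_exp_dualEquiv, ContinuousLinearEquiv.apply_symm_apply]
    have : Integrable (𝓕 (fun v => S v)) := by
      have := (𝓕 S).integrable (μ := volume)
      rwa [SchwartzMap.fourier_coe] at this
    exact this.smul (haarScale μ : ℝ)
  · simp [S, hg0]

/-- Two Haar measures are proportional, and the inversion formula for a single function with `f 0 ≠
0` forces the factor to be `1`. Hence the choice made in `dualMeasure` is no choice. -/
lemma IsDualMeasure.eq_dualHaar {ν : Measure (StrongDual ℝ E)} (hν : IsDualMeasure μ ν) :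
    ν = dualHaar μ := by
  have := hν.1
  have h1 : ν = Measure.addHaarScalarFactor ν (dualHaar μ) • dualHaar μ :=
    Measure.isAddLeftInvariant_eq_smul _ _
  set s := Measure.addHaarScalarFactor ν (dualHaar μ)
  obtain ⟨f, hf, hfi, hF, h0⟩ := exists_fourier_test μ
  have h2 := (isDualMeasure_dualHaar μ).2 f hf hfi hF 0
  have hF' : Integrable (fun p : StrongDual ℝ E =>
      ∫ X, f X * Complex.exp (-Complex.I * (p X : ℂ)) ∂μ) ν := by
    rw [h1]
    exact hF.smul_measure_nnreal
  have h3 := hν.2 f hf hfi hF' 0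
  rw [h1, integral_smul_nnreal_measure, mul_smul_comm, ← h2] at h3
  have h4 : s = 1 := by
    rw [NNReal.smul_def, Complex.real_smul] at h3
    have : ((s : ℝ) : ℂ) = 1 := mul_right_cancel₀ h0 (by rw [← h3, one_mul])
    exact_mod_cast this
  rw [h1, h4, one_smul]

lemma dualMeasure_eq : dualMeasure μ = dualHaar μ :=
  IsDualMeasure.eq_dualHaar μ (Classical.epsilon_spec ⟨_, isDualMeasure_dualHaar μ⟩)

lemma lintegral_dual_smul {ħ : ℝ} (hħ : ħ ≠ 0) (u : StrongDual ℝ E → ℝ≥0∞) :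
    ∫⁻ p, u (ħ⁻¹ • p) ∂(dualHaar μ) = ENNReal.ofReal (|ħ| ^ finrank ℝ E) *
      ∫⁻ p, u p ∂(dualHaar μ) := by
  have h := (Homeomorph.smulOfNeZero ħ⁻¹ (inv_ne_zero hħ) :
    StrongDual ℝ E ≃ₜ StrongDual ℝ E).measurableEmbedding.lintegral_map (μ := dualHaar μ) u
  have h2 := Measure.map_addHaar_smul (dualHaar μ) (inv_ne_zero hħ)
  have h3 : finrank ℝ (StrongDual ℝ E) = finrank ℝ E := by
    rw [← (dualEquiv E).toLinearEquiv.finrank_eq]; simp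
  refine Eq.trans h.symm ?_
  have h4 : Measure.map (Homeomorph.smulOfNeZero ħ⁻¹ (inv_ne_zero hħ)) (dualHaar μ) =
    ENNReal.ofReal (|ħ| ^ finrank ℝ E) • dualHaar μ := by
    refine Eq.trans h2 ?_
    rw [h3, inv_pow, inv_inv, abs_pow]
  rw [h4, lintegral_smul_measure]
  rfl

/-- **Plancherel's theorem** for the transform `∫ f(X) e^{-(i/ħ)⟨p,X⟩} dX`. -/
lemma lintegral_momentum_sq {ħ : ℝ} (hħ : ħ ≠ 0) {f : E → ℂ} (h1 : Integrable f μ)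
    (h2 : MemLp f 2 μ) :
    ∫⁻ p : StrongDual ℝ E, ‖∫ X, f X * Complex.exp (-(Complex.I / ħ) * (p X : ℂ)) ∂μ‖ₑ ^ 2
      ∂(dualHaar μ) = ENNReal.ofReal (|2 * Real.pi * ħ| ^ finrank ℝ E) *
        ∫⁻ X, ‖f X‖ₑ ^ 2 ∂μ := by
  have hc : (haarScale μ : ℝ) ≠ 0 := by exact_mod_cast haarScale_ne_zero μ
  have e : ∀ p : StrongDual ℝ E, ∀ X, -(Complex.I / ħ) * (p X : ℂ) =
      -Complex.I * ((ħ⁻¹ • p) X : ℂ) := by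
    intro p X
    simp only [smul_apply, smul_eq_mul]
    push_cast
    ring
  simp only [e]
  rw [lintegral_dual_smul μ hħ (fun p => ‖∫ X, f X * Complex.exp (-Complex.I * (p X : ℂ)) ∂μ‖ₑ ^ 2),
    lintegral_dualHaar]
  simp only [integral_exp_dualEquiv, enorm_smul, mul_pow]
  rw [lintegral_const_mul' _ _ (by simp), lintegral_fourier_sq
    ((integrable_comp_toEuclidean_symm μ).2 h1), lintegral_eq_haarScale μ (fun X => ‖f X‖ₑ ^ 2)]
  · have h5 : ‖(haarScale μ : ℝ)‖ₑ = ENNReal.ofReal (haarScale μ) := by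
      rw [Real.enorm_eq_ofReal (NNReal.coe_nonneg _)]
    rw [h5, ← ENNReal.ofReal_coe_nnreal (p := haarScale μ), ← ENNReal.ofReal_pow (by positivity)]
    simp only [← mul_assoc]
    rw [← ENNReal.ofReal_mul (by positivity), ← ENNReal.ofReal_mul (by positivity),
      ← ENNReal.ofReal_mul (by positivity)]
    congr 2
    rw [abs_mul, abs_of_pos (show 0 < 2 * Real.pi by positivity), mul_pow]
    field_simp
    ring
  · refine ⟨((integrable_comp_toEuclidean_symm μ).2 h1).aestronglyMeasurable, ?_⟩
    have h6 := h2.2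
    rw [eLpNorm_lt_top_iff_lintegral_rpow_enorm_lt_top (by simp) (by simp)] at h6 ⊢
    rw [lintegral_eq_haarScale μ] at h6
    exact (ENNReal.mul_lt_top_iff.1 h6).elim (fun h => h.2) fun h => h.elim
      (fun h => absurd h (by simpa using haarScale_ne_zero μ)) fun h => by
        rw [h]; exact ENNReal.zero_lt_top

end DualMeasure

/-! ### The inverse momentum Fourier transform on `L²` -/

section MomentumFourier

open Module

variable {E : Type*} [NormedAddCommGroup E] [NormedSpace ℝ E] [FiniteDimensional ℝ E]
  [MeasurableSpace E] [BorelSpace E]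
  {G : Type*} [TopologicalSpace G] [T2Space G] [SecondCountableTopology G] [ChartedSpace E G]
  [Group G] [IsTopologicalGroup G] [LocallyCompactSpace G] [MeasurableSpace G] [BorelSpace G]
  {m : Measure G} [m.IsHaarMeasure] [(algMeasure (E := E) m).IsAddHaarMeasure] {ħ : ℝ}

instance : SigmaFinite (dualMeasure (algMeasure (E := E) m)) := by
  rw [dualMeasure_eq]; infer_instance

/-- The square integrable functions to which the integral formula of the inverse momentum Fourier
transform applies. -/
structure SliceIntegrable (m : Measure G) (ψ : G × E → ℂ) : Prop where
  stronglyMeasurable : StronglyMeasurable ψ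
  memLp : MemLp ψ 2 (measN m)
  slice : ∀ᵐ q ∂m, Integrable (fun X => ψ (q, X)) (algMeasure (E := E) m)

lemma ae_measL_of_ae {P : G → Prop} (h : ∀ᵐ q ∂m, P q) : ∀ᵐ x ∂(measL (E := E) ħ m), P x.1 :=
  Measure.ae_smul_measure (Measure.quasiMeasurePreserving_fst.ae h) _

lemma stronglyMeasurable_invMomentumFourier {ψ : G × E → ℂ} (hψ : StronglyMeasurable ψ) :
    StronglyMeasurable (invMomentumFourier ħ m ψ) := by
  have h1 : StronglyMeasurable fun z : (G × StrongDual ℝ E) × E =>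
      ψ (z.1.1, z.2) * Complex.exp (-(Complex.I / ħ) * (z.1.2 z.2 : ℂ)) := by
    refine (hψ.comp_measurable (by fun_prop)).mul (Continuous.stronglyMeasurable ?_)
    fun_prop
  exact h1.integral_prod_right'

lemma eLpNorm_two_sq {α : Type*} [MeasurableSpace α] {μ : Measure α} (u : α → ℂ) :
    eLpNorm u 2 μ ^ (2 : ℕ) = ∫⁻ v, ‖u v‖ₑ ^ 2 ∂μ := by
  simpa using eLpNorm_nnreal_pow_eq_lintegral (f := u) (μ := μ) (p := 2) two_ne_zero

/-- Plancherel is applied on almost every slice `{q} × E`. The normalization of `dl` is the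
reciprocal of the Plancherel constant. -/
lemma SliceIntegrable.eLpNorm_invMomentumFourier (hħ : ħ ≠ 0) {ψ : G × E → ℂ}
    (hψ : SliceIntegrable m ψ) :
    eLpNorm (invMomentumFourier ħ m ψ) 2 (measL ħ m) = eLpNorm ψ 2 (measN m) := by
  refine (ENNReal.pow_right_strictMono two_ne_zero).injective ?_
  rw [eLpNorm_two_sq, eLpNorm_two_sq, measL, measN, lintegral_smul_measure]
  have hm1 : Measurable fun x => ‖invMomentumFourier ħ m ψ x‖ₑ ^ 2 :=
    (stronglyMeasurable_invMomentumFourier hψ.1).measurable.enorm.pow_const 2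
  have hm2 : Measurable fun x => ‖ψ x‖ₑ ^ 2 := hψ.1.measurable.enorm.pow_const 2
  rw [lintegral_prod _ hm1.aemeasurable, lintegral_prod _ hm2.aemeasurable]
  have hfin : ∀ᵐ q ∂m, ∫⁻ X, ‖ψ (q, X)‖ₑ ^ 2 ∂(algMeasure (E := E) m) < ⊤ := by
    refine ae_lt_top hm2.lintegral_prod_right' ?_
    rw [← lintegral_prod _ hm2.aemeasurable]
    have := hψ.2.2
    have h2 := eLpNorm_two_sq (μ := measN m) ψ
    rw [measN] at h2
    rw [← h2]
    exact ENNReal.pow_ne_top this.ne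
  have key : ∀ᵐ q ∂m, ∫⁻ p, ‖invMomentumFourier ħ m ψ (q, p)‖ₑ ^ 2
      ∂(dualMeasure (algMeasure (E := E) m)) = ENNReal.ofReal (|2 * Real.pi * ħ| ^ finrank ℝ E) *
        ∫⁻ X, ‖ψ (q, X)‖ₑ ^ 2 ∂(algMeasure (E := E) m) := by
    filter_upwards [hfin, hψ.3] with q h1 h2
    rw [dualMeasure_eq]
    refine lintegral_momentum_sq _ hħ h2 ⟨h2.1, ?_⟩
    rw [← eLpNorm_two_sq] at h1
    exact (ENNReal.pow_lt_top_iff.1 h1).resolve_right two_ne_zero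
  rw [lintegral_congr_ae key, lintegral_const_mul _ hm2.lintegral_prod_right', smul_eq_mul,
    ← mul_assoc, ← ENNReal.ofReal_mul (by positivity), inv_mul_cancel₀, ENNReal.ofReal_one, one_mul]
  exact pow_ne_zero _ (abs_ne_zero.2 (mul_ne_zero (by positivity) hħ))

lemma SliceIntegrable.memLp_invMomentumFourier (hħ : ħ ≠ 0) {ψ : G × E → ℂ}
    (hψ : SliceIntegrable m ψ) : MemLp (invMomentumFourier ħ m ψ) 2 (measL ħ m) :=
  ⟨(stronglyMeasurable_invMomentumFourier hψ.1).aestronglyMeasurable, by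
    rw [hψ.eLpNorm_invMomentumFourier hħ]; exact hψ.2.2⟩

lemma SliceIntegrable.add {ψ χ : G × E → ℂ} (hψ : SliceIntegrable m ψ)
    (hχ : SliceIntegrable m χ) : SliceIntegrable m (ψ + χ) :=
  ⟨hψ.1.add hχ.1, hψ.2.add hχ.2, by filter_upwards [hψ.3, hχ.3] with q h1 h2 using h1.add h2⟩

lemma SliceIntegrable.const_smul {ψ : G × E → ℂ} (c : ℂ) (hψ : SliceIntegrable m ψ) :
    SliceIntegrable m (c • ψ) :=
  ⟨hψ.1.const_smul c, hψ.2.const_smul c, by filter_upwards [hψ.3] with q h1 using h1.smul c⟩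

lemma integrable_mul_exp {μ : Measure E} {f : E → ℂ} (hf : Integrable f μ)
    (p : StrongDual ℝ E) :
    Integrable (fun X => f X * Complex.exp (-(Complex.I / ħ) * (p X : ℂ))) μ := by
  refine hf.mul_bdd (c := 1) (Continuous.aestronglyMeasurable (by fun_prop))
    (Eventually.of_forall fun X => ?_)
  have : -(Complex.I / ħ) * (p X : ℂ) = ((-(p X / ħ) : ℝ) : ℂ) * Complex.I := by
    push_cast; ring
  rw [this, Complex.norm_exp_ofReal_mul_I]

lemma invMomentumFourier_add {ψ χ : G × E → ℂ} (hψ : SliceIntegrable m ψ)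
    (hχ : SliceIntegrable m χ) : invMomentumFourier ħ m (ψ + χ) =ᵐ[measL ħ m]
      invMomentumFourier ħ m ψ + invMomentumFourier ħ m χ := by
  filter_upwards [ae_measL_of_ae (ħ := ħ) hψ.3, ae_measL_of_ae (ħ := ħ) hχ.3] with x h1 h2
  simp only [invMomentumFourier, Pi.add_apply, add_mul]
  exact integral_add (integrable_mul_exp h1 _) (integrable_mul_exp h2 _)

lemma invMomentumFourier_smul (c : ℂ) (ψ : G × E → ℂ) :
    invMomentumFourier ħ m (c • ψ) = c • invMomentumFourier ħ m ψ := by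
  funext x
  simp only [invMomentumFourier, Pi.smul_apply, smul_eq_mul, mul_assoc]
  exact integral_const_mul _ _

lemma SliceIntegrable.of_hasCompactSupport {ψ : G × E → ℂ} (h1 : Continuous ψ)
    (h2 : HasCompactSupport ψ) : SliceIntegrable m ψ := by
  refine ⟨h1.stronglyMeasurable, ?_, Eventually.of_forall fun q => ?_⟩
  · have : IsFiniteMeasureOnCompacts (measN (E := E) m) :=
      inferInstanceAs (IsFiniteMeasureOnCompacts (m.prod (algMeasure (E := E) m)))
    exact h1.memLp_of_hasCompactSupport h2
  · refine Continuous.integrable_of_hasCompactSupport (by fun_prop) ?_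
    exact h2.comp_isClosedEmbedding (Topology.IsClosedEmbedding.of_continuous_injective_isClosedMap
      (by fun_prop) (fun a b h => congrArg Prod.snd h) (by
        intro C hC
        have : (fun X : E => (q, X)) '' C = {q} ×ˢ C := by ext ⟨a, b⟩; simp [eq_comm, and_comm]
        rw [this]
        exact isClosed_singleton.prod hC))

/-- The pairs of a continuous compactly supported function and its transform. -/
def momentumCore (ħ : ℝ) (m : Measure G) :
    Set (Lp ℂ 2 (measN (E := E) m) × Lp ℂ 2 (measL (E := E) ħ m)) :=
  {u | ∃ ψ : G × E → ℂ, Continuous ψ ∧ HasCompactSupport ψ ∧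
    u.1 =ᵐ[measN m] ψ ∧ u.2 =ᵐ[measL ħ m] invMomentumFourier ħ m ψ}

/-- The core is already a subspace, so every element of the span is given by one continuous
compactly supported function, to which the isometry applies. -/
lemma span_momentumCore_subset :
    ((Submodule.span ℂ (momentumCore (E := E) ħ m) :
      Submodule ℂ (Lp ℂ 2 (measN (E := E) m) × Lp ℂ 2 (measL (E := E) ħ m))) :
      Set (Lp ℂ 2 (measN (E := E) m) × Lp ℂ 2 (measL (E := E) ħ m))) ⊆ momentumCore ħ m := by
  intro u hu
  refine Submodule.span_induction (p := fun u _ => u ∈ momentumCore ħ m) (fun _ h => h) ?_ ?_ ?_ hu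
  · refine ⟨0, continuous_zero, HasCompactSupport.zero, Lp.coeFn_zero _ _ _, ?_⟩
    filter_upwards [Lp.coeFn_zero ℂ 2 (measL (E := E) ħ m)] with x hx
    simpa [invMomentumFourier] using hx
  · rintro u v - - ⟨ψ, h1, h2, h3, h4⟩ ⟨χ, k1, k2, k3, k4⟩
    refine ⟨ψ + χ, h1.add k1, h2.add k2, (Lp.coeFn_add _ _).trans (h3.add k3),
      (Lp.coeFn_add _ _).trans ((h4.add k4).trans ?_)⟩
    exact (invMomentumFourier_add (.of_hasCompactSupport h1 h2)
      (.of_hasCompactSupport k1 k2)).symm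
  · rintro c u - ⟨ψ, h1, h2, h3, h4⟩
    refine ⟨c • ψ, h1.const_smul c, h2.comp_left (g := fun z => c • z) (smul_zero c),
      (Lp.coeFn_smul _ _).trans (h3.const_smul c), (Lp.coeFn_smul _ _).trans ?_⟩
    rw [invMomentumFourier_smul]
    exact h4.const_smul c

lemma norm_snd_eq_of_mem_momentumCore (hħ : ħ ≠ 0)
    {u : Lp ℂ 2 (measN (E := E) m) × Lp ℂ 2 (measL (E := E) ħ m)}
    (hu : u ∈ momentumCore ħ m) : ‖u.2‖ = ‖u.1‖ := by
  obtain ⟨ψ, h1, h2, h3, h4⟩ := hu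
  rw [Lp.norm_def, Lp.norm_def, eLpNorm_congr_ae h3, eLpNorm_congr_ae h4,
    (SliceIntegrable.of_hasCompactSupport h1 h2).eLpNorm_invMomentumFourier hħ]

lemma norm_snd_eq_of_mem (hħ : ħ ≠ 0)
    {u : Lp ℂ 2 (measN (E := E) m) × Lp ℂ 2 (measL (E := E) ħ m)}
    (hu : u ∈ invMomentumFourierL2 ħ m) : ‖u.2‖ = ‖u.1‖ := by
  have hcl : IsClosed {u : Lp ℂ 2 (measN (E := E) m) × Lp ℂ 2 (measL (E := E) ħ m) |
      ‖u.2‖ = ‖u.1‖} := isClosed_eq (by fun_prop) (by fun_prop)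
  refine hcl.closure_subset_iff.2 ?_ hu
  exact fun v hv => norm_snd_eq_of_mem_momentumCore hħ (span_momentumCore_subset hv)

lemma norm_snd_eq_of_mem_pair (hħ : ħ ≠ 0) {f : Lp ℂ 2 (measN (E := E) m)}
    {g : Lp ℂ 2 (measL (E := E) ħ m)} (h : (f, g) ∈ invMomentumFourierL2 ħ m) : ‖g‖ = ‖f‖ := by
  have h1 := norm_snd_eq_of_mem hħ (u := (f, g)) h
  exact h1

lemma exists_hasCompactSupport_norm_sub_lt {f : G × E → ℂ} (hf : MemLp f 2 (measN m)) {ε : ℝ}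
    (hε : 0 < ε) : ∃ ψ : G × E → ℂ, Continuous ψ ∧ HasCompactSupport ψ ∧
      eLpNorm (f - ψ) 2 (measN m) ≤ ENNReal.ofReal ε := by
  have : IsLocallyFiniteMeasure (measN (E := E) m) :=
    inferInstanceAs (IsLocallyFiniteMeasure (m.prod (algMeasure (E := E) m)))
  have : TopologicalSpace.MetrizableSpace G := TopologicalSpace.metrizableSpace_of_t3_secondCountable G
  obtain ⟨ψ, h1, h2, h3, -⟩ := hf.exists_hasCompactSupport_eLpNorm_sub_le (by simp)
    (ε := ENNReal.ofReal ε) (by simpa using hε)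
  exact ⟨ψ, h3, h1, h2⟩

/-- The transform defined by closure agrees with the integral whenever the slices are integrable. An
`L²` approximation by continuous compactly supported functions also approximates the transforms,
because the integral transform is isometric on the difference. -/
lemma SliceIntegrable.mem_graph (hħ : ħ ≠ 0) {ψ : G × E → ℂ} (hψ : SliceIntegrable m ψ) :
    (hψ.memLp.toLp ψ, (hψ.memLp_invMomentumFourier hħ).toLp _) ∈ invMomentumFourierL2 ħ m := by
  refine Metric.mem_closure_iff.2 fun ε hε => ?_
  obtain ⟨χ, h1, h2, h3⟩ := exists_hasCompactSupport_norm_sub_lt hψ.memLp (half_pos hε)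
  have hχ : SliceIntegrable m χ := .of_hasCompactSupport h1 h2
  refine ⟨(hχ.memLp.toLp χ, (hχ.memLp_invMomentumFourier hħ).toLp _),
    Submodule.subset_span ⟨χ, h1, h2, hχ.memLp.coeFn_toLp,
      (hχ.memLp_invMomentumFourier hħ).coeFn_toLp⟩, ?_⟩
  have hd : SliceIntegrable m (ψ + (-1 : ℂ) • χ) := hψ.add (hχ.const_smul _)
  have e1 : ψ + (-1 : ℂ) • χ = ψ - χ := by rw [neg_one_smul, sub_eq_add_neg]
  have h4 : eLpNorm (invMomentumFourier ħ m ψ - invMomentumFourier ħ m χ) 2 (measL ħ m) ≤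
      ENNReal.ofReal (ε / 2) := by
    have h5 := hd.eLpNorm_invMomentumFourier hħ
    rw [e1] at h5
    rw [← h5] at h3
    refine le_trans (le_of_eq (eLpNorm_congr_ae ?_)) h3
    rw [← e1]
    filter_upwards [invMomentumFourier_add (ħ := ħ) hψ (hχ.const_smul (-1))] with x hx
    rw [hx, invMomentumFourier_smul]
    simp [sub_eq_add_neg]
  have hε2 : ε / 2 < ε := half_lt_self hε
  rw [Prod.dist_eq, max_lt_iff]
  constructor
  · refine lt_of_le_of_lt ?_ hε2
    rw [dist_eq_norm, ← MemLp.toLp_sub, Lp.norm_toLp]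
    exact ENNReal.toReal_le_of_le_ofReal (half_pos hε).le h3
  · refine lt_of_le_of_lt ?_ hε2
    rw [dist_eq_norm, ← MemLp.toLp_sub, Lp.norm_toLp]
    exact ENNReal.toReal_le_of_le_ofReal (half_pos hε).le h4

/-- On the closed graph both components have the same norm, so projection to the first factor is
isometric. Its range is closed, and dense because it contains the continuous compactly supported
functions. -/
lemma exists_mem_invMomentumFourierL2 (hħ : ħ ≠ 0) (f : Lp ℂ 2 (measN (E := E) m)) :
    ∃ g, (f, g) ∈ invMomentumFourierL2 ħ m := by
  have : CompleteSpace (invMomentumFourierL2 (E := E) ħ m) :=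
    (Submodule.isClosed_topologicalClosure _).completeSpace_coe
  let T : invMomentumFourierL2 (E := E) ħ m →ₗᵢ[ℂ] Lp ℂ 2 (measN (E := E) m) :=
    { toLinearMap := (LinearMap.fst ℂ _ _).comp (Submodule.subtype _)
      norm_map' := fun u => by
        have := norm_snd_eq_of_mem hħ u.2
        change ‖u.1.1‖ = ‖u.1‖
        rw [Prod.norm_def, this, max_self] }
  have hcl : IsClosed (range T) := T.isometry.isClosedEmbedding.isClosed_range
  have hmem : f ∈ closure (range T) := by
    refine Metric.mem_closure_iff.2 fun ε hε => ?_
    obtain ⟨χ, h1, h2, h3⟩ := exists_hasCompactSupport_norm_sub_lt (Lp.memLp f) (half_pos hε)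
    have hχ : SliceIntegrable m χ := .of_hasCompactSupport h1 h2
    refine ⟨_, ⟨⟨_, hχ.mem_graph hħ⟩, rfl⟩, lt_of_le_of_lt ?_ (half_lt_self hε)⟩
    change dist f (hχ.memLp.toLp χ) ≤ _
    rw [dist_eq_norm, ← Lp.toLp_coeFn f (Lp.memLp f), ← MemLp.toLp_sub, Lp.norm_toLp]
    exact ENNReal.toReal_le_of_le_ofReal (half_pos hε).le h3
  rw [hcl.closure_eq] at hmem
  obtain ⟨⟨⟨a, b⟩, hu⟩, rfl⟩ := hmem
  exact ⟨b, hu⟩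

lemma eq_of_mem_invMomentumFourierL2 (hħ : ħ ≠ 0) {f : Lp ℂ 2 (measN (E := E) m)}
    {g g' : Lp ℂ 2 (measL (E := E) ħ m)} (h : (f, g) ∈ invMomentumFourierL2 ħ m)
    (h' : (f, g') ∈ invMomentumFourierL2 ħ m) : g = g' := by
  have h1 := norm_snd_eq_of_mem hħ (sub_mem h h')
  simpa [sub_eq_zero] using h1

/-- The value of the inverse momentum Fourier transform on `L²`. -/
def momentumMap (hħ : ħ ≠ 0) (f : Lp ℂ 2 (measN (E := E) m)) : Lp ℂ 2 (measL (E := E) ħ m) :=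
  (exists_mem_invMomentumFourierL2 hħ f).choose

lemma momentumMap_mem (hħ : ħ ≠ 0) (f : Lp ℂ 2 (measN (E := E) m)) :
    (f, momentumMap hħ f) ∈ invMomentumFourierL2 ħ m :=
  (exists_mem_invMomentumFourierL2 hħ f).choose_spec

lemma norm_momentumMap (hħ : ħ ≠ 0) (f : Lp ℂ 2 (measN (E := E) m)) :
    ‖momentumMap hħ f‖ = ‖f‖ := norm_snd_eq_of_mem_pair hħ (momentumMap_mem hħ f)

/-- The inverse momentum Fourier transform as an isometry of `L²` spaces. -/
def momentumIsometry (m : Measure G) [m.IsHaarMeasure] [(algMeasure (E := E) m).IsAddHaarMeasure]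
    (hħ : ħ ≠ 0) :
    Lp ℂ 2 (measN (E := E) m) →ₗᵢ[ℂ] Lp ℂ 2 (measL (E := E) ħ m) where
  toLinearMap :=
    { toFun := momentumMap hħ
      map_add' := fun f g => eq_of_mem_invMomentumFourierL2 hħ (momentumMap_mem hħ (f + g))
        (add_mem (momentumMap_mem hħ f) (momentumMap_mem hħ g))
      map_smul' := fun c f => eq_of_mem_invMomentumFourierL2 hħ (momentumMap_mem hħ (c • f))
        (Submodule.smul_mem _ c (momentumMap_mem hħ f)) }
  norm_map' := norm_momentumMap hħ

lemma mem_invMomentumFourierL2_iff (hħ : ħ ≠ 0)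
    {u : Lp ℂ 2 (measN (E := E) m) × Lp ℂ 2 (measL (E := E) ħ m)} :
    u ∈ invMomentumFourierL2 ħ m ↔ u.2 = momentumIsometry m hħ u.1 := by
  have h := momentumMap_mem hħ u.1
  constructor
  · exact fun hu => eq_of_mem_invMomentumFourierL2 hħ hu h
  · intro hu
    have : u = (u.1, momentumIsometry m hħ u.1) := Prod.ext rfl hu
    rw [this]
    exact h

lemma SliceIntegrable.momentumIsometry_toLp (hħ : ħ ≠ 0) {ψ : G × E → ℂ}
    (hψ : SliceIntegrable m ψ) :
    momentumIsometry m hħ (hψ.memLp.toLp ψ) =ᵐ[measL ħ m] invMomentumFourier ħ m ψ := by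
  rw [← (mem_invMomentumFourierL2_iff hħ).1 (hψ.mem_graph hħ)]
  exact (hψ.memLp_invMomentumFourier hħ).coeFn_toLp

lemma isClosed_tildeL (𝒪 : Set E) : IsClosed (tildeL m 𝒪 : Set (Lp ℂ 2 (measN (E := E) m))) := by
  have hs : MeasurableSet {x : G × E | x.2 ∉ closure 𝒪} :=
    (isClosed_closure.preimage continuous_snd).measurableSet.compl
  have h : (tildeL m 𝒪 : Set (Lp ℂ 2 (measN (E := E) m))) =
      {u | LpToLpRestrictCLM (G × E) ℂ ℂ (measN (E := E) m) 2 {x | x.2 ∉ closure 𝒪} u = 0} := by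
    ext u
    have h1 := LpToLpRestrictCLM_coeFn ℂ {x : G × E | x.2 ∉ closure 𝒪} u
    change (∀ᵐ x ∂(measN (E := E) m), x.2 ∉ closure 𝒪 → u x = 0) ↔ _ = _
    rw [Lp.eq_zero_iff_ae_eq_zero]
    have h2 := ae_restrict_iff' (μ := measN (E := E) m) (p := fun x => u x = 0) hs
    refine h2.symm.trans ⟨fun h => ?_, fun h => ?_⟩
    · filter_upwards [h, h1] with x k1 k2 using k2.trans k1
    · filter_upwards [h, h1] with x k1 k2 using k2.symm.trans k1
  rw [h]
  exact isClosed_eq (ContinuousLinearMap.continuous _) continuous_const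

lemma mem_subspaceL_iff (hħ : ħ ≠ 0) {𝒪 : Set E} {g : Lp ℂ 2 (measL (E := E) ħ m)} :
    g ∈ subspaceL ħ m 𝒪 ↔ ∃ f ∈ tildeL m 𝒪, momentumIsometry m hħ f = g := by
  have h1 : (((tildeL m 𝒪).comap (LinearMap.fst ℂ _ _) ⊓ invMomentumFourierL2 ħ m).map
      (LinearMap.snd ℂ _ _) : Set (Lp ℂ 2 (measL (E := E) ħ m))) =
      momentumIsometry m hħ '' (tildeL m 𝒪) := by
    ext g
    constructor
    · rintro ⟨u, ⟨h1, h2⟩, rfl⟩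
      exact ⟨u.1, h1, ((mem_invMomentumFourierL2_iff hħ).1 h2).symm⟩
    · rintro ⟨f, hf, rfl⟩
      exact ⟨(f, momentumIsometry m hħ f), ⟨hf, (mem_invMomentumFourierL2_iff hħ).2 rfl⟩, rfl⟩
  have h2 : IsClosed (momentumIsometry m hħ ''
      (tildeL m 𝒪 : Set (Lp ℂ 2 (measN (E := E) m)))) := by
    rw [← (momentumIsometry m hħ).isometry.isClosedEmbedding.isClosed_iff_image_isClosed]
    exact isClosed_tildeL (m := m) 𝒪
  rw [← SetLike.mem_coe, subspaceL, Submodule.topologicalClosure_coe, h1, h2.closure_eq]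
  rfl

end MomentumFourier

/-! ### Hilbert algebras with a monotone approximate unit -/

section HilbertAlgebra

/-- A Hilbert algebra: a Hilbert space with a bounded associative product and an involution for
which the left multiplications are a `*`-representation, and with an increasing family of
projections which is an approximate unit. -/
structure HilbertAlgebra (ι H : Type*) [SemilatticeSup ι] [NormedAddCommGroup H]
    [InnerProductSpace ℂ H] where
  mul : H →L[ℂ] H →L[ℂ] H
  invol : H → H
  unit : ι → H
  mul_assoc : ∀ f g h, mul (mul f g) h = mul f (mul g h)
  inner_mul : ∀ f g h, inner ℂ (mul f g) h = inner ℂ g (mul (invol f) h)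
  invol_invol : ∀ f, invol (invol f) = f
  invol_add : ∀ f g, invol (f + g) = invol f + invol g
  invol_mul : ∀ f g, invol (mul f g) = mul (invol g) (invol f)
  inner_invol : ∀ f g, inner ℂ (invol f) (invol g) = inner ℂ g f
  invol_unit : ∀ i, invol (unit i) = unit i
  unit_mul_unit : ∀ i j, i ≤ j → mul (unit i) (unit j) = unit i
  norm_unit_mul_le : ∀ i f, ‖mul (unit i) f‖ ≤ ‖f‖
  tendsto_unit_mul : ∀ f, Tendsto (fun i => mul (unit i) f) atTop (𝓝 f)

namespace HilbertAlgebra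

variable {ι H : Type*} [SemilatticeSup ι] [NormedAddCommGroup H] [InnerProductSpace ℂ H]
  (A : HilbertAlgebra ι H)

omit [SemilatticeSup ι] in
lemma inner_self_eq_ofReal_sq (x : H) : inner ℂ x x = ((‖x‖ : ℝ) : ℂ) ^ 2 :=
  inner_self_eq_norm_sq_to_K x

lemma invol_sub (f g : H) : A.invol (f - g) = A.invol f - A.invol g :=
  map_sub (AddMonoidHom.mk' A.invol A.invol_add) f g

lemma norm_invol (f : H) : ‖A.invol f‖ = ‖f‖ := by
  rw [← sq_eq_sq₀ (norm_nonneg _) (norm_nonneg _)]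
  have h := A.inner_invol f f
  rw [inner_self_eq_norm_sq_to_K, inner_self_eq_norm_sq_to_K] at h
  exact_mod_cast h

/-- The adjoint of right multiplication, obtained from that of left multiplication because the
involution reverses products and is antiunitary. -/
lemma inner_mul_flip (f g h : H) :
    inner ℂ (A.mul f g) h = inner ℂ f (A.mul h (A.invol g)) := by
  rw [← A.inner_invol, A.invol_mul, ← A.inner_mul, ← A.inner_invol, A.invol_mul, A.invol_invol,
    A.invol_invol]

lemma tendsto_mul_unit (f : H) : Tendsto (fun i => A.mul f (A.unit i)) atTop (𝓝 f) := by
  have h := A.tendsto_unit_mul (A.invol f)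
  rw [tendsto_iff_norm_sub_tendsto_zero] at h ⊢
  refine h.congr fun i => ?_
  rw [← A.norm_invol, A.invol_sub, A.invol_mul, A.invol_invol, A.invol_unit]

variable [Nonempty ι]

lemma eq_of_mul_eq {f g : H} (h : A.mul f = A.mul g) : f = g :=
  tendsto_nhds_unique (A.tendsto_mul_unit f) (by rw [h]; exact A.tendsto_mul_unit g)

lemma eq_of_forall_mul_eq {f g : H} (h : ∀ k, A.mul k f = A.mul k g) : f = g :=
  tendsto_nhds_unique (A.tendsto_unit_mul f) (by simp_rw [h]; exact A.tendsto_unit_mul g)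

/-- `u` is a product `invol f ⋆ g`, and `t = ⟨f, g⟩`. -/
def HasTr (u : H) (t : ℂ) : Prop := ∃ f g, u = A.mul (A.invol f) g ∧ t = inner ℂ f g

variable {A} in
-- The trace is a limit of inner products with the approximate unit, hence independent of the
-- factorization of `u`: the functional `∫ · dl` is well defined.
lemma HasTr.tendsto {u : H} {t : ℂ} (h : A.HasTr u t) :
    Tendsto (fun i => inner ℂ (A.unit i) u) atTop (𝓝 t) := by
  obtain ⟨f, g, rfl, rfl⟩ := h
  simp_rw [← A.inner_mul]
  exact (A.tendsto_mul_unit f).inner tendsto_const_nhds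

variable {A} in
lemma HasTr.unique {u : H} {s t : ℂ} (h : A.HasTr u s) (h' : A.HasTr u t) : s = t :=
  tendsto_nhds_unique h.tendsto h'.tendsto

lemma hasTr_mul (f g : H) : A.HasTr (A.mul f g) (inner ℂ (A.invol f) g) :=
  ⟨A.invol f, g, by rw [A.invol_invol], rfl⟩

variable [CompleteSpace H]

lemma adjoint_mul (f : H) : ContinuousLinearMap.adjoint (A.mul f) = A.mul (A.invol f) := by
  symm
  rw [ContinuousLinearMap.eq_adjoint_iff]
  intro x y
  rw [A.inner_mul, A.invol_invol]

/-- The hypothesis says that right multiplication by `ρ` is a positive operator. On a complex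
Hilbert space it is then self-adjoint, and its adjoint is right multiplication by `invol ρ`. -/
lemma invol_eq_of_inner_nonneg {ρ : H} (h : ∀ f, 0 ≤ inner ℂ f (A.mul f ρ)) :
    A.invol ρ = ρ := by
  have hpos : (A.mul.flip ρ).IsPositive := by
    rw [ContinuousLinearMap.isPositive_iff_complex]
    intro f
    have h1 := Complex.nonneg_iff.1 (h f)
    have h2 : inner ℂ (A.mul.flip ρ f) f = inner ℂ f (A.mul f ρ) := by
      rw [← inner_conj_symm]
      exact Complex.conj_eq_iff_im.2 h1.2.symm
    rw [h2]
    exact ⟨Complex.ext rfl h1.2, h1.1⟩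
  refine A.eq_of_forall_mul_eq fun k => ?_
  refine ext_inner_left ℂ fun v => ?_
  rw [← A.inner_mul_flip]
  exact hpos.isSymmetric v k

/-- The involution exchanges right and left multiplication, and `ρ` is self-adjoint by the preceding
lemma. Left multiplications are needed because they generate the algebra of observables. -/
lemma nonneg_mul_of_inner_nonneg {ρ : H} (h : ∀ f, 0 ≤ inner ℂ f (A.mul f ρ)) :
    0 ≤ A.mul ρ := by
  rw [ContinuousLinearMap.nonneg_iff_isPositive, ContinuousLinearMap.isPositive_iff_complex]
  intro f
  have h1 := Complex.nonneg_iff.1 (h (A.invol f))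
  have h2 : inner ℂ (A.mul ρ f) f = inner ℂ (A.invol f) (A.mul (A.invol f) ρ) := by
    rw [← A.inner_invol, A.invol_mul, A.invol_eq_of_inner_nonneg h]
  rw [h2]
  exact ⟨Complex.ext rfl h1.2, h1.1⟩

lemma inner_nonneg_of_dense {ρ : H} {F : Set H} (hF : Dense F)
    (h : ∀ f ∈ F, 0 ≤ inner ℂ f (A.mul f ρ)) (f : H) : 0 ≤ inner ℂ f (A.mul f ρ) := by
  have hc : Continuous fun f => inner ℂ f (A.mul f ρ) :=
    continuous_id.inner (A.mul.flip ρ).continuous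
  have hcl : IsClosed {f : H | 0 ≤ inner ℂ f (A.mul f ρ)} := isClosed_Ici.preimage hc
  exact hcl.closure_subset_iff.2 h (hF f)

/-- A positive element whose trace is bounded is the square of a self-adjoint element. -/
theorem exists_sqrt {ρ : H} (hρ : 0 ≤ A.mul ρ) {C : ℝ}
    (hC : ∃ᶠ i in atTop, (inner ℂ (A.unit i) ρ).re ≤ C) :
    ∃ σ, A.invol σ = σ ∧ A.mul σ σ = ρ := by
  set T := A.mul ρ with hT
  set S := CFC.sqrt T with hS
  have hSS : S * S = T := CFC.sqrt_mul_sqrt_self T hρ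
  have hSpos : S.IsPositive := (ContinuousLinearMap.nonneg_iff_isPositive _).1 (CFC.sqrt_nonneg T)
  have hSadj : ContinuousLinearMap.adjoint S = S := hSpos.isSelfAdjoint
  -- By associativity `T` commutes with right multiplications, so its square root does too. An
  -- operator with this property acts like left multiplication by the possibly missing element `S
  -- 1`, which is constructed below as the limit of `S e_i`.
  have hcomm : ∀ f g, S (A.mul f g) = A.mul (S f) g := by
    intro f g
    have h1 : Commute T (A.mul.flip g) := by
      refine ContinuousLinearMap.ext fun h => ?_
      simp only [mul_apply_eq_comp, ContinuousLinearMap.flip_apply, hT, A.mul_assoc]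
    have h2 : Commute S (A.mul.flip g) := h1.cfcₙ_nnreal NNReal.sqrt
    exact congrArg (fun R : H →L[ℂ] H => R f) h2.eq
  -- For `i ≤ j` the difference `x = e_j - e_i` is again a self-adjoint idempotent, so `⟨x, ρ⟩ = ⟨x
  -- x, ρ⟩ = ⟨x, ρ x⟩ = ‖S x‖²`.
  have hsq : ∀ i j, i ≤ j → (‖S (A.unit j) - S (A.unit i)‖ : ℂ) ^ 2 =
      inner ℂ (A.unit j) ρ - inner ℂ (A.unit i) ρ := by
    intro i j hij
    set x := A.unit j - A.unit i with hx
    have hcx : A.invol x = x := by rw [hx, A.invol_sub, A.invol_unit, A.invol_unit]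
    have hji : A.mul (A.unit j) (A.unit i) = A.unit i := by
      have := congrArg A.invol (A.unit_mul_unit i j hij)
      rwa [A.invol_mul, A.invol_unit, A.invol_unit] at this
    have hxx : A.mul x x = x := by
      simp only [hx, map_sub, sub_apply, hji, A.unit_mul_unit i j hij,
        A.unit_mul_unit i i le_rfl, A.unit_mul_unit j j le_rfl]
      abel
    rw [← map_sub, ← inner_self_eq_ofReal_sq]
    have h1 : inner ℂ (S x) (S x) = inner ℂ x (T x) := by
      rw [← ContinuousLinearMap.adjoint_inner_right, hSadj, ← hSS]; rfl
    have h2 := A.inner_mul_flip x x ρ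
    rw [hcx, hxx] at h2
    rw [h1, hT, ← h2, hx, inner_sub_left]
  have hmono : Monotone fun i => (inner ℂ (A.unit i) ρ).re := by
    intro i j hij
    have := congrArg Complex.re (hsq i j hij)
    rw [Complex.sub_re, ← Complex.ofReal_pow, Complex.ofReal_re] at this
    have h2 := sq_nonneg ‖S (A.unit j) - S (A.unit i)‖
    show (inner ℂ (A.unit i) ρ).re ≤ (inner ℂ (A.unit j) ρ).re
    linarith
  have hbdd : BddAbove (range fun i => (inner ℂ (A.unit i) ρ).re) := by
    refine ⟨C, ?_⟩
    rintro _ ⟨i, rfl⟩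
    obtain ⟨j, hij, hj⟩ := frequently_atTop.1 hC i
    exact (hmono hij).trans hj
  -- The numbers `⟨e_i, ρ⟩` increase and are bounded, hence are Cauchy; by `hsq` their increments
  -- are the squared distances of the `S e_i`.
  have hcauchy : CauchySeq fun i => S (A.unit i) := by
    have h1 := (tendsto_atTop_ciSup hmono hbdd).cauchySeq
    rw [Metric.cauchySeq_iff'] at h1 ⊢
    intro ε hε
    obtain ⟨N, hN⟩ := h1 (ε ^ 2) (by positivity)
    refine ⟨N, fun n hn => ?_⟩
    have h2 := congrArg Complex.re (hsq N n hn)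
    rw [Complex.sub_re, ← Complex.ofReal_pow, Complex.ofReal_re] at h2
    have h3 := hN n hn
    rw [Real.dist_eq, ← h2, abs_of_nonneg (sq_nonneg _)] at h3
    rw [dist_eq_norm]
    exact lt_of_pow_lt_pow_left₀ 2 hε.le h3
  obtain ⟨σ, hσ⟩ := cauchySeq_tendsto_of_complete hcauchy
  have hmulσ : A.mul σ = S := by
    refine ContinuousLinearMap.ext fun g => ?_
    have h1 : Tendsto (fun i => A.mul (S (A.unit i)) g) atTop (𝓝 (A.mul σ g)) :=
      (((A.mul.flip g).continuous.tendsto σ).comp hσ)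
    have h2 : Tendsto (fun i => A.mul (S (A.unit i)) g) atTop (𝓝 (S g)) := by
      simp_rw [← hcomm]
      exact (S.continuous.tendsto g).comp (A.tendsto_unit_mul g)
    exact tendsto_nhds_unique h1 h2
  refine ⟨σ, A.eq_of_mul_eq ?_, A.eq_of_mul_eq ?_⟩
  · rw [← A.adjoint_mul, hmulσ, hSadj]
  · refine ContinuousLinearMap.ext fun g => ?_
    rw [A.mul_assoc, hmulσ, ← hT, ← hSS]
    rfl

/-- The functional `a ↦ ⟨σ, a σ⟩`. -/
def vectorFunctional (B : NonUnitalStarSubalgebra ℂ (H →L[ℂ] H)) (σ : H) : B →L[ℂ] ℂ :=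
  ((innerSL ℂ σ).comp (ContinuousLinearMap.apply ℂ H σ)).comp
    (B.toNonUnitalSubalgebra.toSubmodule.subtypeL)

omit [SemilatticeSup ι] [Nonempty ι] in
lemma vectorFunctional_apply (B : NonUnitalStarSubalgebra ℂ (H →L[ℂ] H)) (σ : H) (a : B) :
    vectorFunctional B σ a = inner ℂ σ ((a : H →L[ℂ] H) σ) := rfl

omit [SemilatticeSup ι] [Nonempty ι] in
lemma vectorFunctional_star_mul_self (B : NonUnitalStarSubalgebra ℂ (H →L[ℂ] H)) (σ : H)
    (a : B) : 0 ≤ vectorFunctional B σ (star a * a) := by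
  have h : vectorFunctional B σ (star a * a) =
      inner ℂ ((a : H →L[ℂ] H) σ) ((a : H →L[ℂ] H) σ) := by
    rw [vectorFunctional_apply, ← ContinuousLinearMap.adjoint_inner_right]
    rfl
  rw [h, inner_self_eq_ofReal_sq]
  exact_mod_cast sq_nonneg ‖(a : H →L[ℂ] H) σ‖

/-- Cauchy-Schwarz gives the upper bound. For the lower one the functional is evaluated at the left
multiplications by `e_i`, which have norm at most one and satisfy `⟨σ, e_i σ⟩ → ‖σ‖²`. -/
lemma norm_vectorFunctional {B : NonUnitalStarSubalgebra ℂ (H →L[ℂ] H)}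
    (hB : ∀ f, A.mul f ∈ B) (σ : H) : ‖vectorFunctional B σ‖ = ‖σ‖ ^ 2 := by
  refine le_antisymm ?_ ?_
  · refine ContinuousLinearMap.opNorm_le_bound _ (by positivity) fun a => ?_
    rw [vectorFunctional_apply]
    calc _ ≤ ‖σ‖ * ‖(a : H →L[ℂ] H) σ‖ := norm_inner_le_norm _ _
      _ ≤ ‖σ‖ * (‖(a : H →L[ℂ] H)‖ * ‖σ‖) := by gcongr; exact ContinuousLinearMap.le_opNorm _ _
      _ = ‖σ‖ ^ 2 * ‖a‖ := by rw [pow_two]; change _ = _ * ‖(a : H →L[ℂ] H)‖; ring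
  · have h1 : Tendsto (fun i => ‖inner ℂ σ (A.mul (A.unit i) σ)‖) atTop (𝓝 (‖σ‖ ^ 2)) := by
      have h2 := (tendsto_const_nhds (x := σ)).inner (𝕜 := ℂ) (A.tendsto_unit_mul σ)
      have h3 := h2.norm
      rwa [inner_self_eq_norm_sq_to_K, norm_pow, RCLike.norm_ofReal, abs_norm] at h3
    refine le_of_tendsto h1 (Eventually.of_forall fun i => ?_)
    have h4 := (vectorFunctional B σ).le_opNorm ⟨A.mul (A.unit i), hB _⟩
    refine h4.trans (mul_le_of_le_one_right (norm_nonneg _) ?_)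
    exact ContinuousLinearMap.opNorm_le_bound _ zero_le_one fun f => by
      rw [one_mul]; exact A.norm_unit_mul_le i f

omit [Nonempty ι] [CompleteSpace H] in
-- This turns the vector functional of a self-adjoint `σ` into the trace pairing with the density `σ
-- σ`.
lemma inner_mul_self {σ : H} (hσ : A.invol σ = σ) (f : H) :
    inner ℂ σ (A.mul f σ) = inner ℂ (A.invol f) (A.mul σ σ) := by
  have h := A.inner_mul_flip (A.invol f) σ σ
  rw [hσ, A.inner_mul, A.invol_invol] at h
  exact h

/-- The closure of the left multiplications. -/
lemma coe_topologicalClosure_adjoin :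
    ((NonUnitalStarAlgebra.adjoin ℂ (range A.mul)).topologicalClosure :
      Set (H →L[ℂ] H)) = closure (range A.mul) := by
  let B₀ : NonUnitalStarSubalgebra ℂ (H →L[ℂ] H) :=
    { carrier := range A.mul
      add_mem' := by rintro _ _ ⟨f, rfl⟩ ⟨g, rfl⟩; exact ⟨f + g, map_add _ _ _⟩
      zero_mem' := ⟨0, map_zero _⟩
      mul_mem' := by
        rintro _ _ ⟨f, rfl⟩ ⟨g, rfl⟩
        exact ⟨A.mul f g, ContinuousLinearMap.ext fun h => A.mul_assoc f g h⟩
      smul_mem' := by rintro c _ ⟨f, rfl⟩; exact ⟨c • f, map_smul _ _ _⟩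
      star_mem' := by rintro _ ⟨f, rfl⟩; exact ⟨A.invol f, (A.adjoint_mul f).symm⟩ }
  have h : NonUnitalStarAlgebra.adjoin ℂ (range A.mul) = B₀ :=
    le_antisymm (NonUnitalStarAlgebra.adjoin_le subset_rfl)
      fun x hx => NonUnitalStarAlgebra.subset_adjoin ℂ _ hx
  rw [h]
  rfl

end HilbertAlgebra

end HilbertAlgebra

/-! ### Square integrable kernels -/

section Kernels

variable {X : Type*} [MeasurableSpace X] {m : Measure X} [SigmaFinite m]

/-- The composition of two integral kernels. -/
def kernelComp (m : Measure X) (f g : X × X → ℂ) (x : X × X) : ℂ :=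
  ∫ b, f (x.1, b) * g (b, x.2) ∂m

omit [SigmaFinite m] in
lemma lintegral_mul_sq_le {u v : X → ℝ≥0∞} (hu : Measurable u) (hv : Measurable v) :
    (∫⁻ x, u x * v x ∂m) ^ 2 ≤ (∫⁻ x, u x ^ 2 ∂m) * ∫⁻ x, v x ^ 2 ∂m := by
  have h := ENNReal.lintegral_mul_le_Lp_mul_Lq m (p := 2) (q := 2)
    (by rw [Real.holderConjugate_iff]; norm_num) hu.aemeasurable hv.aemeasurable
  simp only [Pi.mul_apply, ENNReal.rpow_two] at h
  calc _ ≤ ((∫⁻ x, u x ^ 2 ∂m) ^ (1 / 2 : ℝ) * (∫⁻ x, v x ^ 2 ∂m) ^ (1 / 2 : ℝ)) ^ 2 := by gcongr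
    _ = _ := by
      rw [mul_pow, ← ENNReal.rpow_two, ← ENNReal.rpow_two, ← ENNReal.rpow_mul,
        ← ENNReal.rpow_mul]
      norm_num

/-- Submultiplicativity of the Hilbert-Schmidt norm: Cauchy-Schwarz in the inner variable, after
which the double integral factors. -/
lemma lintegral_comp_sq_le {u v : X × X → ℝ≥0∞} (hu : Measurable u) (hv : Measurable v) :
    ∫⁻ x, (∫⁻ b, u (x.1, b) * v (b, x.2) ∂m) ^ 2 ∂(m.prod m) ≤
      (∫⁻ x, u x ^ 2 ∂(m.prod m)) * ∫⁻ x, v x ^ 2 ∂(m.prod m) := by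
  calc _ ≤ ∫⁻ x, (∫⁻ b, u (x.1, b) ^ 2 ∂m) * (∫⁻ b, v (b, x.2) ^ 2 ∂m) ∂(m.prod m) :=
        lintegral_mono fun x => lintegral_mul_sq_le (by fun_prop) (by fun_prop)
    _ = (∫⁻ a, ∫⁻ b, u (a, b) ^ 2 ∂m ∂m) * ∫⁻ c, ∫⁻ b, v (b, c) ^ 2 ∂m ∂m :=
        lintegral_prod_mul (f := fun a => ∫⁻ b, u (a, b) ^ 2 ∂m)
          (g := fun c => ∫⁻ b, v (b, c) ^ 2 ∂m) (hu.pow_const 2).lintegral_prod_right'.aemeasurable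
          (hv.pow_const 2).lintegral_prod_left'.aemeasurable
    _ = _ := by
      rw [lintegral_prod _ (hu.pow_const 2).aemeasurable,
        lintegral_prod_symm' _ (hv.pow_const 2)]

lemma stronglyMeasurable_kernelComp {f g : X × X → ℂ} (hf : StronglyMeasurable f)
    (hg : StronglyMeasurable g) : StronglyMeasurable (kernelComp m f g) := by
  have h : StronglyMeasurable fun z : (X × X) × X => f (z.1.1, z.2) * g (z.2, z.1.2) :=
    (hf.comp_measurable (by fun_prop)).mul (hg.comp_measurable (by fun_prop))
  exact h.integral_prod_right'

lemma eLpNorm_kernelComp_le {f g : X × X → ℂ} (hf : StronglyMeasurable f)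
    (hg : StronglyMeasurable g) :
    eLpNorm (kernelComp m f g) 2 (m.prod m) ≤
      eLpNorm f 2 (m.prod m) * eLpNorm g 2 (m.prod m) := by
  refine (ENNReal.pow_le_pow_left_iff two_ne_zero).1 ?_
  rw [mul_pow, eLpNorm_two_sq, eLpNorm_two_sq, eLpNorm_two_sq]
  refine le_trans (lintegral_mono fun x => ?_)
    (lintegral_comp_sq_le hf.measurable.enorm hg.measurable.enorm)
  refine pow_le_pow_left' ((enorm_integral_le_lintegral_enorm _).trans ?_) 2
  exact lintegral_mono fun b => by rw [enorm_mul]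

lemma memLp_kernelComp {f g : X × X → ℂ} (hf : StronglyMeasurable f)
    (hg : StronglyMeasurable g) (hf2 : MemLp f 2 (m.prod m)) (hg2 : MemLp g 2 (m.prod m)) :
    MemLp (kernelComp m f g) 2 (m.prod m) :=
  ⟨(stronglyMeasurable_kernelComp hf hg).aestronglyMeasurable,
    (eLpNorm_kernelComp_le hf hg).trans_lt (ENNReal.mul_lt_top hf2.2 hg2.2)⟩

lemma memLp_slice_left {f : X × X → ℂ} (hf : StronglyMeasurable f)
    (hf2 : MemLp f 2 (m.prod m)) : ∀ᵐ a ∂m, MemLp (fun b => f (a, b)) 2 m := by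
  have h : ∫⁻ a, ∫⁻ b, ‖f (a, b)‖ₑ ^ 2 ∂m ∂m ≠ ⊤ := by
    rw [← lintegral_prod _ (hf.measurable.enorm.pow_const 2).aemeasurable, ← eLpNorm_two_sq]
    exact ENNReal.pow_ne_top hf2.2.ne
  filter_upwards [ae_lt_top (hf.measurable.enorm.pow_const 2).lintegral_prod_right' h] with a ha
  refine ⟨(hf.comp_measurable measurable_prodMk_left).aestronglyMeasurable, ?_⟩
  rw [← eLpNorm_two_sq] at ha
  exact (ENNReal.pow_lt_top_iff.1 ha).resolve_right two_ne_zero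

lemma memLp_swap {f : X × X → ℂ} (hf2 : MemLp f 2 (m.prod m)) :
    MemLp (fun x => f x.swap) 2 (m.prod m) :=
  hf2.comp_measurePreserving Measure.measurePreserving_swap

lemma memLp_slice_right {f : X × X → ℂ} (hf : StronglyMeasurable f)
    (hf2 : MemLp f 2 (m.prod m)) : ∀ᵐ c ∂m, MemLp (fun b => f (b, c)) 2 m :=
  memLp_slice_left (hf.comp_measurable measurable_swap) (memLp_swap hf2)

lemma ae_fst {p : X → Prop} (h : ∀ᵐ a ∂m, p a) : ∀ᵐ x ∂(m.prod m), p x.1 :=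
  Measure.quasiMeasurePreserving_fst.ae h

lemma ae_snd {p : X → Prop} (h : ∀ᵐ a ∂m, p a) : ∀ᵐ x ∂(m.prod m), p x.2 :=
  Measure.quasiMeasurePreserving_snd.ae h

lemma ae_integrable_kernel {f g : X × X → ℂ} (hf : StronglyMeasurable f)
    (hg : StronglyMeasurable g) (hf2 : MemLp f 2 (m.prod m)) (hg2 : MemLp g 2 (m.prod m)) :
    ∀ᵐ x ∂(m.prod m), Integrable (fun b => f (x.1, b) * g (b, x.2)) m := by
  filter_upwards [ae_fst (memLp_slice_left hf hf2), ae_snd (memLp_slice_right hg hg2)] with x h1 h2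
  exact h1.integrable_mul h2

lemma ae_slice_right {p : X × X → Prop} (h : ∀ᵐ x ∂(m.prod m), p x) :
    ∀ᵐ c ∂m, ∀ᵐ b ∂m, p (b, c) :=
  Measure.ae_ae_of_ae_prod (p := fun x : X × X => p x.swap)
    (Measure.measurePreserving_swap.quasiMeasurePreserving.ae h)

lemma kernelComp_congr {f f' g g' : X × X → ℂ} (hf : f =ᵐ[m.prod m] f')
    (hg : g =ᵐ[m.prod m] g') : kernelComp m f g =ᵐ[m.prod m] kernelComp m f' g' := by
  filter_upwards [ae_fst (Measure.ae_ae_of_ae_prod hf), ae_snd (ae_slice_right hg)] with x h1 h2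
  refine integral_congr_ae ?_
  filter_upwards [h1, h2] with b k1 k2
  rw [k1, k2]

lemma memLp_tensor {φ ψ : X → ℂ} (hφ : MemLp φ 2 m) (hψ : MemLp ψ 2 m) :
    MemLp (fun x : X × X => φ x.1 * ψ x.2) 2 (m.prod m) := by
  have hm : AEStronglyMeasurable (fun x : X × X => φ x.1 * ψ x.2) (m.prod m) :=
    (hφ.1.comp_quasiMeasurePreserving Measure.quasiMeasurePreserving_fst).mul
      (hψ.1.comp_quasiMeasurePreserving Measure.quasiMeasurePreserving_snd)
  refine ⟨hm, ?_⟩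
  have h : eLpNorm (fun x : X × X => φ x.1 * ψ x.2) 2 (m.prod m) ^ (2 : ℕ) < ⊤ := by
    rw [eLpNorm_two_sq]
    simp_rw [enorm_mul, mul_pow]
    rw [lintegral_prod_mul (f := fun a => ‖φ a‖ₑ ^ 2) (g := fun a => ‖ψ a‖ₑ ^ 2)
      (hφ.1.enorm.pow_const 2) (hψ.1.enorm.pow_const 2), ← eLpNorm_two_sq, ← eLpNorm_two_sq]
    exact ENNReal.mul_lt_top (ENNReal.pow_lt_top hφ.2) (ENNReal.pow_lt_top hψ.2)
  exact (ENNReal.pow_lt_top_iff.1 h).resolve_right two_ne_zero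

/-- Fubini in the two inner variables. For almost every `x` it is justified because `f(x.1, ·) ⊗
h(·, x.2)` and `g` are both square integrable on the product. -/
lemma kernelComp_assoc {f g h : X × X → ℂ} (hf : StronglyMeasurable f)
    (hh : StronglyMeasurable h) (hf2 : MemLp f 2 (m.prod m))
    (hg2 : MemLp g 2 (m.prod m)) (hh2 : MemLp h 2 (m.prod m)) :
    kernelComp m (kernelComp m f g) h =ᵐ[m.prod m] kernelComp m f (kernelComp m g h) := by
  filter_upwards [ae_fst (memLp_slice_left hf hf2), ae_snd (memLp_slice_right hh hh2)] with x h1 h2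
  have hint : Integrable (fun z : X × X => (f (x.1, z.1) * h (z.2, x.2)) * g z) (m.prod m) :=
    (memLp_tensor h1 h2).integrable_mul hg2
  have hs := integral_integral_swap (f := fun b c => (f (x.1, b) * h (c, x.2)) * g (b, c)) hint
  simp only [kernelComp]
  calc _ = ∫ c, ∫ b, (f (x.1, b) * h (c, x.2)) * g (b, c) ∂m ∂m := by
        refine integral_congr_ae (Eventually.of_forall fun c => ?_)
        simp only
        rw [← integral_mul_const]
        refine integral_congr_ae (Eventually.of_forall fun b => ?_)
        simp only
        ring
    _ = _ := hs.symm
    _ = _ := by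
        refine integral_congr_ae (Eventually.of_forall fun b => ?_)
        simp only
        rw [← integral_const_mul]
        refine integral_congr_ae (Eventually.of_forall fun c => ?_)
        simp only
        ring

/-- The adjoint of an integral kernel. -/
def kernelStar (f : X × X → ℂ) (x : X × X) : ℂ := conj (f x.swap)

lemma memLp_kernelStar {f : X × X → ℂ} (hf2 : MemLp f 2 (m.prod m)) :
    MemLp (kernelStar f) 2 (m.prod m) := (memLp_swap hf2).star

lemma stronglyMeasurable_kernelStar {f : X × X → ℂ} (hf : StronglyMeasurable f) :
    StronglyMeasurable (kernelStar f) :=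
  Complex.continuous_conj.comp_stronglyMeasurable (hf.comp_measurable measurable_swap)

lemma kernelStar_congr {f f' : X × X → ℂ} (hf : f =ᵐ[m.prod m] f') :
    kernelStar f =ᵐ[m.prod m] kernelStar f' := by
  filter_upwards [Measure.measurePreserving_swap.quasiMeasurePreserving.ae hf] with x hx
  simp only [kernelStar, hx]

lemma kernelStar_kernelComp (f g : X × X → ℂ) :
    kernelStar (kernelComp m f g) = kernelComp m (kernelStar g) (kernelStar f) := by
  funext x
  simp only [kernelStar, kernelComp, Prod.swap]
  rw [← integral_conj]
  refine integral_congr_ae (Eventually.of_forall fun b => ?_)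
  simp only [map_mul, mul_comm]

/-- For almost every fixed second argument `c`, the integrand in the other two variables is a
product of two square integrable functions, so the order of integration can be exchanged. -/
lemma integral_kernelComp_adjoint {f g h : X × X → ℂ} (hf : StronglyMeasurable f)
    (hg : StronglyMeasurable g) (hh : StronglyMeasurable h) (hf2 : MemLp f 2 (m.prod m))
    (hg2 : MemLp g 2 (m.prod m)) (hh2 : MemLp h 2 (m.prod m)) :
    ∫ x, h x * conj (kernelComp m f g x) ∂(m.prod m) =
      ∫ x, kernelComp m (kernelStar f) h x * conj (g x) ∂(m.prod m) := by
  have i1 : Integrable (fun x => h x * conj (kernelComp m f g x)) (m.prod m) :=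
    hh2.integrable_mul (memLp_kernelComp hf hg hf2 hg2).star
  have i2 : Integrable (fun x => kernelComp m (kernelStar f) h x * conj (g x)) (m.prod m) :=
    (memLp_kernelComp (stronglyMeasurable_kernelStar hf) hh (memLp_kernelStar hf2)
      hh2).integrable_mul hg2.star
  rw [integral_prod_symm _ i1, integral_prod_symm _ i2]
  refine integral_congr_ae ?_
  filter_upwards [memLp_slice_right hg hg2, memLp_slice_right hh hh2] with c h1 h2
  have hint : Integrable (fun z : X × X => (h (z.1, c) * conj (g (z.2, c))) * conj (f z))
      (m.prod m) := (memLp_tensor h2 h1.star).integrable_mul hf2.star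
  have hs := integral_integral_swap (f := fun a b => (h (a, c) * conj (g (b, c))) * conj (f (a, b)))
    hint
  simp only [kernelComp, kernelStar, Prod.swap]
  calc _ = ∫ a, ∫ b, (h (a, c) * conj (g (b, c))) * conj (f (a, b)) ∂m ∂m := by
        refine integral_congr_ae (Eventually.of_forall fun a => ?_)
        simp only
        rw [← integral_conj, ← integral_const_mul]
        refine integral_congr_ae (Eventually.of_forall fun b => ?_)
        simp only [map_mul]
        ring
    _ = _ := hs
    _ = _ := by
        refine integral_congr_ae (Eventually.of_forall fun b => ?_)
        simp only
        rw [← integral_mul_const]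
        refine integral_congr_ae (Eventually.of_forall fun a => ?_)
        simp only
        ring

/-- The composition of square integrable kernels. -/
def kernelMul (f g : Lp ℂ 2 (m.prod m)) : Lp ℂ 2 (m.prod m) :=
  (memLp_kernelComp (Lp.stronglyMeasurable f) (Lp.stronglyMeasurable g) (Lp.memLp f)
    (Lp.memLp g)).toLp _

lemma coeFn_kernelMul (f g : Lp ℂ 2 (m.prod m)) :
    kernelMul f g =ᵐ[m.prod m] kernelComp m f g := MemLp.coeFn_toLp _

lemma norm_kernelMul_le (f g : Lp ℂ 2 (m.prod m)) : ‖kernelMul f g‖ ≤ ‖f‖ * ‖g‖ := by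
  rw [kernelMul, Lp.norm_toLp, Lp.norm_def, Lp.norm_def, ← ENNReal.toReal_mul]
  exact ENNReal.toReal_mono (ENNReal.mul_ne_top (Lp.eLpNorm_ne_top _) (Lp.eLpNorm_ne_top _))
    (eLpNorm_kernelComp_le (Lp.stronglyMeasurable f) (Lp.stronglyMeasurable g))

/-- The composition of square integrable kernels as a bounded bilinear map. -/
def kernelMulL (m : Measure X) [SigmaFinite m] :
    Lp ℂ 2 (m.prod m) →L[ℂ] Lp ℂ 2 (m.prod m) →L[ℂ] Lp ℂ 2 (m.prod m) :=
  LinearMap.mkContinuous₂ (LinearMap.mk₂ ℂ kernelMul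
    (by
      intro f f' g
      refine Lp.ext ?_
      filter_upwards [coeFn_kernelMul (f + f') g, coeFn_kernelMul f g, coeFn_kernelMul f' g,
        Lp.coeFn_add (kernelMul f g) (kernelMul f' g),
        kernelComp_congr (Lp.coeFn_add f f') (EventuallyEq.refl _ g),
        ae_integrable_kernel (Lp.stronglyMeasurable f) (Lp.stronglyMeasurable g) (Lp.memLp f)
          (Lp.memLp g),
        ae_integrable_kernel (Lp.stronglyMeasurable f') (Lp.stronglyMeasurable g) (Lp.memLp f')
          (Lp.memLp g)] with x h1 h2 h3 h4 h5 h6 h7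
      rw [h1, h4, h5, Pi.add_apply, h2, h3]
      simp only [kernelComp, Pi.add_apply, add_mul]
      exact integral_add h6 h7)
    (by
      intro c f g
      refine Lp.ext ?_
      filter_upwards [coeFn_kernelMul (c • f) g, coeFn_kernelMul f g,
        Lp.coeFn_smul c (kernelMul f g),
        kernelComp_congr (Lp.coeFn_smul c f) (EventuallyEq.refl _ g)] with x h1 h2 h4 h5
      rw [h1, h4, h5, Pi.smul_apply, h2]
      simp only [kernelComp, Pi.smul_apply, smul_eq_mul, mul_assoc]
      exact integral_const_mul _ _)
    (by
      intro f g g'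
      refine Lp.ext ?_
      filter_upwards [coeFn_kernelMul f (g + g'), coeFn_kernelMul f g, coeFn_kernelMul f g',
        Lp.coeFn_add (kernelMul f g) (kernelMul f g'),
        kernelComp_congr (EventuallyEq.refl _ f) (Lp.coeFn_add g g'),
        ae_integrable_kernel (Lp.stronglyMeasurable f) (Lp.stronglyMeasurable g) (Lp.memLp f)
          (Lp.memLp g),
        ae_integrable_kernel (Lp.stronglyMeasurable f) (Lp.stronglyMeasurable g') (Lp.memLp f)
          (Lp.memLp g')] with x h1 h2 h3 h4 h5 h6 h7
      rw [h1, h4, h5, Pi.add_apply, h2, h3]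
      simp only [kernelComp, Pi.add_apply, mul_add]
      exact integral_add h6 h7)
    (by
      intro c f g
      refine Lp.ext ?_
      filter_upwards [coeFn_kernelMul f (c • g), coeFn_kernelMul f g,
        Lp.coeFn_smul c (kernelMul f g),
        kernelComp_congr (EventuallyEq.refl _ f) (Lp.coeFn_smul c g)] with x h1 h2 h4 h5
      rw [h1, h4, h5, Pi.smul_apply, h2]
      simp only [kernelComp, Pi.smul_apply, smul_eq_mul, mul_left_comm _ c]
      exact integral_const_mul _ _)) 1
    (fun f g => by rw [one_mul]; exact norm_kernelMul_le f g)

/-- The adjoint of a square integrable kernel. -/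
def kernelInvol (f : Lp ℂ 2 (m.prod m)) : Lp ℂ 2 (m.prod m) :=
  (memLp_kernelStar (Lp.memLp f)).toLp _

lemma coeFn_kernelInvol (f : Lp ℂ 2 (m.prod m)) : kernelInvol f =ᵐ[m.prod m] kernelStar f :=
  MemLp.coeFn_toLp _

lemma kernelMul_assoc (f g h : Lp ℂ 2 (m.prod m)) :
    kernelMul (kernelMul f g) h = kernelMul f (kernelMul g h) := by
  refine Lp.ext ?_
  refine (coeFn_kernelMul _ _).trans (EventuallyEq.trans ?_ (coeFn_kernelMul _ _).symm)
  refine (kernelComp_congr (coeFn_kernelMul f g) (EventuallyEq.refl _ h)).trans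
    (EventuallyEq.trans ?_ (kernelComp_congr (EventuallyEq.refl _ f) (coeFn_kernelMul g h)).symm)
  exact kernelComp_assoc (Lp.stronglyMeasurable f) (Lp.stronglyMeasurable h) (Lp.memLp f)
    (Lp.memLp g) (Lp.memLp h)

lemma kernelInvol_kernelMul (f g : Lp ℂ 2 (m.prod m)) :
    kernelInvol (kernelMul f g) = kernelMul (kernelInvol g) (kernelInvol f) := by
  refine Lp.ext ?_
  refine (coeFn_kernelInvol _).trans ((kernelStar_congr (coeFn_kernelMul f g)).trans ?_)
  rw [kernelStar_kernelComp]
  refine EventuallyEq.trans ?_ (coeFn_kernelMul _ _).symm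
  exact (kernelComp_congr (coeFn_kernelInvol g) (coeFn_kernelInvol f)).symm

lemma kernelInvol_kernelInvol (f : Lp ℂ 2 (m.prod m)) : kernelInvol (kernelInvol f) = f := by
  refine Lp.ext ?_
  refine (coeFn_kernelInvol _).trans ((kernelStar_congr (coeFn_kernelInvol f)).trans ?_)
  exact Eventually.of_forall fun x => by simp [kernelStar]

lemma kernelInvol_add (f g : Lp ℂ 2 (m.prod m)) :
    kernelInvol (f + g) = kernelInvol f + kernelInvol g := by
  refine Lp.ext ?_
  filter_upwards [coeFn_kernelInvol (f + g), kernelStar_congr (Lp.coeFn_add f g),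
    coeFn_kernelInvol f, coeFn_kernelInvol g, Lp.coeFn_add (kernelInvol f) (kernelInvol g)]
    with x h1 h2 h3 h4 h5
  rw [h1, h2, h5, Pi.add_apply, h3, h4]
  simp [kernelStar]

lemma inner_kernelInvol (f g : Lp ℂ 2 (m.prod m)) :
    inner ℂ (kernelInvol f) (kernelInvol g) = inner ℂ g f := by
  rw [L2.inner_def, L2.inner_def, ← integral_prod_swap]
  refine integral_congr_ae ?_
  filter_upwards [Measure.measurePreserving_swap.quasiMeasurePreserving.ae (coeFn_kernelInvol f),
    Measure.measurePreserving_swap.quasiMeasurePreserving.ae (coeFn_kernelInvol g)] with x h1 h2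
  rw [h1, h2]
  simp [kernelStar, RCLike.inner_apply, mul_comm]

lemma inner_kernelMul (f g h : Lp ℂ 2 (m.prod m)) :
    inner ℂ (kernelMul f g) h = inner ℂ g (kernelMul (kernelInvol f) h) := by
  rw [L2.inner_def, L2.inner_def]
  have h1 := integral_kernelComp_adjoint (m := m) (Lp.stronglyMeasurable f)
    (Lp.stronglyMeasurable g) (Lp.stronglyMeasurable h) (Lp.memLp f) (Lp.memLp g) (Lp.memLp h)
  refine Eq.trans ?_ (h1.trans ?_)
  · refine integral_congr_ae ?_
    filter_upwards [coeFn_kernelMul f g] with x hx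
    rw [hx, RCLike.inner_apply]
  · refine integral_congr_ae ?_
    filter_upwards [coeFn_kernelMul (kernelInvol f) h,
      kernelComp_congr (coeFn_kernelInvol f) (EventuallyEq.refl _ h)] with x hx hx'
    rw [hx, hx', RCLike.inner_apply]

end Kernels

/-! ### The approximate unit of the algebra of square integrable kernels -/

section KernelUnit

variable {X : Type*} [MeasurableSpace X] {m : Measure X} [SigmaFinite m]

/-- Distinct orthonormal vectors are at distance `√2`, so the balls of radius `1/2` about them are
disjoint and open. -/
lemma Orthonormal.countable_of_secondCountable {H ι : Type*} [NormedAddCommGroup H]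
    [InnerProductSpace ℂ H] [SecondCountableTopology H] {v : ι → H} (hv : Orthonormal ℂ v) :
    Countable ι := by
  have h : ∀ i j, i ≠ j → 1 ≤ dist (v i) (v j) := by
    intro i j hij
    have h1 : ‖v i - v j‖ ^ 2 = 2 := by
      rw [@norm_sub_sq ℂ, hv.2 hij, hv.1 i, hv.1 j]; norm_num
    rw [dist_eq_norm]
    nlinarith [norm_nonneg (v i - v j)]
  have hd : (univ : Set ι).PairwiseDisjoint fun i => Metric.ball (v i) (1 / 2) := by
    intro i _ j _ hij
    exact Metric.ball_disjoint_ball (by linarith [h i j hij])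
  exact countable_univ_iff.1 (hd.countable_of_isOpen (fun i _ => Metric.isOpen_ball)
    fun i _ => ⟨v i, Metric.mem_ball_self (by norm_num)⟩)

variable {w : Type*} (v : w → Lp ℂ 2 m)

/-- The kernel of the projection onto the span of finitely many orthonormal vectors. -/
def unitKernel (s : Finset w) (x : X × X) : ℂ := ∑ i ∈ s, v i x.1 * conj (v i x.2)

omit [SigmaFinite m] in
lemma stronglyMeasurable_unitKernel (s : Finset w) : StronglyMeasurable (unitKernel v s) := by
  refine Finset.stronglyMeasurable_fun_sum _ fun i _ => ?_
  exact ((Lp.stronglyMeasurable (v i)).comp_measurable measurable_fst).mul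
    (Complex.continuous_conj.comp_stronglyMeasurable
      ((Lp.stronglyMeasurable (v i)).comp_measurable measurable_snd))

lemma memLp_unitKernel (s : Finset w) : MemLp (unitKernel v s) 2 (m.prod m) :=
  memLp_finsetSum _ fun i _ => memLp_tensor (Lp.memLp (v i)) (Lp.memLp (v i)).star

/-- The projection onto the span of finitely many orthonormal vectors. -/
def unitProj (s : Finset w) (φ : Lp ℂ 2 m) : Lp ℂ 2 m := ∑ i ∈ s, inner ℂ (v i) φ • v i

omit [SigmaFinite m] in
lemma coeFn_unitProj (s : Finset w) (φ : Lp ℂ 2 m) :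
    unitProj v s φ =ᵐ[m] fun a => ∑ i ∈ s, inner ℂ (v i) φ * v i a := by
  have h1 : ∀ᵐ a ∂m, ∀ i ∈ s, (inner ℂ (v i) φ • v i : Lp ℂ 2 m) a = inner ℂ (v i) φ * v i a := by
    refine (Filter.eventually_all_finset s).2 fun i _ => ?_
    filter_upwards [Lp.coeFn_smul (inner ℂ (v i) φ) (v i)] with a ha
    rw [ha]; rfl
  filter_upwards [h1, Lp.coeFn_finsetSum s (fun i => inner ℂ (v i) φ • v i)] with a k1 k2
  rw [unitProj, k2, Finset.sum_apply]
  exact Finset.sum_congr rfl k1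

variable {v}

omit [SigmaFinite m] in
lemma inner_toLp_eq {φ : X → ℂ} (hφ : MemLp φ 2 m) (u : Lp ℂ 2 m) :
    inner ℂ u (hφ.toLp φ) = ∫ b, conj (u b) * φ b ∂m := by
  rw [L2.inner_def]
  refine integral_congr_ae ?_
  filter_upwards [hφ.coeFn_toLp] with b hb
  rw [hb, RCLike.inner_apply, mul_comm]

omit [SigmaFinite m] in
lemma kernelComp_unitKernel (s : Finset w) {f : X × X → ℂ} {c : X}
    (hc : MemLp (fun b => f (b, c)) 2 m) (a : X) :
    kernelComp m (unitKernel v s) f (a, c) =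
      ∑ i ∈ s, inner ℂ (v i) (hc.toLp _) * v i a := by
  simp only [kernelComp, unitKernel, Finset.sum_mul]
  rw [integral_finsetSum]
  · refine Finset.sum_congr rfl fun i _ => ?_
    rw [inner_toLp_eq, mul_comm, ← integral_const_mul]
    exact integral_congr_ae (Eventually.of_forall fun b => by simp only [mul_assoc])
  · intro i _
    simp only [mul_assoc]
    exact ((Lp.memLp (v i)).star.integrable_mul hc).const_mul _

omit [SigmaFinite m] in
lemma lintegral_enorm_sq_eq {u : X → ℂ} {φ : Lp ℂ 2 m} (h : φ =ᵐ[m] u) :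
    ∫⁻ a, ‖u a‖ₑ ^ 2 ∂m = ‖φ‖ₑ ^ 2 := by
  rw [← eLpNorm_two_sq, ← eLpNorm_congr_ae h, Lp.enorm_def]

omit [SigmaFinite m] in
lemma lintegral_kernelComp_unitKernel (s : Finset w) {f : X × X → ℂ} {c : X}
    (hc : MemLp (fun b => f (b, c)) 2 m) :
    ∫⁻ a, ‖kernelComp m (unitKernel v s) f (a, c)‖ₑ ^ 2 ∂m =
      ‖unitProj v s (hc.toLp _)‖ₑ ^ 2 := by
  refine lintegral_enorm_sq_eq ((coeFn_unitProj v s _).trans ?_)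
  exact Eventually.of_forall fun a => (kernelComp_unitKernel s hc a).symm

omit [SigmaFinite m] in
lemma lintegral_kernelComp_unitKernel_sub (s : Finset w) {f : X × X → ℂ} {c : X}
    (hc : MemLp (fun b => f (b, c)) 2 m) :
    ∫⁻ a, ‖kernelComp m (unitKernel v s) f (a, c) - f (a, c)‖ₑ ^ 2 ∂m =
      ‖unitProj v s (hc.toLp _) - hc.toLp _‖ₑ ^ 2 := by
  refine lintegral_enorm_sq_eq ((Lp.coeFn_sub _ _).trans ?_)
  filter_upwards [coeFn_unitProj v s (hc.toLp _), hc.coeFn_toLp] with a h1 h2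
  rw [Pi.sub_apply, h1, h2, kernelComp_unitKernel s hc]

omit [SigmaFinite m] in
lemma norm_unitProj_le (hv : Orthonormal ℂ v) (s : Finset w) (φ : Lp ℂ 2 m) :
    ‖unitProj v s φ‖ ≤ ‖φ‖ := by
  rw [← sq_le_sq₀ (norm_nonneg _) (norm_nonneg _)]
  refine le_trans (le_of_eq ?_) (hv.sum_inner_products_le φ (s := s))
  have h := hv.inner_sum (fun i => inner ℂ (v i) φ) (fun i => inner ℂ (v i) φ) s
  change inner ℂ (unitProj v s φ) (unitProj v s φ) = _ at h
  rw [HilbertAlgebra.inner_self_eq_ofReal_sq] at h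
  have h2 : ((‖unitProj v s φ‖ ^ 2 : ℝ) : ℂ) =
      ((∑ i ∈ s, ‖inner ℂ (v i) φ‖ ^ 2 : ℝ) : ℂ) := by
    push_cast
    rw [h]
    exact Finset.sum_congr rfl fun i _ => Complex.conj_mul' _
  exact_mod_cast h2

/-- Composition with `unitKernel` applies an orthogonal projection to almost every column `f(·, c)`.
-/
lemma norm_kernelMul_unit_le (hv : Orthonormal ℂ v) (s : Finset w) (f : Lp ℂ 2 (m.prod m)) :
    ‖kernelMul ((memLp_unitKernel v s).toLp _) f‖ ≤ ‖f‖ := by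
  have h : ‖kernelMul ((memLp_unitKernel v s).toLp _) f‖ₑ ^ 2 ≤ ‖f‖ₑ ^ 2 := by
    have hm := stronglyMeasurable_kernelComp (m := m) (stronglyMeasurable_unitKernel v s)
      (Lp.stronglyMeasurable f)
    rw [← lintegral_enorm_sq_eq ((coeFn_kernelMul _ f).trans
      (kernelComp_congr (memLp_unitKernel v s).coeFn_toLp (EventuallyEq.refl _ f))),
      ← lintegral_enorm_sq_eq (EventuallyEq.refl _ (f : X × X → ℂ)),
      lintegral_prod_symm' _ (hm.measurable.enorm.pow_const 2),
      lintegral_prod_symm' _ ((Lp.stronglyMeasurable f).measurable.enorm.pow_const 2)]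
    refine lintegral_mono_ae ?_
    filter_upwards [memLp_slice_right (Lp.stronglyMeasurable f) (Lp.memLp f)] with c hc
    rw [lintegral_kernelComp_unitKernel s hc, lintegral_enorm_sq_eq hc.coeFn_toLp]
    gcongr
    exact enorm_le_iff_norm_le.2 (norm_unitProj_le hv s _)
  exact enorm_le_iff_norm_le.1 ((ENNReal.pow_le_pow_left_iff two_ne_zero).1 h)

/-- On each column this is the expansion in the Hilbert basis. The columns are integrated by
dominated convergence with bound `(2 ‖f(·, c)‖)²`; countability of `w` makes the filter of finite
subsets countably generated, as that theorem requires. -/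
lemma tendsto_kernelMul_unit [Countable w] (b : HilbertBasis w ℂ (Lp ℂ 2 m))
    (f : Lp ℂ 2 (m.prod m)) :
    Tendsto (fun s => kernelMul ((memLp_unitKernel b s).toLp _) f) atTop (𝓝 f) := by
  have hv := b.orthonormal
  rw [tendsto_iff_edist_tendsto_0]
  have key : Tendsto (fun s => ∫⁻ c, ∫⁻ a, ‖kernelComp m (unitKernel b s) f (a, c) - f (a, c)‖ₑ ^ 2
      ∂m ∂m) atTop (𝓝 (∫⁻ _, 0 ∂m)) := by
    refine tendsto_lintegral_filter_of_dominated_convergence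
      (fun c => 4 * ∫⁻ a, ‖f (a, c)‖ₑ ^ 2 ∂m) (Eventually.of_forall fun s => ?_)
      (Eventually.of_forall fun s => ?_) ?_ ?_
    · exact (((stronglyMeasurable_kernelComp (stronglyMeasurable_unitKernel b s)
        (Lp.stronglyMeasurable f)).sub (Lp.stronglyMeasurable f)).measurable.enorm.pow_const
          2).lintegral_prod_left'
    · filter_upwards [memLp_slice_right (Lp.stronglyMeasurable f) (Lp.memLp f)] with c hc
      rw [lintegral_kernelComp_unitKernel_sub s hc, lintegral_enorm_sq_eq hc.coeFn_toLp]
      have h1 : ‖unitProj b s (hc.toLp _) - hc.toLp _‖ₑ ≤ 2 * ‖hc.toLp _‖ₑ := by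
        refine (enorm_sub_le).trans ?_
        rw [two_mul]
        gcongr
        exact enorm_le_iff_norm_le.2 (norm_unitProj_le hv s _)
      calc _ ≤ (2 * ‖hc.toLp _‖ₑ) ^ 2 := by gcongr
        _ = _ := by rw [mul_pow]; norm_num
    · rw [lintegral_const_mul _ ((Lp.stronglyMeasurable
        f).measurable.enorm.pow_const 2).lintegral_prod_left',
        ← lintegral_prod_symm' _ ((Lp.stronglyMeasurable f).measurable.enorm.pow_const 2),
        ← eLpNorm_two_sq]
      exact ENNReal.mul_ne_top (by norm_num) (ENNReal.pow_ne_top (Lp.eLpNorm_ne_top f))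
    · filter_upwards [memLp_slice_right (Lp.stronglyMeasurable f) (Lp.memLp f)] with c hc
      simp_rw [lintegral_kernelComp_unitKernel_sub _ hc]
      have h1 : Tendsto (fun s => unitProj b s (hc.toLp _)) atTop (𝓝 (hc.toLp _)) := by
        have := b.hasSum_repr (hc.toLp _)
        simp only [HilbertBasis.repr_apply_apply] at this
        exact this
      have h2 := (tendsto_iff_edist_tendsto_0.1 h1)
      simp only [edist_eq_enorm_sub] at h2
      simpa [Function.comp_def] using ((ENNReal.continuous_pow 2).tendsto 0).comp h2
  rw [lintegral_zero] at key
  have h3 : ∀ s, edist (kernelMul ((memLp_unitKernel b s).toLp _) f) f ^ 2 =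
      ∫⁻ c, ∫⁻ a, ‖kernelComp m (unitKernel b s) f (a, c) - f (a, c)‖ₑ ^ 2 ∂m ∂m := by
    intro s
    rw [edist_eq_enorm_sub]
    rw [← lintegral_enorm_sq_eq (u := fun x => kernelComp m (unitKernel b s) f x - f x)]
    · exact lintegral_prod_symm' _ (((stronglyMeasurable_kernelComp
        (stronglyMeasurable_unitKernel b s) (Lp.stronglyMeasurable f)).sub
          (Lp.stronglyMeasurable f)).measurable.enorm.pow_const 2)
    · refine (Lp.coeFn_sub _ _).trans (EventuallyEq.sub ?_ (EventuallyEq.refl _ _))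
      exact (coeFn_kernelMul _ f).trans
        (kernelComp_congr (memLp_unitKernel b s).coeFn_toLp (EventuallyEq.refl _ f))
  simp_rw [← h3] at key
  have h4 := (ENNReal.continuous_rpow_const (y := (1 / 2 : ℝ))).tendsto 0 |>.comp key
  simp only [Function.comp_def] at h4
  rw [ENNReal.zero_rpow_of_pos (by norm_num)] at h4
  refine h4.congr fun s => ?_
  rw [← ENNReal.rpow_natCast, ← ENNReal.rpow_mul]
  norm_num

omit [SigmaFinite m] in
lemma kernelComp_unitKernel_unitKernel (hv : Orthonormal ℂ v) {s t : Finset w} (hst : s ⊆ t) :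
    kernelComp m (unitKernel v s) (unitKernel v t) = unitKernel v s := by
  classical
  funext x
  simp only [kernelComp, unitKernel, Finset.sum_mul_sum]
  have hint : ∀ i j, Integrable (fun b => v i x.1 * conj (v i b) * (v j b * conj (v j x.2))) m := by
    intro i j
    have := (((Lp.memLp (v i)).star.integrable_mul (Lp.memLp (v j))).const_mul
      (v i x.1)).mul_const (conj (v j x.2))
    refine this.congr (Eventually.of_forall fun b => ?_)
    simp only [Pi.mul_apply, Pi.star_apply, mul_assoc]
    rfl
  rw [integral_finsetSum _ fun i _ => integrable_finsetSum _ fun j _ => hint i j]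
  refine Finset.sum_congr rfl fun i hi => ?_
  rw [integral_finsetSum _ fun j _ => hint i j]
  have h1 : ∀ j, ∫ b, v i x.1 * conj (v i b) * (v j b * conj (v j x.2)) ∂m =
      if i = j then v i x.1 * conj (v j x.2) else 0 := by
    intro j
    have h2 : ∫ b, v i x.1 * conj (v i b) * (v j b * conj (v j x.2)) ∂m =
        v i x.1 * conj (v j x.2) * inner ℂ (v i) (v j) := by
      rw [L2.inner_def, ← integral_const_mul]
      refine integral_congr_ae (Eventually.of_forall fun b => ?_)
      simp only [RCLike.inner_apply]
      ring
    rw [h2, (orthonormal_iff_ite.1 hv) i j]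
    split_ifs <;> simp
  simp only [h1]
  rw [Finset.sum_ite_eq, if_pos (hst hi)]

omit [SigmaFinite m] in
lemma kernelStar_unitKernel (s : Finset w) : kernelStar (unitKernel v s) = unitKernel v s := by
  funext x
  simp [kernelStar, unitKernel, mul_comm]

/-- The Hilbert algebra of square integrable kernels. -/
def kernelAlgebra [DecidableEq w] [Countable w] (b : HilbertBasis w ℂ (Lp ℂ 2 m)) :
    HilbertAlgebra (Finset w) (Lp ℂ 2 (m.prod m)) where
  mul := kernelMulL m
  invol := kernelInvol
  unit s := (memLp_unitKernel b s).toLp _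
  mul_assoc := kernelMul_assoc
  inner_mul := inner_kernelMul
  invol_invol := kernelInvol_kernelInvol
  invol_add := kernelInvol_add
  invol_mul := kernelInvol_kernelMul
  inner_invol := inner_kernelInvol
  invol_unit s := by
    refine Lp.ext ?_
    refine (coeFn_kernelInvol _).trans ((kernelStar_congr (memLp_unitKernel b s).coeFn_toLp).trans ?_)
    rw [kernelStar_unitKernel]
    exact (memLp_unitKernel b s).coeFn_toLp.symm
  unit_mul_unit s t hst := by
    refine Lp.ext ?_
    refine (coeFn_kernelMul _ _).trans ((kernelComp_congr (memLp_unitKernel b s).coeFn_toLp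
      (memLp_unitKernel b t).coeFn_toLp).trans ?_)
    rw [kernelComp_unitKernel_unitKernel b.orthonormal hst]
    exact (memLp_unitKernel b s).coeFn_toLp.symm
  norm_unit_mul_le := norm_kernelMul_unit_le b.orthonormal
  tendsto_unit_mul := tendsto_kernelMul_unit b

end KernelUnit

/-! ### Transport of Hilbert algebras along unitary maps -/

namespace HilbertAlgebra

variable {ι H K : Type*} [SemilatticeSup ι] [NormedAddCommGroup H] [InnerProductSpace ℂ H]
  [NormedAddCommGroup K] [InnerProductSpace ℂ K]

/-- Transport of the structure of a Hilbert algebra along a unitary map. -/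
def transport (A : HilbertAlgebra ι K) (V : K ≃ₗᵢ[ℂ] H) : HilbertAlgebra ι H where
  mul := ((V.toContinuousLinearEquiv : K →L[ℂ] H).postcomp H).comp
    ((ContinuousLinearMap.precomp K (V.symm.toContinuousLinearEquiv : H →L[ℂ] K)).comp
      (A.mul.comp (V.symm.toContinuousLinearEquiv : H →L[ℂ] K)))
  invol f := V (A.invol (V.symm f))
  unit i := V (A.unit i)
  mul_assoc f g h := by simp [A.mul_assoc]
  inner_mul f g h := by
    have := A.inner_mul (V.symm f) (V.symm g) (V.symm h)
    rw [← V.symm.inner_map_map, ← V.symm.inner_map_map]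
    simpa using! this
  invol_invol f := by simp [A.invol_invol]
  invol_add f g := by simp [A.invol_add]
  invol_mul f g := by simp [A.invol_mul]
  inner_invol f g := by simp [A.inner_invol]
  invol_unit i := by simp [A.invol_unit]
  unit_mul_unit i j hij := by simp [A.unit_mul_unit i j hij]
  norm_unit_mul_le i f := by simpa using A.norm_unit_mul_le i (V.symm f)
  tendsto_unit_mul f := by
    have := (V.continuous.tendsto _).comp (A.tendsto_unit_mul (V.symm f))
    simpa [Function.comp_def] using this

lemma transport_mul (A : HilbertAlgebra ι K) (V : K ≃ₗᵢ[ℂ] H) (f g : K) :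
    (A.transport V).mul (V f) (V g) = V (A.mul f g) := by
  simp [transport]

lemma transport_invol (A : HilbertAlgebra ι K) (V : K ≃ₗᵢ[ℂ] H) (f : K) :
    (A.transport V).invol (V f) = V (A.invol f) := by
  simp [transport]

end HilbertAlgebra

/-! ### Kernels and symbols -/

section Symbols

variable {E : Type*} [NormedAddCommGroup E] [NormedSpace ℝ E] [FiniteDimensional ℝ E]
  [MeasurableSpace E] [BorelSpace E]
  {G : Type*} [TopologicalSpace G] [T2Space G] [SecondCountableTopology G]
  [ChartedSpace E G] [Group G] [LieGroup 𝓘(ℝ, E) ∞ G]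
  [MeasurableSpace G] [BorelSpace G] {m : Measure G} [m.IsHaarMeasure] {𝒪 : Set E}
  [IsTopologicalGroup G] [LocallyCompactSpace G] [(algMeasure (E := E) m).IsAddHaarMeasure]
  {ħ : ℝ}

variable (G) in
/-- The pair of points with midpoint `q` and difference `X`. -/
def pairMap (x : G × E) : G × G :=
  (x.1 * lieExp G (-(1 / 2 : ℝ) • x.2), x.1 * lieExp G ((1 / 2 : ℝ) • x.2))

/-- The function on `G × 𝔤` associated with a kernel. -/
def symbolMap (𝒪 : Set E) (k : G × G → ℂ) (x : G × E) : ℂ :=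
  𝒪.indicator (fun X => (jacF G X : ℂ) * k (pairMap G (x.1, X))) x.2

/-- The kernel associated with a function on `G × 𝔤`. -/
def kernelMap (𝒪 : Set E) (φ : G × E → ℂ) (y : G × G) : ℂ :=
  (lieExp G '' 𝒪).indicator (fun g =>
    φ (y.1 * lieExp G ((1 / 2 : ℝ) • lieLog 𝒪 g), lieLog 𝒪 g) *
      ((jacF G (lieLog 𝒪 g) : ℂ))⁻¹) (y.1⁻¹ * y.2)

lemma symbolMap_of_mem (k : G × G → ℂ) {q : G} {X : E} (hX : X ∈ 𝒪) :
    symbolMap 𝒪 k (q, X) = jacF G X * k (pairMap G (q, X)) := indicator_of_mem hX _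

lemma symbolMap_of_notMem (k : G × G → ℂ) {q : G} {X : E} (hX : X ∉ 𝒪) :
    symbolMap 𝒪 k (q, X) = 0 := indicator_of_notMem hX _

lemma symbolMap_add (k l : G × G → ℂ) :
    symbolMap 𝒪 (k + l) = symbolMap 𝒪 k + symbolMap 𝒪 l := by
  funext ⟨q, X⟩
  by_cases hX : X ∈ 𝒪
  · simp [symbolMap_of_mem _ hX, mul_add]
  · simp [symbolMap_of_notMem _ hX]

lemma symbolMap_smul (c : ℂ) (k : G × G → ℂ) :
    symbolMap 𝒪 (c • k) = c • symbolMap 𝒪 k := by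
  funext ⟨q, X⟩
  by_cases hX : X ∈ 𝒪
  · simp [symbolMap_of_mem _ hX, mul_left_comm]
  · simp [symbolMap_of_notMem _ hX]

namespace IsExpDomain

lemma continuous_pairMap (h𝒪 : IsExpDomain m 𝒪) : Continuous (pairMap G : G × E → G × G) := by
  have := h𝒪.continuous_lieExp
  unfold pairMap
  fun_prop

lemma lieExp_half_mul_half (h𝒪 : IsExpDomain m 𝒪) (X : E) :
    lieExp G ((1 / 2 : ℝ) • X) * lieExp G ((1 / 2 : ℝ) • X) = lieExp G X := by
  rw [← h𝒪.lieExp_add_smul]; norm_num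

lemma lieExp_neg_half (h𝒪 : IsExpDomain m 𝒪) (X : E) :
    lieExp G (-(1 / 2 : ℝ) • X) = (lieExp G ((1 / 2 : ℝ) • X))⁻¹ := by
  rw [neg_smul, h𝒪.lieExp_neg]

lemma pairMap_snd (h𝒪 : IsExpDomain m 𝒪) (x : G × E) :
    (pairMap G x).2 = (pairMap G x).1 * lieExp G x.2 := by
  simp only [pairMap]
  rw [← h𝒪.lieExp_half_mul_half x.2, h𝒪.lieExp_neg_half]
  group

lemma modSqrt_half_sq (h𝒪 : IsExpDomain m 𝒪) (X : E) :
    (Measure.modularCharacterFun (lieExp G (-(1 / 2 : ℝ) • X)) : ℝ) = (modSqrt (lieExp G X))⁻¹ := by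
  rw [← modSqrt_sq, sq, ← modSqrt_mul, h𝒪.lieExp_neg_half, ← mul_inv_rev,
    h𝒪.lieExp_half_mul_half, modSqrt_inv]

/-- Integration in the coordinates of midpoint and difference. -/
lemma lintegral_pairMap (h𝒪 : IsExpDomain m 𝒪) (w : G × G → ℝ≥0∞) (hw : Measurable w) :
    ∫⁻ q, ∫⁻ X in 𝒪, ENNReal.ofReal (jacF G X ^ 2) * w (pairMap G (q, X))
      ∂(algMeasure (E := E) m) ∂m = ∫⁻ y, w y ∂(m.prod m) := by
  have hF : Measurable fun X : E => ENNReal.ofReal (jacF G X ^ 2) :=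
    (continuous_jacF.pow 2).measurable.ennreal_ofReal
  have hP := h𝒪.continuous_pairMap.measurable
  have hE := h𝒪.measurable_lieExp
  rw [lintegral_lintegral_swap ((hF.comp measurable_snd).mul (hw.comp hP)).aemeasurable]
  have h1 : ∀ X ∈ 𝒪, ∫⁻ q, ENNReal.ofReal (jacF G X ^ 2) * w (pairMap G (q, X)) ∂m =
      ENNReal.ofReal (jacJ G 𝒪 X) * ∫⁻ q, w (q, q * lieExp G X) ∂m := by
    intro X hX
    refine (lintegral_const_mul _
      ((hw.comp (hP.comp measurable_prodMk_right) : Measurable fun q => w (pairMap G (q, X))))).trans ?_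
    -- For fixed `X`, right translation by `exp(-X/2)` moves the midpoint to the first point and
    -- costs `Δ(exp X)^(-1/2)`. With `F² = J √Δ`, what remains is the density `J` of Haar measure in
    -- the difference variable.
    have h2 := lintegral_mul_right_eq_modular (m := m) (fun q => w (q, q * lieExp G X))
      (by fun_prop) (lieExp G (-(1 / 2 : ℝ) • X))
    have h3 : ∀ q, w (q * lieExp G (-(1 / 2 : ℝ) • X), q * lieExp G (-(1 / 2 : ℝ) • X) *
        lieExp G X) = w (pairMap G (q, X)) := fun q =>
      congrArg (fun g => w (_, g)) (h𝒪.pairMap_snd (q, X)).symm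
    simp only [h3] at h2
    simp only [Function.comp_def]
    rw [h2, ← mul_assoc]
    congr 1
    have h4 : (Measure.modularCharacterFun (lieExp G (-(1 / 2 : ℝ) • X)) : ℝ≥0∞) =
        ENNReal.ofReal ((modSqrt (lieExp G X))⁻¹) := by
      rw [← h𝒪.modSqrt_half_sq, ENNReal.ofReal_coe_nnreal]
    rw [h4, ← ENNReal.ofReal_mul (sq_nonneg _), h𝒪.jacF_sq_eq hX, mul_assoc,
      mul_inv_cancel₀ (modSqrt_pos _).ne', mul_one]
  rw [setLIntegral_congr_fun h𝒪.isOpen.measurableSet h1]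
  rw [h𝒪.lintegral_lieExp (fun g => ∫⁻ q, w (q, q * g) ∂m)
    (Measurable.lintegral_prod_left' (f := fun z : G × G => w (z.1, z.1 * z.2)) (by fun_prop)),
    lintegral_lintegral_swap (f := fun g q => w (q, q * g)) (by fun_prop),
    lintegral_prod _ hw.aemeasurable]
  exact lintegral_congr fun q => lintegral_mul_left_eq_self (fun b => w (q, b)) q

lemma stronglyMeasurable_symbolMap (h𝒪 : IsExpDomain m 𝒪) {k : G × G → ℂ}
    (hk : StronglyMeasurable k) : StronglyMeasurable (symbolMap 𝒪 k) := by
  have h1 : StronglyMeasurable fun x : G × E => (jacF G x.2 : ℂ) * k (pairMap G x) :=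
    (Complex.continuous_ofReal.comp
      (continuous_jacF.comp continuous_snd)).stronglyMeasurable.mul
      (hk.comp_measurable h𝒪.continuous_pairMap.measurable)
  exact h1.indicator (h𝒪.isOpen.preimage continuous_snd).measurableSet

lemma lintegral_symbolMap (h𝒪 : IsExpDomain m 𝒪) {k : G × G → ℂ} (hk : StronglyMeasurable k) :
    ∫⁻ x, ‖symbolMap 𝒪 k x‖ₑ ^ 2 ∂(measN (E := E) m) = ∫⁻ y, ‖k y‖ₑ ^ 2 ∂(m.prod m) := by
  rw [← h𝒪.lintegral_pairMap _ (hk.measurable.enorm.pow_const 2), measN,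
    lintegral_prod _ ((h𝒪.stronglyMeasurable_symbolMap hk).measurable.enorm.pow_const 2).aemeasurable]
  refine lintegral_congr fun q => ?_
  rw [← lintegral_indicator h𝒪.isOpen.measurableSet]
  refine lintegral_congr fun X => ?_
  by_cases hX : X ∈ 𝒪
  · rw [symbolMap_of_mem _ hX, indicator_of_mem hX, enorm_mul, mul_pow]
    congr 1
    rw [ENNReal.ofReal_pow (jacF_nonneg X), ← ofReal_norm, Complex.norm_real,
      Real.norm_of_nonneg (jacF_nonneg X)]
  · rw [symbolMap_of_notMem _ hX, indicator_of_notMem hX]; simp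

lemma eLpNorm_symbolMap (h𝒪 : IsExpDomain m 𝒪) {k : G × G → ℂ} (hk : StronglyMeasurable k) :
    eLpNorm (symbolMap 𝒪 k) 2 (measN (E := E) m) = eLpNorm k 2 (m.prod m) := by
  refine (ENNReal.pow_right_strictMono two_ne_zero).injective ?_
  simp only [eLpNorm_two_sq]
  exact h𝒪.lintegral_symbolMap hk

lemma memLp_symbolMap (h𝒪 : IsExpDomain m 𝒪) {k : G × G → ℂ} (hk : StronglyMeasurable k)
    (hk2 : MemLp k 2 (m.prod m)) : MemLp (symbolMap 𝒪 k) 2 (measN (E := E) m) :=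
  ⟨(h𝒪.stronglyMeasurable_symbolMap hk).aestronglyMeasurable,
    (h𝒪.eLpNorm_symbolMap hk).trans_lt hk2.2⟩

/-- The isometry applied to `k - l` replaces an argument about preimages of null sets under
`pairMap`. -/
lemma symbolMap_congr (h𝒪 : IsExpDomain m 𝒪) {k l : G × G → ℂ} (hk : StronglyMeasurable k)
    (hl : StronglyMeasurable l) (h : k =ᵐ[m.prod m] l) :
    symbolMap 𝒪 k =ᵐ[measN (E := E) m] symbolMap 𝒪 l := by
  have h1 : eLpNorm (symbolMap 𝒪 (k + (-1 : ℂ) • l)) 2 (measN (E := E) m) = 0 := by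
    rw [h𝒪.eLpNorm_symbolMap (hk.add (hl.const_smul _))]
    refine (eLpNorm_eq_zero_iff (hk.add (hl.const_smul _)).aestronglyMeasurable
      two_ne_zero).2 ?_
    filter_upwards [h] with y hy
    simp [hy]
  rw [eLpNorm_eq_zero_iff (h𝒪.stronglyMeasurable_symbolMap
    (hk.add (hl.const_smul _))).aestronglyMeasurable two_ne_zero, symbolMap_add,
    symbolMap_smul] at h1
  filter_upwards [h1] with x hx
  simpa [← sub_eq_add_neg, sub_eq_zero] using hx

/-- The unitary map from kernels to functions on `G × 𝔤`, as an isometry. -/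
def symbolIsometry (h𝒪 : IsExpDomain m 𝒪) :
    Lp ℂ 2 (m.prod m) →ₗᵢ[ℂ] Lp ℂ 2 (measN (E := E) m) where
  toLinearMap :=
    { toFun := fun k => (h𝒪.memLp_symbolMap (Lp.stronglyMeasurable k) (Lp.memLp k)).toLp _
      map_add' := fun k l => by
        rw [← MemLp.toLp_add]
        refine (MemLp.toLp_eq_toLp_iff _ _).2 ?_
        rw [← symbolMap_add]
        exact h𝒪.symbolMap_congr (Lp.stronglyMeasurable _)
          ((Lp.stronglyMeasurable k).add (Lp.stronglyMeasurable l)) (Lp.coeFn_add k l)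
      map_smul' := fun c k => by
        rw [RingHom.id_apply, ← MemLp.toLp_const_smul]
        refine (MemLp.toLp_eq_toLp_iff _ _).2 ?_
        rw [← symbolMap_smul]
        exact h𝒪.symbolMap_congr (Lp.stronglyMeasurable _)
          ((Lp.stronglyMeasurable k).const_smul c) (Lp.coeFn_smul c k) }
  norm_map' := fun k => by
    change ‖(h𝒪.memLp_symbolMap (Lp.stronglyMeasurable k) (Lp.memLp k)).toLp _‖ = _
    rw [Lp.norm_toLp, h𝒪.eLpNorm_symbolMap (Lp.stronglyMeasurable k), Lp.norm_def]

lemma coeFn_symbolIsometry (h𝒪 : IsExpDomain m 𝒪) (k : Lp ℂ 2 (m.prod m)) :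
    h𝒪.symbolIsometry k =ᵐ[measN (E := E) m] symbolMap 𝒪 k :=
  (h𝒪.memLp_symbolMap (Lp.stronglyMeasurable k) (Lp.memLp k)).coeFn_toLp

lemma symbolIsometry_toLp (h𝒪 : IsExpDomain m 𝒪) {k : G × G → ℂ} (hk : StronglyMeasurable k)
    (hk2 : MemLp k 2 (m.prod m)) :
    h𝒪.symbolIsometry (hk2.toLp k) = (h𝒪.memLp_symbolMap hk hk2).toLp _ :=
  Lp.ext ((h𝒪.coeFn_symbolIsometry _).trans ((h𝒪.symbolMap_congr (Lp.stronglyMeasurable _) hk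
    hk2.coeFn_toLp).trans (h𝒪.memLp_symbolMap hk hk2).coeFn_toLp.symm))

variable (G) in
/-- The logarithm, extended by zero. -/
def logExt (𝒪 : Set E) : G → E := (lieExp G '' 𝒪).indicator (lieLog (G := G) 𝒪)

lemma measurable_logExt (h𝒪 : IsExpDomain m 𝒪) : Measurable (logExt G 𝒪) := by
  classical
  rw [logExt, ← piecewise_eq_indicator]
  exact h𝒪.continuousOn_lieLog.measurable_piecewise continuousOn_const h𝒪.measurableSet_image

lemma stronglyMeasurable_kernelMap (h𝒪 : IsExpDomain m 𝒪) {φ : G × E → ℂ}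
    (hφ : StronglyMeasurable φ) : StronglyMeasurable (kernelMap 𝒪 φ) := by
  have hlog := h𝒪.measurable_logExt
  have hE := h𝒪.measurable_lieExp
  have h1 : Measurable fun y : G × G => φ (y.1 * lieExp G ((1 / 2 : ℝ) • logExt G 𝒪 (y.1⁻¹ * y.2)),
      logExt G 𝒪 (y.1⁻¹ * y.2)) * ((jacF G (logExt G 𝒪 (y.1⁻¹ * y.2)) : ℂ))⁻¹ := by
    have := hφ.measurable
    have hF : Measurable (jacF G : E → ℝ) := continuous_jacF.measurable
    fun_prop
  have h2 : MeasurableSet ((fun y : G × G => y.1⁻¹ * y.2) ⁻¹' (lieExp G '' 𝒪)) :=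
    (by fun_prop : Measurable fun y : G × G => y.1⁻¹ * y.2) h𝒪.measurableSet_image
  have h3 : kernelMap 𝒪 φ = ((fun y : G × G => y.1⁻¹ * y.2) ⁻¹' (lieExp G '' 𝒪)).indicator
      (fun y : G × G => φ (y.1 * lieExp G ((1 / 2 : ℝ) • logExt G 𝒪 (y.1⁻¹ * y.2)),
      logExt G 𝒪 (y.1⁻¹ * y.2)) * ((jacF G (logExt G 𝒪 (y.1⁻¹ * y.2)) : ℂ))⁻¹) := by
    funext y
    by_cases hy : y.1⁻¹ * y.2 ∈ lieExp G '' 𝒪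
    · rw [kernelMap, indicator_of_mem hy,
        indicator_of_mem (s := (fun y : G × G => y.1⁻¹ * y.2) ⁻¹' (lieExp G '' 𝒪)) hy]
      simp only [logExt, indicator_of_mem hy]
    · rw [kernelMap, indicator_of_notMem hy,
        indicator_of_notMem (s := (fun y : G × G => y.1⁻¹ * y.2) ⁻¹' (lieExp G '' 𝒪)) hy]
  rw [h3]
  exact (h1.indicator h2).stronglyMeasurable

lemma kernelMap_pairMap (h𝒪 : IsExpDomain m 𝒪) (φ : G × E → ℂ) (q : G) {X : E} (hX : X ∈ 𝒪) :
    kernelMap 𝒪 φ (pairMap G (q, X)) = φ (q, X) * ((jacF G X : ℂ))⁻¹ := by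
  have h1 : (pairMap G (q, X)).1⁻¹ * (pairMap G (q, X)).2 = lieExp G X := by
    rw [h𝒪.pairMap_snd]; group
  rw [kernelMap, h1, indicator_of_mem (mem_image_of_mem _ hX), h𝒪.lieLog_lieExp hX]
  congr 2
  simp only [pairMap]
  rw [h𝒪.lieExp_neg_half]
  group

lemma symbolMap_kernelMap (h𝒪 : IsExpDomain m 𝒪) (φ : G × E → ℂ) (q : G) {X : E} (hX : X ∈ 𝒪) :
    symbolMap 𝒪 (kernelMap 𝒪 φ) (q, X) = φ (q, X) := by
  rw [symbolMap_of_mem _ hX, h𝒪.kernelMap_pairMap φ q hX, mul_comm, mul_assoc,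
    inv_mul_cancel₀ (by exact_mod_cast (h𝒪.jacF_pos hX).ne'), mul_one]

/-- A function supported in `G × closure 𝒪` is recovered from its kernel on `G × 𝒪`, and the
boundary of `𝒪` is null. -/
lemma range_symbolIsometry (h𝒪 : IsExpDomain m 𝒪) (u : Lp ℂ 2 (measN (E := E) m)) :
    u ∈ tildeL m 𝒪 ↔ ∃ k, h𝒪.symbolIsometry k = u := by
  constructor
  · intro hu
    have hm := h𝒪.stronglyMeasurable_kernelMap (Lp.stronglyMeasurable u)
    have h1 : symbolMap 𝒪 (kernelMap 𝒪 u) =ᵐ[measN (E := E) m] u := by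
      have hb : ∀ᵐ x ∂(measN (E := E) m), x.2 ∉ closure 𝒪 \ 𝒪 :=
        Measure.quasiMeasurePreserving_snd.ae (measure_eq_zero_iff_ae_notMem.1 h𝒪.algMeasure_boundary)
      filter_upwards [hu, hb] with x k1 k2
      by_cases hX : x.2 ∈ 𝒪
      · exact h𝒪.symbolMap_kernelMap u x.1 hX
      · rw [← Prod.mk.eta (p := x), symbolMap_of_notMem _ hX]
        exact (k1 fun h => k2 ⟨h, hX⟩).symm
    have h2 : MemLp (kernelMap 𝒪 u) 2 (m.prod m) := by
      refine ⟨hm.aestronglyMeasurable, ?_⟩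
      rw [← h𝒪.eLpNorm_symbolMap hm, eLpNorm_congr_ae h1]
      exact Lp.eLpNorm_lt_top u
    refine ⟨h2.toLp _, ?_⟩
    rw [h𝒪.symbolIsometry_toLp hm h2]
    exact Lp.ext ((h𝒪.memLp_symbolMap hm h2).coeFn_toLp.trans h1)
  · rintro ⟨k, rfl⟩
    change ∀ᵐ x ∂(measN (E := E) m), x.2 ∉ closure 𝒪 → h𝒪.symbolIsometry k x = 0
    filter_upwards [h𝒪.coeFn_symbolIsometry k] with x hx hX
    rw [hx, ← Prod.mk.eta (p := x), symbolMap_of_notMem _ fun h => hX (subset_closure h)]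

/-- The unitary map from square integrable kernels to `ℒ(M)`. -/
def quantization (h𝒪 : IsExpDomain m 𝒪) (hħ : ħ ≠ 0) : Lp ℂ 2 (m.prod m) ≃ₗᵢ[ℂ] LM ħ m 𝒪 :=
  LinearIsometryEquiv.ofSurjective
    ({ toFun := fun k => (⟨momentumIsometry m hħ (h𝒪.symbolIsometry k), (mem_subspaceL_iff hħ).2
          ⟨_, (h𝒪.range_symbolIsometry _).2 ⟨k, rfl⟩, rfl⟩⟩ : subspaceL ħ m 𝒪)
       map_add' := fun k l => Subtype.ext (by simp)
       map_smul' := fun c k => Subtype.ext (by simp)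
       norm_map' := fun k => by
        change ‖momentumIsometry m hħ (h𝒪.symbolIsometry k)‖ = _
        simp } : Lp ℂ 2 (m.prod m) →ₗᵢ[ℂ] subspaceL ħ m 𝒪)
    (by
      rintro ⟨g, hg⟩
      obtain ⟨f, hf, rfl⟩ := (mem_subspaceL_iff hħ).1 hg
      obtain ⟨k, rfl⟩ := (h𝒪.range_symbolIsometry f).1 hf
      exact ⟨k, rfl⟩)

end IsExpDomain

end Symbols

/-! ### The space `ℱ(M)` -/

section TestKernels

variable {E : Type*} [NormedAddCommGroup E] [NormedSpace ℝ E] [FiniteDimensional ℝ E]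
  [MeasurableSpace E] [BorelSpace E]
  {G : Type*} [TopologicalSpace G] [T2Space G] [SecondCountableTopology G]
  [ChartedSpace E G] [Group G] [LieGroup 𝓘(ℝ, E) ∞ G]
  [MeasurableSpace G] [BorelSpace G] {m : Measure G} [m.IsHaarMeasure] {𝒪 : Set E}
  [IsTopologicalGroup G] [LocallyCompactSpace G] [(algMeasure (E := E) m).IsAddHaarMeasure]
  {ħ : ℝ}

/-- A bounded measurable function vanishing outside a compact set. -/
structure IsBoundedCompact {X : Type*} [TopologicalSpace X] [MeasurableSpace X] (k : X → ℂ) :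
    Prop where
  stronglyMeasurable : StronglyMeasurable k
  bounded : ∃ C, ∀ x, ‖k x‖ ≤ C
  support : ∃ K, IsCompact K ∧ ∀ x, x ∉ K → k x = 0

namespace IsBoundedCompact

lemma memLp {X : Type*} [TopologicalSpace X] [T2Space X] [MeasurableSpace X]
    [OpensMeasurableSpace X] {k : X → ℂ}
    (hk : IsBoundedCompact k) (μ : Measure X) [IsFiniteMeasureOnCompacts μ] (p : ℝ≥0∞) :
    MemLp k p μ := by
  obtain ⟨C, hC⟩ := hk.bounded
  obtain ⟨K, hK, hK0⟩ := hk.support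
  have h1 : MemLp (K.indicator fun _ => (C : ℂ)) p μ :=
    memLp_indicator_const p hK.measurableSet _ (Or.inr hK.measure_lt_top.ne)
  refine h1.mono hk.stronglyMeasurable.aestronglyMeasurable (Eventually.of_forall fun x => ?_)
  by_cases hx : x ∈ K
  · rw [indicator_of_mem hx, Complex.norm_real]
    exact (hC x).trans (le_abs_self C)
  · rw [hK0 x hx, norm_zero]; exact norm_nonneg _

lemma integrable {X : Type*} [TopologicalSpace X] [T2Space X] [MeasurableSpace X]
    [OpensMeasurableSpace X] {k : X → ℂ}
    (hk : IsBoundedCompact k) (μ : Measure X) [IsFiniteMeasureOnCompacts μ] : Integrable k μ :=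
  memLp_one_iff_integrable.1 (hk.memLp μ 1)

lemma of_continuous {X : Type*} [TopologicalSpace X] [MeasurableSpace X]
    [OpensMeasurableSpace X] {k : X → ℂ} (h1 : Continuous k)
    (h2 : HasCompactSupport k) : IsBoundedCompact k where
  stronglyMeasurable := h1.stronglyMeasurable_of_hasCompactSupport h2
  bounded := h1.bounded_above_of_compact_support h2
  support := ⟨tsupport k, h2, fun _ hx => image_eq_zero_of_notMem_tsupport hx⟩

lemma kernelStar {X : Type*} [TopologicalSpace X] [MeasurableSpace X] {k : X × X → ℂ}
    (hk : IsBoundedCompact k) : IsBoundedCompact (kernelStar k) := by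
  obtain ⟨C, hC⟩ := hk.bounded
  obtain ⟨K, hK, hK0⟩ := hk.support
  refine ⟨stronglyMeasurable_kernelStar hk.stronglyMeasurable, ⟨C, fun x => ?_⟩,
    Prod.swap '' K, hK.image continuous_swap, fun x hx => ?_⟩
  · rw [LieStar.kernelStar, RCLike.norm_conj]; exact hC _
  · rw [LieStar.kernelStar, hK0 _ fun h => hx ⟨_, h, Prod.swap_swap x⟩, map_zero]

/-- Closure under composition is the reason for this class: the integral formula for the transform
then applies to a product of test kernels without a proof that the product is smooth. -/
lemma kernelComp {k l : G × G → ℂ} (hk : IsBoundedCompact k) (hl : IsBoundedCompact l) :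
    IsBoundedCompact (kernelComp m k l) := by
  obtain ⟨C, hC⟩ := hk.bounded
  obtain ⟨K, hK, hK0⟩ := hk.support
  obtain ⟨D, hD⟩ := hl.bounded
  obtain ⟨L, hL, hL0⟩ := hl.support
  refine ⟨stronglyMeasurable_kernelComp hk.stronglyMeasurable hl.stronglyMeasurable,
    ⟨C * D * m.real (Prod.snd '' K), fun x => ?_⟩, (Prod.fst '' K) ×ˢ (Prod.snd '' L),
      (hK.image continuous_fst).prod (hL.image continuous_snd), fun x hx => ?_⟩
  · have h0 : ∀ b, b ∉ Prod.snd '' K → k (x.1, b) * l (b, x.2) = 0 := fun b hb => by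
      rw [hK0 _ fun h => hb ⟨_, h, rfl⟩, zero_mul]
    have h1 : LieStar.kernelComp m k l x = ∫ b in Prod.snd '' K, k (x.1, b) * l (b, x.2) ∂m :=
      (setIntegral_eq_integral_of_forall_compl_eq_zero fun b hb => h0 b hb).symm
    rw [h1]
    refine norm_setIntegral_le_of_norm_le_const (hK.image continuous_snd).measure_lt_top
      fun b _ => ?_
    rw [norm_mul]
    exact mul_le_mul (hC _) (hD _) (norm_nonneg _) ((norm_nonneg _).trans (hC (x.1, b)))
  · have h0 : ∀ b, k (x.1, b) * l (b, x.2) = 0 := by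
      intro b
      by_contra h
      refine hx ⟨⟨(x.1, b), ?_, rfl⟩, ⟨(b, x.2), ?_, rfl⟩⟩
      · by_contra h'; exact h (by rw [hK0 _ h', zero_mul])
      · by_contra h'; exact h (by rw [hL0 _ h', mul_zero])
    simp [LieStar.kernelComp, h0]

end IsBoundedCompact

namespace IsExpDomain

/-- Here the assumption that `exp⁻¹` preserves precompactness enters: compactly supported kernels
have symbols supported, uniformly in `q`, over a compact set of `X`, and are therefore integrable in
`X`. -/
lemma exists_isCompact_symbolMap_eq_zero (h𝒪 : IsExpDomain m 𝒪) {K : Set (G × G)}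
    (hK : IsCompact K) : ∃ B : Set E, IsCompact B ∧ ∀ x : G × E, x.2 ∈ 𝒪 → pairMap G x ∈ K →
      x.2 ∈ B := by
  set K' : Set G := (fun y : G × G => y.1⁻¹ * y.2) '' K
  have hK' : IsCompact K' := hK.image (by fun_prop)
  refine ⟨_, h𝒪.precompact (lieExp G '' 𝒪 ∩ K') inter_subset_left
    (hK'.closure_of_subset inter_subset_right), fun x hx hxK => subset_closure ?_⟩
  refine ⟨lieExp G x.2, ⟨mem_image_of_mem _ hx, ⟨_, hxK, ?_⟩⟩, h𝒪.lieLog_lieExp hx⟩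
  change (pairMap G x).1⁻¹ * (pairMap G x).2 = _
  rw [h𝒪.pairMap_snd]; group

lemma integrable_symbolMap (h𝒪 : IsExpDomain m 𝒪) {k : G × G → ℂ} (hk : IsBoundedCompact k)
    (q : G) : Integrable (fun X => symbolMap 𝒪 k (q, X)) (algMeasure (E := E) m) := by
  obtain ⟨C, hC⟩ := hk.bounded
  obtain ⟨K, hK, hK0⟩ := hk.support
  obtain ⟨B, hB, hB0⟩ := h𝒪.exists_isCompact_symbolMap_eq_zero hK
  obtain ⟨D, hD⟩ := hB.exists_bound_of_continuousOn (f := jacF G) continuous_jacF.continuousOn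
  refine IsBoundedCompact.integrable ⟨(h𝒪.stronglyMeasurable_symbolMap hk.1).comp_measurable
    measurable_prodMk_left, ⟨|D| * |C|, fun X => ?_⟩, B, hB, fun X hX => ?_⟩ _
  · by_cases hX : X ∈ 𝒪
    · rw [Function.comp_apply, symbolMap_of_mem _ hX, norm_mul, Complex.norm_real]
      by_cases hp : pairMap G (q, X) ∈ K
      · exact mul_le_mul ((hD _ (hB0 _ hX hp)).trans (le_abs_self _))
          ((hC _).trans (le_abs_self _)) (norm_nonneg _) (abs_nonneg _)
      · rw [hK0 _ hp, norm_zero, mul_zero]; positivity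
    · rw [Function.comp_apply, symbolMap_of_notMem _ hX, norm_zero]; positivity
  · by_cases hX' : X ∈ 𝒪
    · rw [Function.comp_apply, symbolMap_of_mem _ hX', hK0 _ fun hp => hX (hB0 _ hX' hp), mul_zero]
    · exact symbolMap_of_notMem _ hX'

lemma sliceIntegrable_symbolMap (h𝒪 : IsExpDomain m 𝒪) {k : G × G → ℂ}
    (hk : IsBoundedCompact k) : SliceIntegrable m (symbolMap 𝒪 k : G × E → ℂ) :=
  ⟨h𝒪.stronglyMeasurable_symbolMap hk.1, h𝒪.memLp_symbolMap hk.1 (hk.memLp _ 2),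
    Eventually.of_forall fun q => h𝒪.integrable_symbolMap hk q⟩

lemma fn_quantization (h𝒪 : IsExpDomain m 𝒪) (hħ : ħ ≠ 0) {k : G × G → ℂ}
    (hk : IsBoundedCompact k) :
    (h𝒪.quantization hħ ((hk.memLp (m.prod m) 2).toLp k)).fn =ᵐ[measL ħ m]
      invMomentumFourier ħ m (symbolMap 𝒪 k) := by
  have h := (h𝒪.sliceIntegrable_symbolMap hk).momentumIsometry_toLp hħ
  rw [← h𝒪.symbolIsometry_toLp hk.1] at h
  exact h

end IsExpDomain

omit [T2Space G] [SecondCountableTopology G] [LieGroup 𝓘(ℝ, E) ∞ G] [BorelSpace G]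
  [m.IsHaarMeasure] [IsTopologicalGroup G] [LocallyCompactSpace G]
  [(algMeasure (E := E) m).IsAddHaarMeasure] in
lemma LM.ext_fn {f g : LM ħ m 𝒪} (h : f.fn =ᵐ[measL ħ m] g.fn) : f = g :=
  Subtype.ext (Lp.ext h)

/-- The smooth compactly supported kernels. -/
def IsTestKernel (k : G × G → ℂ) : Prop :=
  ContMDiff (𝓘(ℝ, E).prod 𝓘(ℝ, E)) 𝓘(ℝ, ℂ) ∞ k ∧ HasCompactSupport k

omit [FiniteDimensional ℝ E] [MeasurableSpace E] [BorelSpace E] [T2Space G]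
  [Group G] [LieGroup 𝓘(ℝ, E) ∞ G] [IsTopologicalGroup G] [LocallyCompactSpace G] in
lemma IsTestKernel.isBoundedCompact {k : G × G → ℂ} (hk : IsTestKernel (E := E) k) :
    IsBoundedCompact k := .of_continuous hk.1.continuous hk.2

namespace IsExpDomain

/-- The smooth extension `k` required in `IsTildeF` is itself the test kernel. Its values at pairs
with `a⁻¹ b ∉ 𝒰` do not enter the symbol. -/
lemma isTildeF_iff (h𝒪 : IsExpDomain m 𝒪) {φ : G × E → ℂ} :
    IsTildeF 𝒪 φ ↔ ∃ k, IsTestKernel (E := E) k ∧ φ = symbolMap 𝒪 k := by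
  constructor
  · rintro ⟨h1, k, h2, h3, h4⟩
    refine ⟨k, ⟨h2, h3⟩, ?_⟩
    funext ⟨q, X⟩
    by_cases hX : X ∈ 𝒪
    · have h5 : (pairMap G (q, X)).1⁻¹ * (pairMap G (q, X)).2 = lieExp G X := by
        rw [h𝒪.pairMap_snd]; group
      have h6 := h4 (pairMap G (q, X)).1 (pairMap G (q, X)).2
      rw [h5, h𝒪.lieLog_lieExp hX] at h6
      have h7 : (pairMap G (q, X)).1 * lieExp G ((1 / 2 : ℝ) • X) = q := by
        simp only [pairMap]
        rw [h𝒪.lieExp_neg_half]; group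
      rw [h7] at h6
      rw [symbolMap_of_mem _ hX, ← Prod.mk.eta (p := pairMap G (q, X)),
        h6 (mem_image_of_mem _ hX), mul_left_comm, ← Complex.ofReal_mul,
        mul_inv_cancel₀ (h𝒪.jacF_pos hX).ne', Complex.ofReal_one, mul_one]
    · rw [symbolMap_of_notMem _ hX, h1 _ _ hX]
  · rintro ⟨k, hk, rfl⟩
    refine ⟨fun q X hX => symbolMap_of_notMem _ hX, k, hk.1, hk.2, fun a b hab => ?_⟩
    have hV := lieLog_mem hab
    set V := lieLog 𝒪 (a⁻¹ * b) with hVd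
    have hp : pairMap G (a * lieExp G ((1 / 2 : ℝ) • V), V) = (a, b) := by
      refine Prod.ext ?_ ?_
      · simp only [pairMap]; rw [h𝒪.lieExp_neg_half]; group
      · simp only [pairMap]
        rw [mul_assoc, h𝒪.lieExp_half_mul_half, hVd, lieExp_lieLog hab]; group
    rw [symbolMap_of_mem _ hV, hp, mul_comm, ← mul_assoc, ← Complex.ofReal_mul,
      inv_mul_cancel₀ (h𝒪.jacF_pos hV).ne', Complex.ofReal_one, one_mul]

lemma mem_FM_iff (h𝒪 : IsExpDomain m 𝒪) (hħ : ħ ≠ 0) {f : LM ħ m 𝒪} :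
    f ∈ FM ħ m 𝒪 ↔ ∃ (k : G × G → ℂ) (hk : IsTestKernel (E := E) k),
      f = h𝒪.quantization hħ ((hk.isBoundedCompact.memLp (m.prod m) 2).toLp k) := by
  constructor
  · rintro ⟨φ, hφ, hf⟩
    obtain ⟨k, hk, rfl⟩ := h𝒪.isTildeF_iff.1 hφ
    exact ⟨k, hk, LM.ext_fn (hf.trans (h𝒪.fn_quantization hħ hk.isBoundedCompact).symm)⟩
  · rintro ⟨k, hk, rfl⟩
    exact ⟨_, h𝒪.isTildeF_iff.2 ⟨k, hk, rfl⟩, h𝒪.fn_quantization hħ hk.isBoundedCompact⟩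

end IsExpDomain

variable (E) in
/-- The classes of the smooth compactly supported kernels. -/
def testKernels (m : Measure G) : Set (Lp ℂ 2 (m.prod m)) :=
  {u | ∃ k : G × G → ℂ, IsTestKernel (E := E) k ∧ u =ᵐ[m.prod m] k}

/-- A class orthogonal to all test kernels integrates to zero against every smooth compactly
supported function, hence vanishes almost everywhere. -/
lemma dense_testKernels : Dense (testKernels E m) := by
  let S : Submodule ℂ (Lp ℂ 2 (m.prod m)) :=
    { carrier := testKernels E m
      zero_mem' := ⟨0, ⟨contMDiff_const, HasCompactSupport.zero⟩, Lp.coeFn_zero _ _ _⟩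
      add_mem' := by
        rintro u v ⟨k, hk, hu⟩ ⟨l, hl, hv⟩
        exact ⟨k + l, ⟨hk.1.add hl.1, hk.2.add hl.2⟩, (Lp.coeFn_add _ _).trans (hu.add hv)⟩
      smul_mem' := by
        rintro c u ⟨k, hk, hu⟩
        refine ⟨c • k, ⟨?_, hk.2.comp_left (g := fun z => c • z) (smul_zero c)⟩,
          (Lp.coeFn_smul _ _).trans (hu.const_smul c)⟩
        exact ((ContinuousLinearMap.lsmul ℝ ℂ c).contDiff.contMDiff).comp hk.1 }
  change Dense (S : Set (Lp ℂ 2 (m.prod m)))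
  rw [Submodule.dense_iff_topologicalClosure_eq_top, Submodule.topologicalClosure_eq_top_iff,
    Submodule.eq_bot_iff]
  intro u hu
  rw [Lp.eq_zero_iff_ae_eq_zero]
  have hloc : LocallyIntegrable u (m.prod m) := (Lp.memLp u).locallyIntegrable (by norm_num)
  refine ae_eq_zero_of_integral_contMDiff_smul_eq_zero (𝓘(ℝ, E).prod 𝓘(ℝ, E)) hloc
    fun g hg hgc => ?_
  have hk : IsTestKernel (E := E) fun x : G × G => (g x : ℂ) :=
    ⟨Complex.ofRealCLM.contDiff.contMDiff.comp hg, hgc.comp_left Complex.ofReal_zero⟩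
  have hL := hk.isBoundedCompact.memLp (m.prod m) 2
  have h1 := (Submodule.mem_orthogonal S u).1 hu (hL.toLp _) ⟨_, hk, hL.coeFn_toLp⟩
  rw [L2.inner_def] at h1
  rw [← h1]
  refine integral_congr_ae ?_
  filter_upwards [hL.coeFn_toLp] with x hx
  rw [hx, RCLike.inner_apply, Complex.conj_ofReal, Complex.real_smul, mul_comm]

end TestKernels

/-! ### The star-product as the composition of kernels -/

section StarProduct

variable {E : Type*} [NormedAddCommGroup E] [NormedSpace ℝ E] [FiniteDimensional ℝ E]
  [MeasurableSpace E] [BorelSpace E]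
  {G : Type*} [TopologicalSpace G] [T2Space G] [SecondCountableTopology G]
  [ChartedSpace E G] [Group G] [LieGroup 𝓘(ℝ, E) ∞ G]
  [MeasurableSpace G] [BorelSpace G] {m : Measure G} [m.IsHaarMeasure] {𝒪 : Set E}
  [IsTopologicalGroup G] [LocallyCompactSpace G] [(algMeasure (E := E) m).IsAddHaarMeasure]
  {ħ : ℝ}

namespace IsExpDomain

lemma integral_lieExp (h𝒪 : IsExpDomain m 𝒪) {u : G → ℂ} (hu : StronglyMeasurable u) :
    ∫ g, u g ∂m = ∫ X in 𝒪, (jacJ G 𝒪 X : ℂ) * u (lieExp G X) ∂(algMeasure (E := E) m) := by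
  conv_lhs => rw [← h𝒪.map_lieExp]
  rw [integral_map h𝒪.measurable_lieExp.aemeasurable hu.aestronglyMeasurable,
    integral_withDensity_eq_integral_toReal_smul h𝒪.continuous_jacJ.measurable.ennreal_ofReal
    (Eventually.of_forall fun X => ENNReal.ofReal_lt_top)]
  refine integral_congr_ae (Eventually.of_forall fun X => ?_)
  simp only
  rw [ENNReal.toReal_ofReal (jacJ_nonneg X), Complex.real_smul]

lemma integrable_lieExp (h𝒪 : IsExpDomain m 𝒪) {u : G → ℂ} (hu : StronglyMeasurable u) :
    Integrable u m ↔ IntegrableOn (fun X => (jacJ G 𝒪 X : ℂ) * u (lieExp G X)) 𝒪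
      (algMeasure (E := E) m) := by
  conv_lhs => rw [← h𝒪.map_lieExp]
  rw [integrable_map_measure hu.aestronglyMeasurable h𝒪.measurable_lieExp.aemeasurable,
    integrable_withDensity_iff_integrable_smul' h𝒪.continuous_jacJ.measurable.ennreal_ofReal
    (Eventually.of_forall fun X => ENNReal.ofReal_lt_top)]
  refine integrable_congr (Eventually.of_forall fun X => ?_)
  simp only [Function.comp_apply]
  rw [ENNReal.toReal_ofReal (jacJ_nonneg X), Complex.real_smul]

lemma integral_prod_lieExp (h𝒪 : IsExpDomain m 𝒪) {u : G × G → ℂ} (hu : StronglyMeasurable u) :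
    ∫ y, u y ∂(m.prod m) = ∫ Z in 𝒪 ×ˢ 𝒪,
      (jacJ G 𝒪 Z.1 * jacJ G 𝒪 Z.2 : ℂ) * u (lieExp G Z.1, lieExp G Z.2)
        ∂((algMeasure (E := E) m).prod (algMeasure (E := E) m)) := by
  have hJ : Measurable fun X => ENNReal.ofReal (jacJ G 𝒪 X) :=
    h𝒪.continuous_jacJ.measurable.ennreal_ofReal
  have hE := h𝒪.measurable_lieExp
  have h1 : ((((algMeasure (E := E) m).prod (algMeasure (E := E) m)).restrict
      (𝒪 ×ˢ 𝒪)).withDensity (fun Z => ENNReal.ofReal (jacJ G 𝒪 Z.1) *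
        ENNReal.ofReal (jacJ G 𝒪 Z.2))).map (Prod.map (lieExp G) (lieExp G)) = m.prod m := by
    rw [← Measure.prod_restrict, ← prod_withDensity hJ hJ, ← Measure.map_prod_map _ _ hE hE,
      h𝒪.map_lieExp]
  conv_lhs => rw [← h1]
  rw [integral_map (hE.prodMap hE).aemeasurable hu.aestronglyMeasurable,
    integral_withDensity_eq_integral_toReal_smul
      (show Measurable fun Z : E × E => ENNReal.ofReal (jacJ G 𝒪 Z.1) *
        ENNReal.ofReal (jacJ G 𝒪 Z.2) from (hJ.comp measurable_fst).mul (hJ.comp measurable_snd))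
    (Eventually.of_forall fun X => ENNReal.mul_lt_top ENNReal.ofReal_lt_top ENNReal.ofReal_lt_top)]
  refine integral_congr_ae (Eventually.of_forall fun X => ?_)
  simp only
  rw [ENNReal.toReal_mul, ENNReal.toReal_ofReal (jacJ_nonneg _),
    ENNReal.toReal_ofReal (jacJ_nonneg _), Complex.real_smul, Complex.ofReal_mul]
  rfl

/-- The density of the star-product in the variable `X ⋄ Y`. -/
def starDensity (ħ : ℝ) (𝒪 : Set E) (p : StrongDual ℝ E) (z : G) : ℂ :=
  (lieExp G '' 𝒪).indicator (fun z => (modSqrt z : ℂ) / (jacF G (logExt G 𝒪 z) : ℂ) *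
    Complex.exp (-(Complex.I / ħ) * (p (logExt G 𝒪 z) : ℂ))) z

lemma stronglyMeasurable_starDensity (h𝒪 : IsExpDomain m 𝒪) (p : StrongDual ℝ E) :
    StronglyMeasurable (starDensity (G := G) ħ 𝒪 p) := by
  have h1 := h𝒪.measurable_logExt
  have h2 : Measurable (jacF G : E → ℝ) := continuous_jacF.measurable
  have h3 : Measurable (modSqrt : G → ℝ) := continuous_modSqrt.measurable
  have h4 : Measurable p := p.continuous.measurable
  exact (Measurable.indicator (by fun_prop) h𝒪.measurableSet_image).stronglyMeasurable

lemma logExt_lieExp (h𝒪 : IsExpDomain m 𝒪) {Z : E} (hZ : Z ∈ 𝒪) :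
    logExt G 𝒪 (lieExp G Z) = Z := by
  rw [logExt, indicator_of_mem (mem_image_of_mem _ hZ), h𝒪.lieLog_lieExp hZ]

/-- The density is designed so that passing to exponential coordinates leaves the weight `F` of
`symbolMap`: by `F² = J √Δ` one has `J √Δ / F = F`. -/
lemma jacJ_mul_starDensity (h𝒪 : IsExpDomain m 𝒪) (p : StrongDual ℝ E) {Z : E} (hZ : Z ∈ 𝒪) :
    (jacJ G 𝒪 Z : ℂ) * starDensity ħ 𝒪 p (lieExp G Z) =
      jacF G Z * Complex.exp (-(Complex.I / ħ) * (p Z : ℂ)) := by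
  rw [starDensity, indicator_of_mem (mem_image_of_mem _ hZ), h𝒪.logExt_lieExp hZ, ← mul_assoc]
  congr 1
  have h0 : (jacF G Z : ℂ) ≠ 0 := by exact_mod_cast (h𝒪.jacF_pos hZ).ne'
  have h1 : (jacF G Z : ℂ) ^ 2 = jacJ G 𝒪 Z * modSqrt (lieExp G Z) := by
    exact_mod_cast h𝒪.jacF_sq_eq hZ
  rw [mul_div_assoc', ← h1, sq, mul_div_assoc, div_self h0, mul_one]

/-- The integrand of the star-product in group coordinates. -/
def starKernel (ħ : ℝ) (𝒪 : Set E) (k l : G × G → ℂ) (x : G × StrongDual ℝ E) (g z : G) : ℂ :=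
  starDensity ħ 𝒪 x.2 z * (k ((pairMap G (x.1, logExt G 𝒪 z)).1,
      (pairMap G (x.1, logExt G 𝒪 z)).1 * g) *
    l ((pairMap G (x.1, logExt G 𝒪 z)).1 * g, (pairMap G (x.1, logExt G 𝒪 z)).2))

lemma stronglyMeasurable_starKernel (h𝒪 : IsExpDomain m 𝒪) {k l : G × G → ℂ}
    (hk : StronglyMeasurable k) (hl : StronglyMeasurable l) (x : G × StrongDual ℝ E) :
    StronglyMeasurable fun y : G × G => starKernel ħ 𝒪 k l x y.1 y.2 := by
  have h1 := h𝒪.measurable_logExt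
  have h2 := (h𝒪.stronglyMeasurable_starDensity (ħ := ħ) x.2).measurable
  have h3 := h𝒪.continuous_pairMap.measurable
  have h4 := hk.measurable
  have h5 := hl.measurable
  have h6 : Measurable fun y : G × G => pairMap G (x.1, logExt G 𝒪 y.2) :=
    h3.comp (by fun_prop : Measurable fun y : G × G => (x.1, logExt G 𝒪 y.2))
  refine Measurable.stronglyMeasurable ?_
  refine (h2.comp measurable_snd).mul (Measurable.mul (h4.comp ?_) (h5.comp ?_))
  · exact h6.fst.prodMk (h6.fst.mul measurable_fst)
  · exact (h6.fst.mul measurable_fst).prodMk h6.snd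

lemma integral_starKernel (k l : G × G → ℂ) (x : G × StrongDual ℝ E) (z : G) :
    ∫ g, starKernel ħ 𝒪 k l x g z ∂m = starDensity ħ 𝒪 x.2 z *
      kernelComp m k l (pairMap G (x.1, logExt G 𝒪 z)) := by
  simp only [starKernel]
  rw [integral_const_mul]
  congr 1
  exact integral_mul_left_eq_self (fun b => k ((pairMap G (x.1, logExt G 𝒪 z)).1, b) *
    l (b, (pairMap G (x.1, logExt G 𝒪 z)).2)) _

lemma integrable_slice_kernel {k l : G × G → ℂ} (hk : IsBoundedCompact k)
    (hl : IsBoundedCompact l) (a c : G) : Integrable (fun b => k (a, b) * l (b, c)) m := by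
  obtain ⟨C, hC⟩ := hk.bounded
  obtain ⟨K, hK, hK0⟩ := hk.support
  obtain ⟨D, hD⟩ := hl.bounded
  refine IsBoundedCompact.integrable ⟨(hk.1.comp_measurable (by fun_prop)).mul
    (hl.1.comp_measurable (by fun_prop)), ⟨C * D, fun b => ?_⟩, Prod.snd '' K,
      hK.image continuous_snd, fun b hb => ?_⟩ m
  · change ‖k (a, b) * l (b, c)‖ ≤ C * D
    rw [norm_mul]
    exact mul_le_mul (hC _) (hD _) (norm_nonneg _) ((norm_nonneg _).trans (hC (a, b)))
  · change k (a, b) * l (b, c) = 0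
    rw [hK0 _ fun h => hb ⟨_, h, rfl⟩, zero_mul]

lemma stronglyMeasurable_starDensity_mul (h𝒪 : IsExpDomain m 𝒪) {k : G × G → ℂ}
    (hk : StronglyMeasurable k) (x : G × StrongDual ℝ E) : StronglyMeasurable
      fun z => starDensity ħ 𝒪 x.2 z * k (pairMap G (x.1, logExt G 𝒪 z)) := by
  have h1 := h𝒪.measurable_logExt
  exact (h𝒪.stronglyMeasurable_starDensity (ħ := ħ) x.2).mul (hk.comp_measurable
    (h𝒪.continuous_pairMap.measurable.comp (by fun_prop : Measurable
      fun z : G => (x.1, logExt G 𝒪 z))))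

lemma jacJ_mul_starDensity_mul (h𝒪 : IsExpDomain m 𝒪) (k : G × G → ℂ)
    (x : G × StrongDual ℝ E) :
    𝒪.indicator (fun Z => (jacJ G 𝒪 Z : ℂ) * (starDensity ħ 𝒪 x.2 (lieExp G Z) *
      k (pairMap G (x.1, logExt G 𝒪 (lieExp G Z))))) =
    fun Z => symbolMap 𝒪 k (x.1, Z) * Complex.exp (-(Complex.I / ħ) * (x.2 Z : ℂ)) := by
  funext Z
  by_cases hZ : Z ∈ 𝒪
  · rw [indicator_of_mem hZ, ← mul_assoc, h𝒪.jacJ_mul_starDensity _ hZ, h𝒪.logExt_lieExp hZ,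
      symbolMap_of_mem _ hZ]
    ring
  · rw [indicator_of_notMem hZ, symbolMap_of_notMem _ hZ, zero_mul]

lemma integrable_starDensity_mul (h𝒪 : IsExpDomain m 𝒪) {k : G × G → ℂ}
    (hk : IsBoundedCompact k) (x : G × StrongDual ℝ E) :
    Integrable (fun z => starDensity ħ 𝒪 x.2 z * k (pairMap G (x.1, logExt G 𝒪 z))) m := by
  rw [h𝒪.integrable_lieExp (h𝒪.stronglyMeasurable_starDensity_mul hk.1 x),
    ← integrable_indicator_iff h𝒪.isOpen.measurableSet, h𝒪.jacJ_mul_starDensity_mul]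
  exact integrable_mul_exp (h𝒪.integrable_symbolMap hk _) _

lemma integral_starDensity_mul (h𝒪 : IsExpDomain m 𝒪) {k : G × G → ℂ}
    (hk : StronglyMeasurable k) (x : G × StrongDual ℝ E) :
    ∫ z, starDensity ħ 𝒪 x.2 z * k (pairMap G (x.1, logExt G 𝒪 z)) ∂m =
      invMomentumFourier ħ m (symbolMap 𝒪 k) x := by
  rw [h𝒪.integral_lieExp (h𝒪.stronglyMeasurable_starDensity_mul hk x),
    ← integral_indicator h𝒪.isOpen.measurableSet, h𝒪.jacJ_mul_starDensity_mul]
  rfl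

/-- The integral over `g` of the norm is, by left invariance, the density times the composition of
`‖k‖` and `‖l‖`. That composition is again bounded with compact support, so the one-variable
integrability lemma applies to it. -/
lemma integrable_starKernel (h𝒪 : IsExpDomain m 𝒪) {k l : G × G → ℂ} (hk : IsBoundedCompact k)
    (hl : IsBoundedCompact l) (x : G × StrongDual ℝ E) :
    Integrable (fun y : G × G => starKernel ħ 𝒪 k l x y.1 y.2) (m.prod m) := by
  rw [integrable_prod_iff' (h𝒪.stronglyMeasurable_starKernel hk.1 hl.1 x).aestronglyMeasurable]
  constructor
  · refine Eventually.of_forall fun z => ?_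
    simp only [starKernel]
    generalize pairMap G (x.1, logExt G 𝒪 z) = y
    generalize starDensity ħ 𝒪 x.2 z = d
    have h := integrable_slice_kernel (m := m) hk hl y.1 y.2
    exact (h.comp_mul_left y.1).const_mul d
  · have hn : ∀ {f : G × G → ℂ}, IsBoundedCompact f →
        IsBoundedCompact fun y => ((‖f y‖ : ℝ) : ℂ) := by
      rintro f ⟨h1, ⟨C, hC⟩, K, hK, hK0⟩
      exact ⟨Complex.continuous_ofReal.comp_stronglyMeasurable h1.norm, ⟨C, fun y => by simpa using hC y⟩,
        K, hK, fun y hy => by simp [hK0 y hy]⟩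
    have h1 := (h𝒪.integrable_starDensity_mul (ħ := ħ) ((hn hk).kernelComp (m := m) (hn hl)) x).norm
    refine h1.congr (Eventually.of_forall fun z => ?_)
    have h2 := integral_starKernel (m := m) (ħ := ħ) (𝒪 := 𝒪) (fun y => ((‖k y‖ : ℝ) : ℂ))
      (fun y => ((‖l y‖ : ℝ) : ℂ)) x z
    simp only
    rw [← h2]
    simp only [starKernel, integral_const_mul, norm_mul]
    congr 1
    simp only [← Complex.ofReal_mul]
    rw [integral_complex_ofReal, Complex.norm_real, Real.norm_of_nonneg
      (integral_nonneg fun g => by positivity)]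

/-- The transform of a composed kernel is an integral over `z = exp Z` and an intermediate point
`b`. Writing `b = a g`, with `a` the first point, and `z = g h`, left invariance turns it into a
double Haar integral in `g = exp X` and `h = exp Y`, so that `Z = X ⋄ Y`. The Jacobians `J` and the
modular factors then combine to `F(X)² F(Y)² / F(Z)`, which is `L(X, Y)` times the weights of the
two symbols. -/
lemma starIntegral_symbolMap (h𝒪 : IsExpDomain m 𝒪) {k l : G × G → ℂ} (hk : IsBoundedCompact k)
    (hl : IsBoundedCompact l) (x : G × StrongDual ℝ E) :
    starIntegral ħ m 𝒪 (symbolMap 𝒪 k) (symbolMap 𝒪 l) x =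
      invMomentumFourier ħ m (symbolMap 𝒪 (kernelComp m k l)) x := by
  have hH := h𝒪.stronglyMeasurable_starKernel (ħ := ħ) hk.1 hl.1 x
  have hH' : StronglyMeasurable fun y : G × G => starKernel ħ 𝒪 k l x y.1 (y.1 * y.2) :=
    hH.comp_measurable (by fun_prop : Measurable fun y : G × G => (y.1, y.1 * y.2))
  rw [← h𝒪.integral_starDensity_mul (hk.kernelComp hl).1]
  simp only [← integral_starKernel (m := m)]
  rw [← integral_prod_symm _ (h𝒪.integrable_starKernel hk hl x)]
  -- The shear `(g, h) ↦ (g, g h)` realizes the substitution `z = g h`.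
  have hmp := measurePreserving_prod_mul m m
  have h1 : ∫ y : G × G, starKernel ħ 𝒪 k l x y.1 y.2 ∂(m.prod m) =
      ∫ y : G × G, starKernel ħ 𝒪 k l x y.1 (y.1 * y.2) ∂(m.prod m) := by
    conv_lhs => rw [← hmp.map_eq]
    exact integral_map hmp.measurable.aemeasurable hH.aestronglyMeasurable
  rw [h1, h𝒪.integral_prod_lieExp hH', starIntegral,
    ← integral_indicator (h𝒪.isOpen.measurableSet.prod h𝒪.isOpen.measurableSet)]
  refine integral_congr_ae (Eventually.of_forall fun ⟨X, Y⟩ => ?_)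
  simp only
  by_cases hXY : (X, Y) ∈ bchDomain G 𝒪
  · obtain ⟨hX, hY, hZ'⟩ := hXY
    simp only at hX hY hZ'
    rw [indicator_of_mem (show (X, Y) ∈ 𝒪 ×ˢ 𝒪 from ⟨hX, hY⟩), jacL,
      if_pos (show (X, Y) ∈ bchDomain G 𝒪 from ⟨hX, hY, hZ'⟩)]
    have hZ : bch G 𝒪 X Y ∈ 𝒪 := lieLog_mem hZ'
    have hXYZ : lieExp G X * lieExp G Y = lieExp G (bch G 𝒪 X Y) := (lieExp_lieLog hZ').symm
    simp only
    rw [starKernel, hXYZ, h𝒪.logExt_lieExp hZ]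
    have hmod : modSqrt (lieExp G X) * modSqrt (lieExp G Y) =
        modSqrt (lieExp G (bch G 𝒪 X Y)) := by rw [← hXYZ, modSqrt_mul]
    set Z := bch G 𝒪 X Y
    have hp1 : pairMap G (x.1 * lieExp G (-(1 / 2 : ℝ) • Z) * lieExp G ((1 / 2 : ℝ) • X), X) =
        ((pairMap G (x.1, Z)).1, (pairMap G (x.1, Z)).1 * lieExp G X) := by
      refine Prod.ext ?_ ?_
      · simp only [pairMap]; rw [h𝒪.lieExp_neg_half X]; group
      · simp only [pairMap]; rw [mul_assoc, h𝒪.lieExp_half_mul_half]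
    have hp2 : pairMap G (x.1 * lieExp G ((1 / 2 : ℝ) • Z) * lieExp G (-(1 / 2 : ℝ) • Y), Y) =
        ((pairMap G (x.1, Z)).1 * lieExp G X, (pairMap G (x.1, Z)).2) := by
      have e : (pairMap G (x.1, Z)).1 * lieExp G X =
          (pairMap G (x.1, Z)).2 * (lieExp G Y)⁻¹ := by
        rw [h𝒪.pairMap_snd, mul_assoc, ← hXYZ, mul_inv_cancel_right]
      rw [e]
      refine Prod.ext ?_ ?_
      · simp only [pairMap]
        rw [mul_assoc, h𝒪.lieExp_neg_half Y, ← mul_inv_rev, h𝒪.lieExp_half_mul_half]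
      · simp only [pairMap]; rw [h𝒪.lieExp_neg_half Y]; group
    rw [symbolMap_of_mem _ hX, symbolMap_of_mem _ hY, hp1, hp2, starDensity,
      indicator_of_mem (mem_image_of_mem _ hZ), h𝒪.logExt_lieExp hZ, ← hmod]
    -- One factor `F(X)` comes from the symbol and one from `L`, likewise for `Y`. Multiplicativity
    -- of `√Δ` (`hmod`) has split the modular factor of `Z` accordingly.
    have e1 : (jacF G X : ℂ) ^ 2 = jacJ G 𝒪 X * modSqrt (lieExp G X) := by
      exact_mod_cast h𝒪.jacF_sq_eq hX
    have e2 : (jacF G Y : ℂ) ^ 2 = jacJ G 𝒪 Y * modSqrt (lieExp G Y) := by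
      exact_mod_cast h𝒪.jacF_sq_eq hY
    push_cast
    linear_combination (jacF G Y ^ 2 * e1 + jacJ G 𝒪 X * modSqrt (lieExp G X) * e2) *
      (Complex.exp (-(Complex.I / ħ) * (x.2 Z : ℂ)) / jacF G Z *
        (k ((pairMap G (x.1, Z)).1, (pairMap G (x.1, Z)).1 * lieExp G X) *
         l ((pairMap G (x.1, Z)).1 * lieExp G X, (pairMap G (x.1, Z)).2)))
  -- Off the domain of `⋄` both sides vanish: `L` by its default value, the other side by the
  -- indicator of `𝒪 ×ˢ 𝒪` or because the density is supported in `𝒰`.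
  · rw [jacL, if_neg hXY, Complex.ofReal_zero, mul_zero]
    by_cases h : (X, Y) ∈ 𝒪 ×ˢ 𝒪
    · rw [indicator_of_mem h]
      have h0 : lieExp G X * lieExp G Y ∉ lieExp G '' 𝒪 := fun h' => hXY ⟨h.1, h.2, h'⟩
      simp only [starKernel, starDensity, indicator_of_notMem h0, zero_mul, mul_zero]
    · rw [indicator_of_notMem h]

end IsExpDomain

end StarProduct

/-! ### Conjugation and star-product in terms of kernels -/

section Quantization

variable {E : Type*} [NormedAddCommGroup E] [NormedSpace ℝ E] [FiniteDimensional ℝ E]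
  [MeasurableSpace E] [BorelSpace E]
  {G : Type*} [TopologicalSpace G] [T2Space G] [SecondCountableTopology G]
  [ChartedSpace E G] [Group G] [LieGroup 𝓘(ℝ, E) ∞ G]
  [MeasurableSpace G] [BorelSpace G] {m : Measure G} [m.IsHaarMeasure] {𝒪 : Set E}
  [IsTopologicalGroup G] [LocallyCompactSpace G] [(algMeasure (E := E) m).IsAddHaarMeasure]
  {ħ : ℝ}

lemma norm_kernelInvol {X : Type*} [MeasurableSpace X] {μ : Measure X} [SigmaFinite μ]
    (f : Lp ℂ 2 (μ.prod μ)) : ‖kernelInvol f‖ = ‖f‖ := by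
  have h := inner_kernelInvol f f
  rw [HilbertAlgebra.inner_self_eq_ofReal_sq, HilbertAlgebra.inner_self_eq_ofReal_sq] at h
  exact (sq_eq_sq₀ (norm_nonneg _) (norm_nonneg _)).1 (by exact_mod_cast h)

lemma continuous_kernelInvol {X : Type*} [MeasurableSpace X] {μ : Measure X} [SigmaFinite μ] :
    Continuous (kernelInvol : Lp ℂ 2 (μ.prod μ) → Lp ℂ 2 (μ.prod μ)) :=
  (AddMonoidHomClass.isometry_of_norm (AddMonoidHom.mk' kernelInvol kernelInvol_add)
    norm_kernelInvol).continuous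

lemma Lp.continuous_star {X : Type*} [MeasurableSpace X] {μ : Measure X} :
    Continuous fun f : Lp ℂ 2 μ => star f := by
  refine (Isometry.of_dist_eq fun f g => ?_).continuous
  rw [Lp.dist_def, Lp.dist_def]
  congr 1
  refine eLpNorm_congr_norm_ae ?_
  filter_upwards [Lp.coeFn_star f, Lp.coeFn_star g] with x h1 h2
  rw [Pi.sub_apply, Pi.sub_apply, h1, h2, Pi.star_apply, Pi.star_apply, ← star_sub, norm_star]

/-- The set `S` lies in the graph of a continuous bilinear map and contains its restriction to a
dense set, so its closure is the whole graph. Thus extension by continuity is unambiguous. -/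
lemma mem_closure_graph_iff {K H : Type*} [NormedAddCommGroup K] [InnerProductSpace ℂ K]
    [NormedAddCommGroup H] [InnerProductSpace ℂ H] (V : K ≃ₗᵢ[ℂ] H) (M : K →L[ℂ] K →L[ℂ] K)
    {D : Set K} (hD : Dense D) {S : Set (H × H × H)}
    (h1 : ∀ u ∈ D, ∀ v ∈ D, (V u, V v, V (M u v)) ∈ S)
    (h2 : ∀ t ∈ S, t.2.2 = V (M (V.symm t.1) (V.symm t.2.1))) (u v : K) (h : H) :
    (V u, V v, h) ∈ closure S ↔ h = V (M u v) := by
  have hmul : Continuous fun z : K × K => M z.1 z.2 :=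
    (M.continuous.comp continuous_fst).clm_apply continuous_snd
  constructor
  · intro hh
    have hcl : IsClosed {t : H × H × H | t.2.2 = V (M (V.symm t.1) (V.symm t.2.1))} :=
      isClosed_eq (continuous_snd.comp continuous_snd) (V.continuous.comp (hmul.comp
        ((V.symm.continuous.comp continuous_fst).prodMk
          (V.symm.continuous.comp (continuous_fst.comp continuous_snd)))))
    simpa using! hcl.closure_subset_iff.2 h2 hh
  · rintro rfl
    have hc : Continuous fun z : K × K => (V z.1, V z.2, V (M z.1 z.2)) :=
      (V.continuous.comp continuous_fst).prodMk
        ((V.continuous.comp continuous_snd).prodMk (V.continuous.comp hmul))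
    exact map_mem_closure (f := fun z : K × K => (V z.1, V z.2, V (M z.1 z.2))) hc
      ((hD.prod hD) (u, v)) fun z hz => h1 _ hz.1 _ hz.2

namespace IsExpDomain

/-- Exchanging the two points keeps their midpoint and reverses their difference; `F` and `𝒪` are
symmetric. -/
lemma symbolMap_kernelStar (h𝒪 : IsExpDomain m 𝒪) (k : G × G → ℂ) (q : G) (X : E) :
    symbolMap 𝒪 (kernelStar k) (q, X) = conj (symbolMap 𝒪 k (q, -X)) := by
  by_cases hX : X ∈ 𝒪
  · rw [symbolMap_of_mem _ hX, symbolMap_of_mem _ (h𝒪.neg_mem hX), map_mul, Complex.conj_ofReal,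
      jacF_neg, kernelStar]
    congr 3
    simp [pairMap]
  · rw [symbolMap_of_notMem _ hX, symbolMap_of_notMem _ fun h => hX (by simpa using h𝒪.neg_mem h),
      map_zero]

lemma invMomentumFourier_kernelStar (h𝒪 : IsExpDomain m 𝒪) (k : G × G → ℂ)
    (x : G × StrongDual ℝ E) :
    invMomentumFourier ħ m (symbolMap 𝒪 (kernelStar k)) x =
      conj (invMomentumFourier ħ m (symbolMap 𝒪 k) x) := by
  rw [invMomentumFourier, invMomentumFourier, ← integral_conj, ← integral_neg_eq_self]
  refine integral_congr_ae (Eventually.of_forall fun X => ?_)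
  simp only
  rw [h𝒪.symbolMap_kernelStar, neg_neg, map_mul, ← Complex.exp_conj]
  congr 2
  simp only [map_mul, map_neg, map_div₀, Complex.conj_I, Complex.conj_ofReal, Complex.ofReal_neg]
  ring

/-- Both sides are continuous in `u`. On test kernels the transform is an honest integral, and the
substitution `X ↦ -X` proves the claim. -/
lemma toLp_quantization_kernelInvol (h𝒪 : IsExpDomain m 𝒪) (hħ : ħ ≠ 0)
    (u : Lp ℂ 2 (m.prod m)) : (h𝒪.quantization hħ (kernelInvol u)).toLp =
      star (h𝒪.quantization hħ u).toLp := by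
  have hc : Continuous fun u => (h𝒪.quantization hħ u).toLp :=
    ((momentumIsometry m hħ).continuous.comp h𝒪.symbolIsometry.continuous)
  have hcl : IsClosed {u : Lp ℂ 2 (m.prod m) | (h𝒪.quantization hħ (kernelInvol u)).toLp =
      star (h𝒪.quantization hħ u).toLp} :=
    isClosed_eq (hc.comp continuous_kernelInvol) (Lp.continuous_star.comp hc)
  refine hcl.closure_subset_iff.2 ?_ (dense_testKernels (E := E) u)
  rintro u ⟨k, hk, hu⟩
  have hb := hk.isBoundedCompact
  have e1 : u = (hb.memLp (m.prod m) 2).toLp k := Lp.ext (hu.trans (MemLp.coeFn_toLp _).symm)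
  have e2 : kernelInvol u = (hb.kernelStar.memLp (m.prod m) 2).toLp _ :=
    Lp.ext ((coeFn_kernelInvol u).trans ((kernelStar_congr hu).trans (MemLp.coeFn_toLp _).symm))
  have h1 := h𝒪.fn_quantization hħ hb
  have h2 := h𝒪.fn_quantization hħ hb.kernelStar
  rw [← e1] at h1
  rw [← e2] at h2
  refine Lp.ext (h2.trans (EventuallyEq.trans ?_ (Lp.coeFn_star _).symm))
  filter_upwards [h1] with x hx
  rw [h𝒪.invMomentumFourier_kernelStar, ← hx]
  rfl

lemma conjLM_quantization (h𝒪 : IsExpDomain m 𝒪) (hħ : ħ ≠ 0) (u : Lp ℂ 2 (m.prod m)) :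
    conjLM (h𝒪.quantization hħ u) = h𝒪.quantization hħ (kernelInvol u) := by
  have h1 : (h𝒪.quantization hħ (kernelInvol u)).fn =ᵐ[measL ħ m]
      fun x => conj ((h𝒪.quantization hħ u).fn x) := by
    rw [LM.fn, h𝒪.toLp_quantization_kernelInvol hħ]
    exact Lp.coeFn_star _
  have h2 := Classical.epsilon_spec (p := fun g : LM ħ m 𝒪 => g.fn =ᵐ[measL ħ m]
    fun x => conj ((h𝒪.quantization hħ u).fn x)) ⟨_, h1⟩
  exact LM.ext_fn (h2.trans h1.symm)

lemma starGraph_subset (h𝒪 : IsExpDomain m 𝒪) (hħ : ħ ≠ 0) {t : LM ħ m 𝒪 × LM ħ m 𝒪 × LM ħ m 𝒪}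
    (ht : t ∈ starGraph ħ m 𝒪) : t.2.2 = h𝒪.quantization hħ
      (kernelMulL m ((h𝒪.quantization hħ).symm t.1) ((h𝒪.quantization hħ).symm t.2.1)) := by
  obtain ⟨φ, χ, hφ, hχ, h1, h2, h3⟩ := ht
  obtain ⟨k, hk, rfl⟩ := h𝒪.isTildeF_iff.1 hφ
  obtain ⟨l, hl, rfl⟩ := h𝒪.isTildeF_iff.1 hχ
  have bk := hk.isBoundedCompact
  have bl := hl.isBoundedCompact
  have e1 := LM.ext_fn (h1.trans (h𝒪.fn_quantization hħ bk).symm)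
  have e2 := LM.ext_fn (h2.trans (h𝒪.fn_quantization hħ bl).symm)
  rw [e1, e2, LinearIsometryEquiv.symm_apply_apply, LinearIsometryEquiv.symm_apply_apply]
  have bkl := bk.kernelComp (m := m) bl
  have e3 : kernelMulL m ((bk.memLp (m.prod m) 2).toLp k) ((bl.memLp (m.prod m) 2).toLp l) =
      (bkl.memLp (m.prod m) 2).toLp _ :=
    Lp.ext ((coeFn_kernelMul _ _).trans ((kernelComp_congr (MemLp.coeFn_toLp _)
      (MemLp.coeFn_toLp _)).trans (MemLp.coeFn_toLp _).symm))
  rw [e3]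
  refine LM.ext_fn (h3.trans (EventuallyEq.trans ?_ (h𝒪.fn_quantization hħ bkl).symm))
  exact Eventually.of_forall fun x => h𝒪.starIntegral_symbolMap bk bl x

lemma quantization_mem_starGraph (h𝒪 : IsExpDomain m 𝒪) (hħ : ħ ≠ 0) {u v : Lp ℂ 2 (m.prod m)}
    (hu : u ∈ testKernels E m) (hv : v ∈ testKernels E m) :
    (h𝒪.quantization hħ u, h𝒪.quantization hħ v, h𝒪.quantization hħ (kernelMulL m u v)) ∈
      starGraph ħ m 𝒪 := by
  obtain ⟨k, hk, hu⟩ := hu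
  obtain ⟨l, hl, hv⟩ := hv
  have bk := hk.isBoundedCompact
  have bl := hl.isBoundedCompact
  have bkl := bk.kernelComp (m := m) bl
  have e1 : u = (bk.memLp (m.prod m) 2).toLp k := Lp.ext (hu.trans (MemLp.coeFn_toLp _).symm)
  have e2 : v = (bl.memLp (m.prod m) 2).toLp l := Lp.ext (hv.trans (MemLp.coeFn_toLp _).symm)
  have e3 : kernelMulL m u v = (bkl.memLp (m.prod m) 2).toLp _ :=
    Lp.ext ((coeFn_kernelMul _ _).trans ((kernelComp_congr hu hv).trans
      (MemLp.coeFn_toLp _).symm))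
  refine ⟨symbolMap 𝒪 k, symbolMap 𝒪 l, h𝒪.isTildeF_iff.2 ⟨k, hk, rfl⟩,
    h𝒪.isTildeF_iff.2 ⟨l, hl, rfl⟩, ?_, ?_, ?_⟩
  · rw [e1]; exact h𝒪.fn_quantization hħ bk
  · rw [e2]; exact h𝒪.fn_quantization hħ bl
  · rw [e3]
    exact (h𝒪.fn_quantization hħ bkl).trans
      (Eventually.of_forall fun x => (h𝒪.starIntegral_symbolMap bk bl x).symm)

/-- The closure of the graph of the star-product is itself the graph of composition, so the value
selected in `starProd` is forced. -/
lemma starProd_quantization (h𝒪 : IsExpDomain m 𝒪) (hħ : ħ ≠ 0) (u v : Lp ℂ 2 (m.prod m)) :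
    starProd (h𝒪.quantization hħ u) (h𝒪.quantization hħ v) =
      h𝒪.quantization hħ (kernelMulL m u v) := by
  have key := mem_closure_graph_iff (h𝒪.quantization (ħ := ħ) hħ) (kernelMulL m)
    (dense_testKernels (E := E) (m := m)) (fun u hu v hv => h𝒪.quantization_mem_starGraph hħ hu hv)
    (fun t ht => h𝒪.starGraph_subset hħ ht) u v
  have h2 := Classical.epsilon_spec (p := fun h => (h𝒪.quantization hħ u, h𝒪.quantization hħ v, h) ∈
    closure (starGraph ħ m 𝒪)) ⟨_, (key _).2 rfl⟩
  exact (key _).1 h2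

lemma dense_FM (h𝒪 : IsExpDomain m 𝒪) (hħ : ħ ≠ 0) : Dense (FM ħ m 𝒪) := by
  refine (DenseRange.dense_image (h𝒪.quantization hħ).surjective.denseRange
    (h𝒪.quantization hħ).continuous (dense_testKernels (E := E) (m := m))).mono ?_
  rintro _ ⟨u, ⟨k, hk, hu⟩, rfl⟩
  refine (h𝒪.mem_FM_iff hħ).2 ⟨k, hk, ?_⟩
  congr 1
  exact Lp.ext (hu.trans (MemLp.coeFn_toLp _).symm)

/-- The Hilbert algebra `ℒ(M)`. -/
def observables (h𝒪 : IsExpDomain m 𝒪) (hħ : ħ ≠ 0) {w : Type*} [DecidableEq w] [Countable w]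
    (b : HilbertBasis w ℂ (Lp ℂ 2 m)) : HilbertAlgebra (Finset w) (LM ħ m 𝒪) :=
  (kernelAlgebra b).transport (h𝒪.quantization hħ)

variable {w : Type*} [DecidableEq w] [Countable w] (b : HilbertBasis w ℂ (Lp ℂ 2 m))

lemma conjLM_eq (h𝒪 : IsExpDomain m 𝒪) (hħ : ħ ≠ 0) (f : LM ħ m 𝒪) :
    conjLM f = (h𝒪.observables hħ b).invol f := by
  obtain ⟨u, rfl⟩ := (h𝒪.quantization hħ).surjective f
  rw [h𝒪.conjLM_quantization hħ]
  exact (HilbertAlgebra.transport_invol (kernelAlgebra b) (h𝒪.quantization hħ) u).symm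

lemma starProd_eq (h𝒪 : IsExpDomain m 𝒪) (hħ : ħ ≠ 0) (f g : LM ħ m 𝒪) :
    starProd f g = (h𝒪.observables hħ b).mul f g := by
  obtain ⟨u, rfl⟩ := (h𝒪.quantization hħ).surjective f
  obtain ⟨v, rfl⟩ := (h𝒪.quantization hħ).surjective g
  rw [h𝒪.starProd_quantization hħ]
  exact (HilbertAlgebra.transport_mul (kernelAlgebra b) (h𝒪.quantization hħ) u v).symm

lemma leftMul_eq (h𝒪 : IsExpDomain m 𝒪) (hħ : ħ ≠ 0) (f : LM ħ m 𝒪) :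
    leftMul f = (h𝒪.observables hħ b).mul f := by
  have h := Classical.epsilon_spec (p := fun T : LM ħ m 𝒪 →L[ℂ] LM ħ m 𝒪 =>
    ∀ h, T h = starProd f h) ⟨_, fun h => (h𝒪.starProd_eq b hħ f h).symm⟩
  exact ContinuousLinearMap.ext fun g => (h g).trans (h𝒪.starProd_eq b hħ f g)

omit [Countable w] [DecidableEq w] in
lemma integral_fn_mul_fn (h𝒪 : IsExpDomain m 𝒪) (hħ : ħ ≠ 0) (f g : LM ħ m 𝒪) :
    ∫ x, f.fn x * g.fn x ∂(measL (E := E) ħ m) = inner ℂ (conjLM f) g := by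
  obtain ⟨u, rfl⟩ := (h𝒪.quantization hħ).surjective f
  have h1 : (conjLM (h𝒪.quantization hħ u)).toLp = star (h𝒪.quantization hħ u).toLp := by
    rw [h𝒪.conjLM_quantization hħ, h𝒪.toLp_quantization_kernelInvol hħ]
  change _ = inner ℂ (conjLM (h𝒪.quantization hħ u)).toLp g.toLp
  rw [h1, L2.inner_def]
  refine integral_congr_ae ?_
  filter_upwards [Lp.coeFn_star (h𝒪.quantization hħ u).toLp] with x hx
  rw [hx, RCLike.inner_apply]
  simp only [Pi.star_apply, RCLike.star_def, Complex.conj_conj, LM.fn]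
  ring

end IsExpDomain

end Quantization

/-! ### States of the algebra generated by a Hilbert algebra -/

namespace HilbertAlgebra

variable {ι H : Type*} [SemilatticeSup ι] [Nonempty ι] [NormedAddCommGroup H]
  [InnerProductSpace ℂ H] [CompleteSpace H] (A : HilbertAlgebra ι H)

omit [Nonempty ι] [CompleteSpace H] in
lemma hasTr_sq_mul (f ρ : H) :
    A.HasTr (A.mul (A.mul (A.invol f) f) ρ) (inner ℂ f (A.mul f ρ)) :=
  ⟨f, A.mul f ρ, A.mul_assoc _ _ _, rfl⟩

/-- Positivity extends from the dense set by continuity. Existence of the trace makes `⟨e_i, ρ⟩`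
converge to `1`, hence eventually at most `2`, which is the bound `exists_sqrt` asks for. The trace
of `σ σ` is `‖σ‖²`, which fixes the norm. -/
theorem exists_sqrt_of_hasTr {F : Set H} (hF : Dense F) {ρ : H} (htr : A.HasTr ρ 1)
    (hpos : ∀ f ∈ F, ∃ t : ℂ, A.HasTr (A.mul (A.mul (A.invol f) f) ρ) t ∧ 0 ≤ t) :
    ∃ σ, A.invol σ = σ ∧ A.mul σ σ = ρ ∧ ‖σ‖ ^ 2 = 1 := by
  have h1 := A.inner_nonneg_of_dense hF (ρ := ρ) fun f hf => by
    obtain ⟨t, ht, h0⟩ := hpos f hf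
    rwa [(A.hasTr_sq_mul f ρ).unique ht]
  have h2 : Tendsto (fun i => (inner ℂ (A.unit i) ρ).re) atTop (𝓝 1) :=
    (Complex.continuous_re.tendsto 1).comp htr.tendsto
  obtain ⟨σ, hσ, rfl⟩ := A.exists_sqrt (A.nonneg_mul_of_inner_nonneg h1)
    (h2.eventually_le_const one_lt_two).frequently
  refine ⟨σ, hσ, rfl, ?_⟩
  have h3 : A.HasTr (A.mul σ σ) (inner ℂ σ σ) := ⟨σ, σ, by rw [hσ], rfl⟩
  have h4 := h3.unique htr
  rw [inner_self_eq_ofReal_sq] at h4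
  exact_mod_cast h4

variable {B : NonUnitalStarSubalgebra ℂ (H →L[ℂ] H)} (hB : (B : Set (H →L[ℂ] H)) =
  closure (range A.mul)) {J : H → B} (hJ : ∀ f, (J f : H →L[ℂ] H) = A.mul f)

include hB hJ in
lemma ext_functional {Λ Λ' : B →L[ℂ] ℂ} (h : ∀ f, Λ (J f) = Λ' (J f)) :
    Λ = Λ' := by
  have hd : DenseRange J := by
    intro a
    rw [closure_subtype]
    have ha : (a : H →L[ℂ] H) ∈ closure (range A.mul) := by rw [← hB]; exact a.2
    refine closure_mono ?_ ha
    rintro _ ⟨f, rfl⟩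
    exact ⟨J f, ⟨f, rfl⟩, hJ f⟩
  refine ContinuousLinearMap.ext fun a => ?_
  have := hd.equalizer Λ.continuous Λ'.continuous (funext h)
  exact congrFun this a

include hJ in
lemma mem_of_coe_eq (f : H) : A.mul f ∈ B := by rw [← hJ]; exact (J f).2

include hJ in
lemma vectorFunctional_coe {σ : H} (hσ : A.invol σ = σ) (f : H) :
    vectorFunctional B σ (J f) = inner ℂ (A.invol f) (A.mul σ σ) := by
  rw [vectorFunctional_apply, hJ, A.inner_mul_self hσ]

include hB hJ in
-- The operator norm is dominated by the Hilbert space norm, so the state is represented on `H` by a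
-- vector `ρ` by Riesz. Evaluation at squares gives positivity, and `‖Λ‖ = 1` bounds `⟨e_i, ρ⟩`
-- because left multiplication by `e_i` is a contraction. So `ρ = σ σ`, and the norm formula for
-- vector functionals returns `‖σ‖ = 1`.
theorem exists_density {Λ : B →L[ℂ] ℂ} (hΛ : ‖Λ‖ = 1) (hpos : ∀ a : B, 0 ≤ Λ (star a * a)) :
    ∃ σ, A.invol σ = σ ∧ ‖σ‖ ^ 2 = 1 ∧ Λ = vectorFunctional B σ ∧
      A.HasTr (A.mul σ σ) 1 ∧ (∀ f, 0 ≤ inner ℂ f (A.mul f (A.mul σ σ))) := by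
  have hmem := A.mem_of_coe_eq hJ
  let J' : H →L[ℂ] B := A.mul.codRestrict B.toNonUnitalSubalgebra.toSubmodule hmem
  have hJJ : ∀ f, J' f = J f := fun f => Subtype.ext (hJ f).symm
  -- The involution makes the pairing with `ρ` linear in `f` in the form `⟨invol f, ρ⟩`, which is
  -- the trace of the product `f ρ`.
  set ρ : H := A.invol ((InnerProductSpace.toDual ℂ H).symm (Λ.comp J')) with hρ
  have hΛρ : ∀ f, Λ (J f) = inner ℂ (A.invol f) ρ := by
    intro f
    rw [hρ, A.inner_invol, InnerProductSpace.toDual_symm_apply, ← hJJ]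
    rfl
  have h0 : ∀ f, 0 ≤ inner ℂ f (A.mul f ρ) := by
    intro f
    have h1 := hpos (J f)
    have h2 : star (J f) * J f = J (A.mul (A.invol f) f) := by
      refine Subtype.ext ?_
      rw [hJ]
      change star (J f : H →L[ℂ] H) * (J f : H →L[ℂ] H) = _
      rw [hJ, ContinuousLinearMap.star_eq_adjoint, A.adjoint_mul]
      exact ContinuousLinearMap.ext fun h => (A.mul_assoc _ _ _).symm
    rw [h2, hΛρ, A.invol_mul, A.invol_invol, A.inner_mul, A.invol_invol] at h1
    exact h1
  have hbd : ∀ i, (inner ℂ (A.unit i) ρ).re ≤ 1 := by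
    intro i
    have h1 := hΛρ (A.unit i)
    rw [A.invol_unit] at h1
    rw [← h1]
    refine (Complex.re_le_norm _).trans ((Λ.le_opNorm _).trans ?_)
    rw [hΛ, one_mul]
    change ‖(J (A.unit i) : H →L[ℂ] H)‖ ≤ 1
    rw [hJ]
    exact ContinuousLinearMap.opNorm_le_bound _ zero_le_one fun f => by
      rw [one_mul]; exact A.norm_unit_mul_le i f
  obtain ⟨σ, hσ, hσρ⟩ := A.exists_sqrt (A.nonneg_mul_of_inner_nonneg h0)
    (Eventually.of_forall hbd).frequently
  have hΛσ : Λ = vectorFunctional B σ := A.ext_functional hB hJ fun f => by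
    rw [A.vectorFunctional_coe hJ hσ, hΛρ, hσρ]
  have hnorm : ‖σ‖ ^ 2 = 1 := by rw [← A.norm_vectorFunctional hmem, ← hΛσ, hΛ]
  refine ⟨σ, hσ, hnorm, hΛσ, ⟨σ, σ, by rw [hσ], ?_⟩, by rw [hσρ]; exact h0⟩
  rw [inner_self_eq_ofReal_sq]
  exact_mod_cast hnorm.symm

omit [Nonempty ι] [CompleteSpace H] in
lemma eq_of_inner_invol_eq {ρ ρ' : H} (h : ∀ f, inner ℂ (A.invol f) ρ = inner ℂ (A.invol f) ρ') :
    ρ = ρ' :=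
  ext_inner_left ℂ fun f => by rw [← A.invol_invol f, h]

end HilbertAlgebra

end LieStar

end

/-! ### States and quasi-probability distributions -/

theorem theorem5
    {E : Type*} [NormedAddCommGroup E] [NormedSpace ℝ E] [FiniteDimensional ℝ E]
    [MeasurableSpace E] [BorelSpace E]
    {G : Type*} [TopologicalSpace G] [T2Space G] [SecondCountableTopology G]
    [ChartedSpace E G] [Group G] [LieGroup 𝓘(ℝ, E) ∞ G]
    [MeasurableSpace G] [BorelSpace G]
    (m : MeasureTheory.Measure G) [m.IsHaarMeasure]
    (𝒪 : Set E) (h𝒪 : LieStar.IsExpDomain m 𝒪)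
    (ħ : ℝ) (hħ : ħ ≠ 0) :
    (∀ ρ : LieStar.LM ħ m 𝒪, LieStar.IsQuasiDensity ρ →
      (∃! Λ : LieStar.AM ħ m 𝒪 →L[ℂ] ℂ, LieStar.IsLambda ρ Λ) ∧
      ∀ Λ : LieStar.AM ħ m 𝒪 →L[ℂ] ℂ, LieStar.IsLambda ρ Λ → LieStar.IsState Λ) ∧
    (∀ Λ : LieStar.AM ħ m 𝒪 →L[ℂ] ℂ, LieStar.IsState Λ →
      ∃! ρ : LieStar.LM ħ m 𝒪, LieStar.IsQuasiDensity ρ ∧ LieStar.IsLambda ρ Λ) := by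
  have : IsTopologicalGroup G := topologicalGroup_of_lieGroup 𝓘(ℝ, E) (∞ : WithTop ℕ∞)
  have : LocallyCompactSpace G := Manifold.locallyCompact_of_finiteDimensional 𝓘(ℝ, E) (M := G)
  have : (LieStar.algMeasure (E := E) m).IsAddHaarMeasure := h𝒪.isAddHaarMeasure_algMeasure
  -- These facts let instance search find that `L²(G)` is second countable, hence that its Hilbert
  -- basis is countable.
  have : Fact ((1 : ℝ≥0∞) ≤ 2) := ⟨one_le_two⟩
  have : Fact ((2 : ℝ≥0∞) ≠ ⊤) := ⟨ENNReal.ofNat_ne_top⟩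
  classical
  obtain ⟨w, b, -⟩ := exists_hilbertBasis ℂ (Lp ℂ 2 m)
  have : Countable w := LieStar.Orthonormal.countable_of_secondCountable b.orthonormal
  set A := h𝒪.observables hħ b with hA
  have hconj : ∀ f : LieStar.LM ħ m 𝒪, LieStar.conjLM f = A.invol f := h𝒪.conjLM_eq b hħ
  have hstar : ∀ f g : LieStar.LM ħ m 𝒪, LieStar.starProd f g = A.mul f g := h𝒪.starProd_eq b hħ
  have htr : ∀ (u : LieStar.LM ħ m 𝒪) (t : ℂ), LieStar.HasTrace u t ↔ A.HasTr u t := by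
    intro u t
    simp only [LieStar.HasTrace, LieStar.HilbertAlgebra.HasTr, hstar, hconj]
  have hJ : ∀ f : LieStar.LM ħ m 𝒪, (LieStar.toAM f : LieStar.LM ħ m 𝒪 →L[ℂ] LieStar.LM ħ m 𝒪) =
      A.mul f := h𝒪.leftMul_eq b hħ
  have hB : (LieStar.AM ħ m 𝒪 : Set (LieStar.LM ħ m 𝒪 →L[ℂ] LieStar.LM ħ m 𝒪)) =
      closure (range A.mul) := by
    rw [← A.coe_topologicalClosure_adjoin, LieStar.AM]
    have : (LieStar.leftMul (ħ := ħ) (m := m) (𝒪 := 𝒪)) = A.mul := funext hJ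
    rw [this]
  -- Both formulas for `Λ_ρ` say the same: `f ⋆ ρ` is always in the domain of the trace, with trace
  -- `⟨conj f, ρ⟩`, and this is also the integral of the pointwise product.
  have hlam : ∀ (ρ : LieStar.LM ħ m 𝒪) (Λ : LieStar.AM ħ m 𝒪 →L[ℂ] ℂ), LieStar.IsLambda ρ Λ ↔
      ∀ f, Λ (LieStar.toAM f) = inner ℂ (A.invol f) ρ := by
    intro ρ Λ
    refine forall_congr' fun f => ?_
    rw [htr, hstar, h𝒪.integral_fn_mul_fn hħ, hconj]
    refine ⟨fun h => h.2, fun h => ⟨?_, h⟩⟩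
    rw [h]
    exact A.hasTr_mul f ρ
  refine ⟨fun ρ hρ => ?_, fun Λ hΛ => ?_⟩
  · obtain ⟨σ, hσ, hσρ, hn⟩ := A.exists_sqrt_of_hasTr (h𝒪.dense_FM hħ)
      ((htr _ _).1 hρ.integral_eq_one) fun f hf => by
        simpa only [htr, hstar, hconj] using hρ.nonneg f hf
    -- The values on `ℒ(M)` determine a continuous functional on `𝒜(M)`, so the vector functional of
    -- `σ` is the only candidate; existence, uniqueness and the state property can all be read off
    -- from it.
    have h1 : ∀ Λ, LieStar.IsLambda ρ Λ ↔
        Λ = LieStar.HilbertAlgebra.vectorFunctional (LieStar.AM ħ m 𝒪) σ := by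
      intro Λ
      rw [hlam]
      constructor
      · intro h
        exact A.ext_functional hB hJ fun f => by rw [h, A.vectorFunctional_coe hJ hσ, hσρ]
      · rintro rfl f
        rw [A.vectorFunctional_coe hJ hσ, hσρ]
    refine ⟨⟨_, (h1 _).2 rfl, fun Λ h => (h1 Λ).1 h⟩, fun Λ h => ?_⟩
    rw [(h1 Λ).1 h]
    exact ⟨(A.norm_vectorFunctional (A.mem_of_coe_eq hJ) σ).trans hn,
      LieStar.HilbertAlgebra.vectorFunctional_star_mul_self _ σ⟩
  · obtain ⟨σ, hσ, -, rfl, h1, h2⟩ := A.exists_density hB hJ hΛ.1 hΛ.2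
    have h3 := (hlam (A.mul σ σ) _).2 (A.vectorFunctional_coe hJ hσ)
    refine ⟨A.mul σ σ, ⟨⟨?_, (htr _ _).2 h1, fun f _ => ⟨_, (htr _ _).2 ?_, h2 f⟩⟩, h3⟩, ?_⟩
    · rw [hconj, A.invol_mul, hσ]
    · rw [hstar, hstar, hconj]
      exact A.hasTr_sq_mul f _
    · rintro ρ' ⟨-, h'⟩
      exact A.eq_of_inner_invol_eq fun f => by rw [← (hlam _ _).1 h' f, (hlam _ _).1 h3 f]
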